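/- Let $\zeta(s)$ denote the Riemann zeta-function. Assume the Riemann Hypothesis and that all zeros of $\zeta(s)$ are simple. Then for every fixed $\varepsilon > 0$ there is a $T_0 = T_0(\varepsilon)$ such that for all real $T \ge T_0$, $$\sum_{0<\gamma\le T} \frac{1}{|\zeta'(\rho)|^{2}} \;\ge\; \left(\frac{3}{2\pi^{3}} - \varepsilon\right) T,$$ where the sum runs over the non-trivial zeros $\rho = \tfrac12 + i\gamma$ of $\zeta(s)$ (that is, the zeros in the strip $0 < \operatorname{Re} s < 1$) with $0 < \gamma \le T$. -/

import Mathlib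

/-- The non-trivial zeros `ρ` of the Riemann zeta function (those in the critical strip)
whose ordinate `γ = Im ρ` satisfies `0 < γ ≤ T`. -/
def zetaZerosUpTo (T : ℝ) : Set ℂ :=
  {ρ : ℂ | riemannZeta ρ = 0 ∧ 0 < ρ.re ∧ ρ.re < 1 ∧ 0 < ρ.im ∧ ρ.im ≤ T}

theorem zetaZerosUpTo_finite (T : ℝ) : (zetaZerosUpTo T).Finite := by
  by_contra hinf
  have hK : IsCompact (Set.Icc (0 : ℝ) 1 ×ℂ Set.Icc 0 T) :=
    isCompact_Icc.reProdIm isCompact_Icc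
  have hsub : zetaZerosUpTo T ⊆ Set.Icc (0 : ℝ) 1 ×ℂ Set.Icc 0 T := fun s hs =>
    ⟨⟨hs.2.1.le, hs.2.2.1.le⟩, ⟨hs.2.2.2.1.le, hs.2.2.2.2⟩⟩
  obtain ⟨z, -, hz⟩ := Set.Infinite.exists_accPt_of_subset_isCompact hinf hK hsub
  have hfreq : ∃ᶠ s in nhdsWithin z {z}ᶜ, riemannZeta s = 0 :=
    (accPt_iff_frequently_nhdsNE.mp hz).mono fun s hs => hs.1
  by_cases h1 : z = 1
  · subst h1
    have hne := riemannZeta_residue_one.eventually_ne one_ne_zero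
    exact hfreq (hne.mono fun s hs h0 => hs (by simp [h0]))
  · have hana : AnalyticOnNhd ℂ riemannZeta {1}ᶜ :=
      DifferentiableOn.analyticOnNhd
        (fun s hs => (differentiableAt_riemannZeta hs).differentiableWithinAt)
        isOpen_compl_singleton
    have hconn : IsPreconnected ({1}ᶜ : Set ℂ) :=
      (isConnected_compl_singleton_of_one_lt_rank (by simp) 1).isPreconnected
    have h2 := hana.eqOn_zero_of_preconnected_of_frequently_eq_zero hconn h1 hfreq
      (show (2 : ℂ) ∈ ({1}ᶜ : Set ℂ) by simp)
    exact riemannZeta_ne_zero_of_one_le_re (s := 2) (by simp) h2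

/-- The sum of `1 / |ζ'(ρ)|²` over the non-trivial zeros `ρ = β + iγ` with `0 < γ ≤ T`. -/
noncomputable def reciprocalZetaDerivMoment (T : ℝ) : ℝ :=
  ∑ ρ ∈ (zetaZerosUpTo_finite T).toFinset, 1 / ‖deriv riemannZeta ρ‖ ^ 2

/-! The bound comes from Cauchy–Schwarz with a mollifier. Put M(s) = ∑_{n ≤ N} μ(n) n^{-s} with N =
τ^ϑ, ϑ < 1 close to 1, and let W(s) = P((s - 1/2)/(iτ)) be a polynomial weight that is nearly 1 on
most of 0 < t < τ and vanishes to high order K at both ends. Then |∑ W(ρ) M(1-ρ)/ζ'(ρ)|² ≤ ∑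
1/|ζ'(ρ)|² · ∑ W(ρ)² |M(ρ)|², and both sums on the outside are residue sums over the rectangle -1/2
≤ Re s ≤ 3/2, b ≤ Im s ≤ τ.

First moment (`exists_norm_firstMoment_sub_le`): integrate M(1-s) W(s)/ζ(s). On the right edge 1/ζ
is the Dirichlet series of μ, and only the diagonal survives, giving τ/(2π) · ∫P · S with S = ∑_{n ≤
N} μ(n)²/n. On the left edge the functional equation bounds 1/ζ.

Second moment (`exists_secondMoment_le`): integrate (ζ'/ζ)(s) M(s) M(1-s) times the weight built
from P². The right edge yields L = ∑_{n ≤ N} μ(n)² log n / n. The functional equation turns the left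
edge into a reflected copy of the right one plus the logarithmic derivative of its factor, which is
moved to the critical line; there its real part is at most log t + O(1) and it multiplies the mean
square of M. The total is at most about τ/(2π) · ∫P² · (S log τ + 2L).

With c = 6/π² and X = log N, the expected sizes S ~ cX, L ~ cX²/2 and log τ ~ X give the quotient
τ/(2π) · c/2 = 3τ/(2π³). Asymptotics for S are not needed: S ≥ cX is elementary, partial summation
gives 2L ≤ 2SX - cX² + O(1), and the resulting quotient is smallest at S = cX (`mul_quadratic_le`).

The horizontal edges need heights τ at which 1/ζ is at most a power of τ. Every interval [T-1, T]
with T large contains one (`exists_heightBound_pow`), and the vanishing of the weight absorbs that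
power. Monotonicity of the moment then passes from τ to T. -/

open Complex Set Filter Topology MeasureTheory

/-! ### Contour integrals over rectangles and the residue theorem -/

/-- The integral of `f` over the boundary of the rectangle `[a, b] × [c, d]`, anticlockwise. -/
noncomputable def rectIntegral (f : ℂ → ℂ) (a b c d : ℝ) : ℂ :=
  (∫ x : ℝ in a..b, f (x + c * I)) - (∫ x : ℝ in a..b, f (x + d * I)) +
    I * (∫ y : ℝ in c..d, f (b + y * I)) - I * (∫ y : ℝ in c..d, f (a + y * I))

theorem log_neg_eq_of_im_pos {z : ℂ} (hz : 0 < z.im) : log (-z) = log z - Real.pi * I := by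
  rw [log, log, norm_neg, arg_neg_eq_arg_sub_pi_of_im_pos hz]; push_cast; ring

theorem log_neg_eq_of_im_neg {z : ℂ} (hz : z.im < 0) : log (-z) = log z + Real.pi * I := by
  rw [log, log, norm_neg, arg_neg_eq_arg_add_pi_of_im_neg hz]; push_cast; ring

theorem hasDerivAt_horizontal (d x : ℝ) : HasDerivAt (fun x : ℝ => (x + d * I : ℂ)) 1 x := by
  simpa using (hasDerivAt_id x).ofReal_comp.add_const (d * I : ℂ)

theorem hasDerivAt_vertical (a y : ℝ) : HasDerivAt (fun y : ℝ => (a + y * I : ℂ)) I y := by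
  simpa using ((hasDerivAt_id y).ofReal_comp.mul_const I).const_add (a : ℂ)

theorem continuous_horizontal (d : ℝ) : Continuous (fun x : ℝ => (x + d * I : ℂ)) := by fun_prop

theorem continuous_vertical (a : ℝ) : Continuous (fun y : ℝ => (a + y * I : ℂ)) := by fun_prop

/-- The principal logarithm of z - ρ is a primitive on the horizontal edges and on the right edge.
The left edge crosses its cut, so log(-(z - ρ)) is used there; the two branches differ by ∓πi at the
upper and lower corners, and these differences add up to 2πi. -/
theorem rectIntegral_inv_sub {a b c d : ℝ} {ρ : ℂ} (ha : a < ρ.re) (hb : ρ.re < b)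
    (hc : c < ρ.im) (hd : ρ.im < d) :
    rectIntegral (fun z => (z - ρ)⁻¹) a b c d = 2 * Real.pi * I := by
  have hor : ∀ e : ℝ, e ≠ ρ.im → (∫ x : ℝ in a..b, ((x + e * I : ℂ) - ρ)⁻¹) =
      log (b + e * I - ρ) - log (a + e * I - ρ) := by
    intro e he
    have hm : ∀ x : ℝ, (x + e * I : ℂ) - ρ ∈ slitPlane := fun x =>
      Or.inr (by simpa using sub_ne_zero.mpr he)
    refine intervalIntegral.integral_eq_sub_of_hasDerivAt
      (f := fun x : ℝ => log (x + e * I - ρ)) (fun x _ => ?_) ?_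
    · simpa [one_div] using ((hasDerivAt_horizontal e x).sub_const ρ).clog_real (hm x)
    · refine Continuous.intervalIntegrable ?_ _ _
      exact ((continuous_horizontal e).sub continuous_const).inv₀ fun x =>
        slitPlane_ne_zero (hm x)
  have ver : I * (∫ y : ℝ in c..d, ((b + y * I : ℂ) - ρ)⁻¹) =
      log (b + d * I - ρ) - log (b + c * I - ρ) := by
    have hm : ∀ y : ℝ, (b + y * I : ℂ) - ρ ∈ slitPlane := fun y => Or.inl (by simpa using hb)
    rw [← intervalIntegral.integral_const_mul]
    refine intervalIntegral.integral_eq_sub_of_hasDerivAt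
      (f := fun y : ℝ => log (b + y * I - ρ)) (fun y _ => ?_) ?_
    · simpa [div_eq_mul_inv] using ((hasDerivAt_vertical b y).sub_const ρ).clog_real (hm y)
    · refine Continuous.intervalIntegrable ?_ _ _
      exact continuous_const.mul (((continuous_vertical b).sub continuous_const).inv₀ fun x =>
        slitPlane_ne_zero (hm x))
  have ver' : I * (∫ y : ℝ in c..d, ((a + y * I : ℂ) - ρ)⁻¹) =
      log (-(a + d * I - ρ)) - log (-(a + c * I - ρ)) := by
    have hm : ∀ y : ℝ, -((a + y * I : ℂ) - ρ) ∈ slitPlane := fun y => Or.inl (by simpa using ha)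
    rw [← intervalIntegral.integral_const_mul]
    refine intervalIntegral.integral_eq_sub_of_hasDerivAt
      (f := fun y : ℝ => log (-(a + y * I - ρ))) (fun y _ => ?_) ?_
    · have := (((hasDerivAt_vertical a y).sub_const ρ).neg).clog_real (hm y)
      convert! this using 1
      rw [Pi.neg_apply, neg_div_neg_eq, div_eq_mul_inv]
    · refine Continuous.intervalIntegrable ?_ _ _
      exact continuous_const.mul (((continuous_vertical a).sub continuous_const).inv₀ fun x =>
        neg_ne_zero.mp (slitPlane_ne_zero (hm x)))
  rw [rectIntegral, hor c hc.ne, hor d hd.ne', ver, ver',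
    log_neg_eq_of_im_pos (by simpa using hd), log_neg_eq_of_im_neg (by simpa using hc)]
  ring

section

variable {a b c d : ℝ}

theorem horizontal_mem {x e : ℝ} (hx : x ∈ Icc a b) (he : e ∈ Icc c d) :
    (x + e * I : ℂ) ∈ Icc a b ×ℂ Icc c d := by
  simpa [mem_reProdIm] using And.intro hx he

theorem rectIntegral_congr (hab : a ≤ b) (hcd : c ≤ d) {f g : ℂ → ℂ}
    (h : ∀ z ∈ Icc a b ×ℂ Icc c d, z ∉ Ioo a b ×ℂ Ioo c d → f z = g z) :
    rectIntegral f a b c d = rectIntegral g a b c d := by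
  have hH : ∀ e ∈ Icc c d, e ∉ Ioo c d →
      (∫ x : ℝ in a..b, f (x + e * I)) = ∫ x : ℝ in a..b, g (x + e * I) := fun e he he' =>
    intervalIntegral.integral_congr fun x hx => by
      rw [uIcc_of_le hab] at hx
      exact h _ (horizontal_mem hx he) (fun h' => he' (by simpa using h'.2))
  have hV : ∀ e ∈ Icc a b, e ∉ Ioo a b →
      (∫ y : ℝ in c..d, f (e + y * I)) = ∫ y : ℝ in c..d, g (e + y * I) := fun e he he' =>
    intervalIntegral.integral_congr fun y hy => by
      rw [uIcc_of_le hcd] at hy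
      exact h _ (horizontal_mem he hy) (fun h' => he' (by simpa using h'.1))
  rw [rectIntegral, rectIntegral, hH c (left_mem_Icc.2 hcd) (by simp),
    hH d (right_mem_Icc.2 hcd) (by simp), hV b (right_mem_Icc.2 hab) (by simp),
    hV a (left_mem_Icc.2 hab) (by simp)]

theorem rectIntegral_sub (hab : a ≤ b) (hcd : c ≤ d) {f g : ℂ → ℂ}
    (hf : ∀ z ∈ Icc a b ×ℂ Icc c d, z ∉ Ioo a b ×ℂ Ioo c d → ContinuousAt f z)
    (hg : ∀ z ∈ Icc a b ×ℂ Icc c d, z ∉ Ioo a b ×ℂ Ioo c d → ContinuousAt g z) :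
    rectIntegral (fun z => f z - g z) a b c d
      = rectIntegral f a b c d - rectIntegral g a b c d := by
  have hH : ∀ φ : ℂ → ℂ,
      (∀ z ∈ Icc a b ×ℂ Icc c d, z ∉ Ioo a b ×ℂ Ioo c d → ContinuousAt φ z) →
      ∀ e ∈ Icc c d, e ∉ Ioo c d →
      IntervalIntegrable (fun x : ℝ => φ (x + e * I)) volume a b := fun φ hφ e he he' => by
    refine ContinuousOn.intervalIntegrable fun x hx => ?_
    rw [uIcc_of_le hab] at hx
    exact (ContinuousAt.comp (f := fun x : ℝ => (x + e * I : ℂ))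
      (hφ _ (horizontal_mem hx he) (fun h' => he' (by simpa using h'.2)))
      (continuous_horizontal e).continuousAt).continuousWithinAt
  have hV : ∀ φ : ℂ → ℂ,
      (∀ z ∈ Icc a b ×ℂ Icc c d, z ∉ Ioo a b ×ℂ Ioo c d → ContinuousAt φ z) →
      ∀ e ∈ Icc a b, e ∉ Ioo a b →
      IntervalIntegrable (fun y : ℝ => φ (e + y * I)) volume c d := fun φ hφ e he he' => by
    refine ContinuousOn.intervalIntegrable fun y hy => ?_
    rw [uIcc_of_le hcd] at hy
    exact (ContinuousAt.comp (f := fun y : ℝ => (e + y * I : ℂ))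
      (hφ _ (horizontal_mem he hy) (fun h' => he' (by simpa using h'.1)))
      (continuous_vertical e).continuousAt).continuousWithinAt
  have hc := left_mem_Icc.2 hcd
  have hd := right_mem_Icc.2 hcd
  have ha := left_mem_Icc.2 hab
  have hb := right_mem_Icc.2 hab
  simp only [rectIntegral]
  rw [intervalIntegral.integral_sub (hH f hf c hc (by simp)) (hH g hg c hc (by simp)),
    intervalIntegral.integral_sub (hH f hf d hd (by simp)) (hH g hg d hd (by simp)),
    intervalIntegral.integral_sub (hV f hf a ha (by simp)) (hV g hg a ha (by simp)),
    intervalIntegral.integral_sub (hV f hf b hb (by simp)) (hV g hg b hb (by simp))]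
  ring

theorem rectIntegral_const_mul (k : ℂ) (f : ℂ → ℂ) :
    rectIntegral (fun z => k * f z) a b c d = k * rectIntegral f a b c d := by
  simp only [rectIntegral, intervalIntegral.integral_const_mul]
  ring

theorem rectIntegral_eq_zero (hab : a ≤ b) (hcd : c ≤ d) {f : ℂ → ℂ}
    (hf : ∀ z ∈ Icc a b ×ℂ Icc c d, DifferentiableAt ℂ f z) :
    rectIntegral f a b c d = 0 := by
  have := integral_boundary_rect_eq_zero_of_differentiableOn f (a + c * I) (b + d * I) (by
    intro z hz
    refine (hf z ?_).differentiableWithinAt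
    simpa [uIcc_of_le hab, uIcc_of_le hcd] using hz)
  simpa [rectIntegral] using this

/-- The residue theorem for a rectangle and a function with finitely many simple poles. -/
theorem rectIntegral_eq_sum_residues (hab : a ≤ b) (hcd : c ≤ d) (S : Finset ℂ) (r : ℂ → ℂ) :
    ∀ {f : ℂ → ℂ}, (∀ ρ ∈ S, ρ ∈ Ioo a b ×ℂ Ioo c d) →
    (∀ z ∈ Icc a b ×ℂ Icc c d, z ∉ S → DifferentiableAt ℂ f z) →
    (∀ ρ ∈ S, Tendsto (fun z => (z - ρ) * f z) (𝓝[≠] ρ) (𝓝 (r ρ))) →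
    rectIntegral f a b c d = 2 * Real.pi * I * ∑ ρ ∈ S, r ρ := by
  classical
  induction S using Finset.induction_on with
  | empty =>
    intro f _ hf _
    simpa using rectIntegral_eq_zero hab hcd fun z hz => hf z hz (by simp)
  | insert ρ S hρ ih =>
    intro f hS hf hr
    have hρm := hS ρ (Finset.mem_insert_self _ _)
    -- The principal part at ρ is subtracted and the removable singularity filled in with the limit,
    -- which leaves a function with poles only in S. Nothing changes on the boundary, since ρ is
    -- interior.
    set g₀ : ℂ → ℂ := fun z => f z - r ρ * (z - ρ)⁻¹ with hg₀
    set g : ℂ → ℂ := Function.update g₀ ρ (limUnder (𝓝[≠] ρ) g₀) with hg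
    have hgz : ∀ z, z ≠ ρ → g =ᶠ[𝓝 z] g₀ := fun z hz => by
      filter_upwards [isOpen_ne.mem_nhds hz] with w hw
      exact Function.update_of_ne hw _ _
    have hinv : ∀ z, z ≠ ρ → DifferentiableAt ℂ (fun z => r ρ * (z - ρ)⁻¹) z := fun z hz =>
      ((differentiableAt_id.sub_const ρ).inv (sub_ne_zero.mpr hz)).const_mul _
    have hUopen : IsOpen (Ioo a b ×ℂ Ioo c d) := isOpen_Ioo.reProdIm isOpen_Ioo
    have hUsub : Ioo a b ×ℂ Ioo c d ⊆ Icc a b ×ℂ Icc c d := fun z hz =>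
      ⟨Ioo_subset_Icc_self hz.1, Ioo_subset_Icc_self hz.2⟩
    have hnhds : (Ioo a b ×ℂ Ioo c d) \ (S : Set ℂ) ∈ 𝓝 ρ :=
      (hUopen.sdiff S.finite_toSet.isClosed).mem_nhds ⟨hρm, hρ⟩
    have hgρ : DifferentiableAt ℂ g ρ := by
      refine (differentiableOn_update_limUnder_of_isLittleO hnhds (fun z hz => ?_) ?_
        ).differentiableAt hnhds
      · have hz' : z ∉ insert ρ S := by simpa using ⟨hz.2, hz.1.2⟩
        exact ((hf z (hUsub hz.1.1) hz').sub (hinv z hz.2)).differentiableWithinAt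
      · have h1 : Tendsto (fun z => (z - ρ) * (g₀ z - g₀ ρ)) (𝓝[≠] ρ) (𝓝 0) := by
          have h2 := hr ρ (Finset.mem_insert_self _ _)
          have h3 : Tendsto (fun z : ℂ => (z - ρ) * g₀ ρ) (𝓝[≠] ρ) (𝓝 0) := by
            have : Continuous fun z : ℂ => (z - ρ) * g₀ ρ := by fun_prop
            simpa using (this.tendsto ρ).mono_left nhdsWithin_le_nhds
          have h4 := (h2.sub_const (r ρ)).sub h3
          rw [sub_self, sub_zero] at h4
          refine h4.congr' ?_
          filter_upwards [self_mem_nhdsWithin] with z hz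
          have : z - ρ ≠ 0 := sub_ne_zero.mpr hz
          simp only [hg₀]
          field_simp
        refine Asymptotics.isLittleO_of_tendsto' ?_ (h1.congr fun z => ?_)
        · filter_upwards [self_mem_nhdsWithin] with z hz h0
          exact absurd (inv_eq_zero.mp h0) (sub_ne_zero.mpr hz)
        · rw [div_inv_eq_mul, mul_comm]
    have key := ih (f := g) (fun z hz => hS z (Finset.mem_insert_of_mem hz))
      (fun z hz hzS => by
        by_cases h : z = ρ
        · rwa [h]
        · exact ((hf z hz (by simp [h, hzS])).sub (hinv z h)).congr_of_eventuallyEq (hgz z h))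
      (fun z hz => by
        have hne : z ≠ ρ := fun h => hρ (h ▸ hz)
        have h2 := hr z (Finset.mem_insert_of_mem hz)
        have h3 : Tendsto (fun w : ℂ => (w - z) * (r ρ * (w - ρ)⁻¹)) (𝓝[≠] z) (𝓝 0) := by
          have : ContinuousAt (fun w : ℂ => (w - z) * (r ρ * (w - ρ)⁻¹)) z :=
            (by fun_prop : ContinuousAt (fun w : ℂ => w - z) z).mul
              (hinv z hne).continuousAt
          simpa using this.tendsto.mono_left nhdsWithin_le_nhds
        have h4 := h2.sub h3
        rw [sub_zero] at h4
        refine h4.congr' ?_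
        filter_upwards [(hgz z hne).filter_mono nhdsWithin_le_nhds] with w hw
        rw [hw]; simp only [hg₀]; ring)
    have hbd : ∀ z ∈ Icc a b ×ℂ Icc c d, z ∉ Ioo a b ×ℂ Ioo c d → z ≠ ρ ∧ z ∉ insert ρ S :=
      fun z _ hz' => ⟨fun h => hz' (h ▸ hρm), fun h => hz' (hS z h)⟩
    have e1 : rectIntegral g a b c d = rectIntegral g₀ a b c d :=
      rectIntegral_congr hab hcd fun z hz hz' => (hgz z (hbd z hz hz').1).self_of_nhds
    have e2 : rectIntegral g₀ a b c d = rectIntegral f a b c d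
        - rectIntegral (fun z => r ρ * (z - ρ)⁻¹) a b c d :=
      rectIntegral_sub hab hcd
        (fun z hz hz' => (hf z hz (hbd z hz hz').2).continuousAt)
        (fun z hz hz' => (hinv z (hbd z hz hz').1).continuousAt)
    rw [rectIntegral_const_mul, rectIntegral_inv_sub hρm.1.1 hρm.1.2 hρm.2.1 hρm.2.2] at e2
    rw [Finset.sum_insert hρ, mul_add, ← key, e1, e2]
    ring

end

/-! ### Lower bounds for holomorphic functions away from their zeros -/

/-- Dividing by z - ρ through `dslope` keeps holomorphy and leaves the other points of S as zeros,
because they differ from ρ. -/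
theorem exists_eq_prod_sub_mul {U : Set ℂ} (hU : IsOpen U) (S : Finset ℂ) :
    ∀ {f : ℂ → ℂ}, DifferentiableOn ℂ f U → (∀ ρ ∈ S, ρ ∈ U ∧ f ρ = 0) →
      ∃ g : ℂ → ℂ, DifferentiableOn ℂ g U ∧ ∀ z, f z = (∏ ρ ∈ S, (z - ρ)) * g z := by
  classical
  induction S using Finset.induction_on with
  | empty => exact fun {f} hf _ => ⟨f, hf, by simp⟩
  | insert ρ S hρ ih =>
    intro f hf hS
    obtain ⟨hρU, hρ0⟩ := hS ρ (Finset.mem_insert_self _ _)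
    have hfac : ∀ z, f z = (z - ρ) * dslope f ρ z := fun z => by
      have := sub_smul_dslope f ρ z
      rw [smul_eq_mul, hρ0, sub_zero] at this
      exact this.symm
    obtain ⟨g, hg, hfg⟩ := ih (f := dslope f ρ)
      ((differentiableOn_dslope (hU.mem_nhds hρU)).mpr hf) fun z hz => by
        obtain ⟨h1, h2⟩ := hS z (Finset.mem_insert_of_mem hz)
        refine ⟨h1, ?_⟩
        have h3 := hfac z
        rw [h2] at h3
        exact (mul_eq_zero.mp h3.symm).resolve_left
          (sub_ne_zero.mpr fun h => hρ (h ▸ hz))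
    refine ⟨g, hg, fun z => ?_⟩
    rw [Finset.prod_insert hρ, hfac z, hfg z, mul_assoc]

/-- A disc carries a primitive h of g'/g with h(0) = 0, and g exp(-h) has zero derivative. -/
theorem exists_exp_eq_on_ball {g : ℂ → ℂ} {r : ℝ} (hr : 0 < r)
    (hg : DifferentiableOn ℂ g (Metric.ball 0 r)) (h0 : ∀ z ∈ Metric.ball (0 : ℂ) r, g z ≠ 0) :
    ∃ h : ℂ → ℂ, DifferentiableOn ℂ h (Metric.ball 0 r) ∧ h 0 = 0 ∧
      ∀ z ∈ Metric.ball (0 : ℂ) r, g z = g 0 * exp (h z) := by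
  have hd : DifferentiableOn ℂ (fun z => deriv g z / g z) (Metric.ball 0 r) :=
    (hg.deriv Metric.isOpen_ball).div hg h0
  obtain ⟨h, hh0, hh⟩ := hd.isExactOn_ball.with_val_at 0 0
  have hmem : (0 : ℂ) ∈ Metric.ball (0 : ℂ) r := Metric.mem_ball_self hr
  refine ⟨h, fun z hz => (hh z hz).differentiableAt.differentiableWithinAt, hh0, fun z hz => ?_⟩
  have hdz : ∀ z ∈ Metric.ball (0 : ℂ) r, HasDerivAt (fun z => g z * exp (-h z)) 0 z := by
    intro z hz
    have h1 := (hg.differentiableAt (Metric.isOpen_ball.mem_nhds hz)).hasDerivAt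
    have h2 := h1.fun_mul ((hh z hz).fun_neg.cexp)
    convert! h2 using 1
    have := h0 z hz
    field_simp
    ring
  have hconst := Metric.isOpen_ball.is_const_of_deriv_eq_zero
    (convex_ball (0 : ℂ) r).isPreconnected
    (fun z hz => (hdz z hz).differentiableAt.differentiableWithinAt)
    (fun z hz => (hdz z hz).deriv) hz hmem
  simp only [hh0, neg_zero, exp_zero, mul_one] at hconst
  rw [← hconst, mul_assoc, ← exp_add]
  simp

/-- On the circle R² = z z̄, so R² - ρ̄z is z times the conjugate of z - ρ. -/
theorem norm_blaschke_denominator {R : ℝ} (hR : 0 < R) {z : ℂ} (ρ : ℂ) (hz : ‖z‖ = R) :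
    ‖((R : ℂ) ^ 2 - (starRingEnd ℂ) ρ * z) / R‖ = ‖z - ρ‖ := by
  have h1 : (R : ℂ) ^ 2 = z * (starRingEnd ℂ) z := by
    rw [mul_conj, normSq_eq_norm_sq, hz]; push_cast; rfl
  have h2 : (R : ℂ) ^ 2 - (starRingEnd ℂ) ρ * z = z * (starRingEnd ℂ) (z - ρ) := by
    rw [h1, map_sub]; ring
  rw [h2, norm_div, norm_mul, RCLike.norm_conj, hz, norm_real, Real.norm_of_nonneg hR.le]
  field_simp

/-- A bounded holomorphic function on a disc that is not small at the centre has few zeros, and it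
is not small away from its zeros. The zeros are assumed to be simple. -/
theorem norm_ge_of_simple_zeros {f : ℂ → ℂ} {U : Set ℂ} {r r' R M : ℝ} (hr : 0 < r) (hr' : r < r')
    (hR : r' < R) (hU : IsOpen U) (hUR : Metric.closedBall 0 R ⊆ U) (hf : DifferentiableOn ℂ f U)
    (hM : ∀ z ∈ Metric.closedBall (0 : ℂ) R, ‖f z‖ ≤ M) (h0 : f 0 ≠ 0) (h0M : ‖f 0‖ < M)
    (S : Finset ℂ) (hS : ∀ z, z ∈ S ↔ z ∈ Metric.ball 0 r' ∧ f z = 0)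
    (hsimple : ∀ ρ ∈ S, deriv f ρ ≠ 0) :
    S.card * Real.log (R / r') ≤ Real.log (M / ‖f 0‖) ∧
    ∀ z ∈ Metric.closedBall (0 : ℂ) r,
      ‖f 0‖ * Real.exp (-(2 * Real.log (M / ‖f 0‖) * r / (r' - r))) *
        ∏ ρ ∈ S, (‖z - ρ‖ / (2 * R)) ≤ ‖f z‖ := by
  have hr'0 : 0 < r' := hr.trans hr'
  have hR0 : 0 < R := hr'0.trans hR
  have hf0 : 0 < ‖f 0‖ := norm_pos_iff.mpr h0
  have hMpos : 0 < M := hf0.trans h0M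
  have hsubR : Metric.ball (0 : ℂ) r' ⊆ U := fun z hz =>
    hUR (Metric.ball_subset_closedBall (Metric.ball_subset_ball hR.le hz))
  obtain ⟨g, hg, hfg⟩ := exists_eq_prod_sub_mul hU S hf fun ρ hρ =>
    ⟨hsubR ((hS ρ).1 hρ).1, ((hS ρ).1 hρ).2⟩
  -- Replacing each factor z - ρ by (R² - ρ̄z)/R removes the zeros in S without changing |f| on |z|
  -- = R, so the maximum principle still bounds the new function g₀ by M.
  set q : ℂ → ℂ := fun z => ∏ ρ ∈ S, (((R : ℂ) ^ 2 - (starRingEnd ℂ) ρ * z) / R) with hq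
  have hqd : Differentiable ℂ q := by
    refine Differentiable.fun_finsetProd fun ρ _ => ?_
    fun_prop
  set g₀ : ℂ → ℂ := fun z => g z * q z with hg₀
  have hg₀d : DifferentiableOn ℂ g₀ U := hg.mul hqd.differentiableOn
  have hg₀sphere : ∀ z, ‖z‖ = R → ‖g₀ z‖ ≤ M := fun z hz => by
    have : ‖g₀ z‖ = ‖f z‖ := by
      rw [hfg z, hg₀, norm_mul, norm_mul, mul_comm, hq, norm_prod, norm_prod]
      congr 1
      exact Finset.prod_congr rfl fun ρ _ => norm_blaschke_denominator hR0 ρ hz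
    rw [this]
    exact hM z (by simp [hz])
  have hg₀M : ∀ z ∈ Metric.closedBall (0 : ℂ) R, ‖g₀ z‖ ≤ M := fun z hz => by
    refine Complex.norm_le_of_forall_mem_frontier_norm_le (U := Metric.ball 0 R)
      Metric.isBounded_ball ?_ (fun w hw => ?_) (by rwa [closure_ball _ hR0.ne'])
    · exact (hg₀d.mono hUR).diffContOnCl_ball (U := Metric.closedBall 0 R) subset_rfl
    · rw [frontier_ball _ hR0.ne'] at hw
      exact hg₀sphere w (by simpa using hw)
  have hρr : ∀ ρ ∈ S, ‖ρ‖ < r' := fun ρ hρ => by simpa using ((hS ρ).1 hρ).1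
  -- Jensen's inequality: each zero costs a factor |ρ|/R < r'/R at the centre. Combined with |g₀(0)|
  -- ≤ M this bounds the number of zeros.
  have hcentre : ‖f 0‖ ≤ ‖g₀ 0‖ * (r' / R) ^ S.card := by
    have e1 : ‖f 0‖ = ‖g₀ 0‖ * ∏ ρ ∈ S, (‖ρ‖ / R) := by
      rw [hfg 0, hg₀, norm_mul, norm_mul, hq, norm_prod, norm_prod, mul_assoc,
        ← Finset.prod_mul_distrib, mul_comm]
      congr 1
      refine Finset.prod_congr rfl fun ρ _ => ?_
      simp only [zero_sub, norm_neg, mul_zero, sub_zero, norm_div, norm_pow, norm_real,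
        Real.norm_of_nonneg hR0.le]
      field_simp
    rw [e1, ← Finset.prod_const]
    gcongr with ρ hρ
    exact (hρr ρ hρ).le
  have hratio : r' / R ≤ 1 := (div_le_one hR0).mpr hR.le
  have hcentre' : ‖f 0‖ ≤ ‖g₀ 0‖ :=
    hcentre.trans (mul_le_of_le_one_right (norm_nonneg _) (pow_le_one₀ (by positivity) hratio))
  have hg₀0 : 0 < ‖g₀ 0‖ := hf0.trans_le hcentre'
  set A := Real.log (M / ‖f 0‖) with hA
  have hApos : 0 < A := Real.log_pos ((one_lt_div hf0).mpr h0M)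
  refine ⟨?_, fun z hz => ?_⟩
  · have h1 : (R / r') ^ S.card ≤ M / ‖f 0‖ := by
      rw [le_div_iff₀ hf0]
      calc (R / r') ^ S.card * ‖f 0‖
          ≤ (R / r') ^ S.card * (M * (r' / R) ^ S.card) := by
            gcongr
            refine hcentre.trans ?_
            gcongr
            exact hg₀M 0 (by simp [hR0.le])
        _ = M := by
            rw [mul_left_comm, ← mul_pow, div_mul_div_cancel₀ hr'0.ne', div_self hR0.ne', one_pow,
              mul_one]
    calc S.card * Real.log (R / r') = Real.log ((R / r') ^ S.card) := (Real.log_pow _ _).symm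
      _ ≤ A := Real.log_le_log (by positivity) h1
  -- Simplicity enters here: if g vanished at w, then w would be a zero of f, hence in S, and f
  -- would vanish there to second order.
  · have hne : ∀ w ∈ Metric.ball (0 : ℂ) r', g₀ w ≠ 0 := by
      intro w hw
      have hwr : ‖w‖ < r' := by simpa using hw
      refine mul_ne_zero (fun hgw => ?_) ?_
      · have hfw : f w = 0 := by rw [hfg, hgw, mul_zero]
        have hwS := (hS w).2 ⟨hw, hfw⟩
        refine hsimple w hwS ?_
        have h1 : HasDerivAt (fun z => ∏ ρ ∈ S, (z - ρ))
            (deriv (fun z => ∏ ρ ∈ S, (z - ρ)) w) w := by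
          refine DifferentiableAt.hasDerivAt ?_
          exact (Differentiable.fun_finsetProd fun ρ _ => by fun_prop) w
        have h2 := (hg.differentiableAt (hU.mem_nhds (hsubR hw))).hasDerivAt
        have h3 := h1.fun_mul h2
        rw [show f = fun z => (∏ ρ ∈ S, (z - ρ)) * g z from funext hfg, h3.deriv, hgw,
          Finset.prod_eq_zero hwS (sub_self w)]
        ring
      · refine Finset.prod_ne_zero_iff.mpr fun ρ hρ => div_ne_zero (sub_ne_zero.mpr fun h => ?_)
          (by exact_mod_cast hR0.ne')
        have := congrArg norm h
        rw [norm_mul, RCLike.norm_conj, norm_pow, norm_real, Real.norm_of_nonneg hR0.le] at this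
        have h1 := hρr ρ hρ
        nlinarith [norm_nonneg ρ, norm_nonneg w]
    obtain ⟨h, hhd, hh0, hh⟩ := exists_exp_eq_on_ball hr'0 (hg₀d.mono hsubR) hne
    have hnorm : ∀ w ∈ Metric.ball (0 : ℂ) r', ‖g₀ w‖ = ‖g₀ 0‖ * Real.exp (h w).re :=
      fun w hw => by rw [hh w hw, norm_mul, norm_exp]
    -- Since |g₀| ≤ M and |g₀(0)| ≥ |f(0)|, the logarithm h has real part at most A;
    -- Borel–Carathéodory then bounds |h|, and so bounds |g₀| from below.
    have hre : Set.MapsTo h (Metric.ball 0 r') {z | z.re ≤ A} := by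
      intro w hw
      have h1 : Real.exp (h w).re ≤ M / ‖f 0‖ := by
        rw [le_div_iff₀ hf0, mul_comm]
        calc ‖f 0‖ * Real.exp (h w).re ≤ ‖g₀ 0‖ * Real.exp (h w).re := by gcongr
          _ = ‖g₀ w‖ := (hnorm w hw).symm
          _ ≤ M := hg₀M w (Metric.ball_subset_closedBall (Metric.ball_subset_ball hR.le hw))
      exact (Real.le_log_iff_exp_le (by positivity)).mpr h1
    have hzr : ‖z‖ ≤ r := by simpa using hz
    have hzb : z ∈ Metric.ball (0 : ℂ) r' := by simpa using hzr.trans_lt hr'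
    have hbc := borelCaratheodory_zero hApos hhd hre hr'0 hzb hh0
    have hbc' : ‖h z‖ ≤ 2 * A * r / (r' - r) := by
      refine hbc.trans ?_
      have : 0 < r' - r := sub_pos.mpr hr'
      gcongr
    have hlow : ‖f 0‖ * Real.exp (-(2 * A * r / (r' - r))) ≤ ‖g₀ z‖ := by
      rw [hnorm z hzb]
      gcongr
      linarith [(abs_le.mp (abs_re_le_norm (h z))).1]
    have hden : ∀ ρ ∈ S, ‖((R : ℂ) ^ 2 - (starRingEnd ℂ) ρ * z) / R‖ ≤ 2 * R := fun ρ hρ => by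
      rw [norm_div, norm_real, Real.norm_of_nonneg hR0.le, div_le_iff₀ hR0]
      refine (norm_sub_le _ _).trans ?_
      rw [norm_mul, RCLike.norm_conj, norm_pow, norm_real, Real.norm_of_nonneg hR0.le]
      have h1 := hρr ρ hρ
      nlinarith [norm_nonneg ρ, norm_nonneg z]
    calc ‖f 0‖ * Real.exp (-(2 * A * r / (r' - r))) * ∏ ρ ∈ S, (‖z - ρ‖ / (2 * R))
        ≤ ‖g₀ z‖ * ∏ ρ ∈ S, (‖z - ρ‖ / (2 * R)) := by gcongr
      _ = (‖g z‖ * ∏ ρ ∈ S, (‖z - ρ‖ / (2 * R))) *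
            ∏ ρ ∈ S, ‖((R : ℂ) ^ 2 - (starRingEnd ℂ) ρ * z) / R‖ := by
          simp only [hg₀, hq, norm_mul, norm_prod]; ring
      _ ≤ (‖g z‖ * ∏ ρ ∈ S, (‖z - ρ‖ / (2 * R))) * ∏ _ρ ∈ S, (2 * R) := by
          gcongr with ρ hρ
          exact hden ρ hρ
      _ = ‖f z‖ := by
          rw [mul_assoc, ← Finset.prod_mul_distrib, hfg z, norm_mul, norm_prod, mul_comm]
          congr 1
          refine Finset.prod_congr rfl fun ρ _ => ?_
          field_simp

/-- A product of `n` factors `|t - γ i|` is at least `8⁻ⁿ` somewhere on any interval of length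
one. -/
theorem exists_prod_abs_sub_ge {ι : Type*} (S : Finset ι) (γ : ι → ℝ) (t₀ : ℝ) :
    ∃ t ∈ Icc (t₀ - 1 / 2) (t₀ + 1 / 2), (1 / 8 : ℝ) ^ S.card ≤ ∏ i ∈ S, |t - γ i| := by
  by_contra! hcon
  -- The interval is rescaled to [-1, 1] by t = t₀ + x/2; each factor doubles, so the assumed bound
  -- 8⁻ⁿ becomes 4⁻ⁿ.
  set Q : Polynomial ℝ := ∏ i ∈ S, (Polynomial.X - Polynomial.C (2 * (γ i - t₀))) with hQ
  have hmonic : Q.Monic := Polynomial.monic_prod_of_monic _ _ fun i _ => Polynomial.monic_X_sub_C _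
  have hdeg : Q.natDegree = S.card := by
    rw [hQ, Polynomial.natDegree_prod_of_monic _ _ fun i _ => Polynomial.monic_X_sub_C _]
    simp only [Polynomial.natDegree_X_sub_C, Finset.sum_const, smul_eq_mul, mul_one]
  have hbound : ∀ x ∈ Icc (-1 : ℝ) 1, |Q.eval x| ≤ (1 / 4) ^ S.card := by
    intro x hx
    have h1 := hcon (t₀ + x / 2) ⟨by linarith [hx.1], by linarith [hx.2]⟩
    have h2 : |Q.eval x| = 2 ^ S.card * ∏ i ∈ S, |t₀ + x / 2 - γ i| := by
      rw [hQ, Polynomial.eval_prod, Finset.abs_prod, ← Finset.prod_const, ← Finset.prod_mul_distrib]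
      refine Finset.prod_congr rfl fun i _ => ?_
      rw [← abs_two, ← abs_mul]
      simp only [Polynomial.eval_sub, Polynomial.eval_X, Polynomial.eval_C, abs_two]
      congr 1; ring
    rw [h2]
    calc (2 : ℝ) ^ S.card * ∏ i ∈ S, |t₀ + x / 2 - γ i| ≤ 2 ^ S.card * (1 / 8) ^ S.card := by
          gcongr
      _ = (1 / 4) ^ S.card := by rw [← mul_pow]; norm_num
  -- Chebyshev: a polynomial bounded by 1 on [-1, 1] has leading coefficient at most 2ⁿ⁻¹, whereas
  -- that of 4ⁿQ is 4ⁿ.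
  have key := Polynomial.Chebyshev.leadingCoeff_le_of_forall_abs_le_one (n := S.card)
    (P := Polynomial.C (4 ^ S.card) * Q) (by
      rw [Polynomial.degree_C_mul (by positivity), Polynomial.degree_eq_natDegree hmonic.ne_zero,
        hdeg]) (fun x hx => by
      rw [Polynomial.eval_mul, Polynomial.eval_C, abs_mul, abs_of_pos (by positivity)]
      calc (4 : ℝ) ^ S.card * |Q.eval x| ≤ 4 ^ S.card * (1 / 4) ^ S.card := by
            gcongr; exact hbound x hx
        _ = 1 := by rw [← mul_pow]; norm_num)
  rw [Polynomial.leadingCoeff_mul, hmonic.leadingCoeff, Polynomial.leadingCoeff_C, mul_one] at key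
  -- For n = 0 the truncated exponent n - 1 gives 1 ≤ 1 and no contradiction; there the empty
  -- product contradicts the assumption directly.
  rcases Nat.eq_zero_or_pos S.card with h | h
  · have := hcon t₀ ⟨by linarith, by linarith⟩
    rw [Finset.card_eq_zero.mp h] at this
    simp at this
  · have h1 : (2 : ℝ) ^ (S.card - 1) < 4 ^ S.card :=
      calc (2 : ℝ) ^ (S.card - 1) ≤ 2 ^ S.card := pow_le_pow_right₀ (by norm_num) (by omega)
        _ < 4 ^ S.card := pow_lt_pow_left₀ (by norm_num) (by norm_num) h.ne'
    linarith

/-! ### Euler–Maclaurin continuation and polynomial growth of ζ -/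

/-- The error of the trapezoidal rule for `x ↦ x ^ (-s)` on `[n + 1, n + 2]`. -/
noncomputable def trapezoidError (n : ℕ) (s : ℂ) : ℂ :=
  ((n + 1 : ℂ) ^ (-s) + (n + 2 : ℂ) ^ (-s)) / 2 -
    ((n + 2 : ℂ) ^ (1 - s) - (n + 1 : ℂ) ^ (1 - s)) / (1 - s)

theorem hasDerivAt_shift_cpow {x u : ℝ} (hx : 0 < x + u) (c : ℂ) :
    HasDerivAt (fun u : ℝ => (x + u : ℂ) ^ c) (c * (x + u : ℂ) ^ (c - 1)) u := by
  have h1 : HasDerivAt (fun z : ℂ => (x + z) ^ c) (c * (x + u : ℂ) ^ (c - 1)) (u : ℂ) := by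
    have := ((hasDerivAt_id (u : ℂ)).const_add (x : ℂ)).cpow_const (c := c)
      (by left; simpa using hx)
    simpa using this
  exact h1.comp_ofReal

/-- Two integrations by parts against the kernel u(1-u)/2, recorded as one explicit primitive. The
exponent -s-2 is what makes the sum over n converge as far as Re s > -1. -/
theorem trapezoidError_eq_integral (n : ℕ) {s : ℂ} (hs : s ≠ 1) :
    trapezoidError n s = ∫ u : ℝ in (0 : ℝ)..1,
      s * (s + 1) / 2 * (u * (1 - u)) * (((n + 1 : ℝ) : ℂ) + u) ^ (-s - 2) := by
  have hs' : 1 - s ≠ 0 := sub_ne_zero.mpr hs.symm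
  set x : ℝ := n + 1 with hx
  have hx0 : 0 < x := by positivity
  have hpos : ∀ u ∈ uIcc (0 : ℝ) 1, 0 < x + u := fun u hu => by
    rw [uIcc_of_le zero_le_one] at hu; linarith [hu.1]
  rw [intervalIntegral.integral_eq_sub_of_hasDerivAt (f := fun u : ℝ =>
    (u * (1 - u) * (-s * (x + u : ℂ) ^ (-s - 1)) - (1 - 2 * u) * (x + u : ℂ) ^ (-s)) / 2
      - (x + u : ℂ) ^ (1 - s) / (1 - s))]
  · have e : (n + 2 : ℂ) = x + 1 := by rw [hx]; push_cast; ring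
    rw [trapezoidError, e]
    simp only [ofReal_one, ofReal_zero, add_zero]
    rw [show (n + 1 : ℂ) = x by rw [hx]; push_cast; rfl]
    ring
  · intro u hu
    have d0 : HasDerivAt (fun u : ℝ => (u : ℂ)) 1 u := (hasDerivAt_id u).ofReal_comp
    have d1 := hasDerivAt_shift_cpow (hpos u hu) (-s - 1)
    have d2 := hasDerivAt_shift_cpow (hpos u hu) (-s)
    have d3 := hasDerivAt_shift_cpow (hpos u hu) (1 - s)
    have d4 := (((d0.fun_mul (d0.const_sub 1)).fun_mul (d1.const_mul (-s))).fun_sub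
      (((d0.const_mul 2).const_sub 1).fun_mul d2)).div_const 2
    have d5 := d4.fun_sub (d3.div_const (1 - s))
    convert! d5 using 1
    rw [show -s - 1 - 1 = -s - 2 by ring, show 1 - s - 1 = -s by ring]
    field_simp
    ring
  · refine ContinuousOn.intervalIntegrable fun u hu => ?_
    have d1 := (hasDerivAt_shift_cpow (hpos u hu) (-s - 2)).continuousAt
    have d0 : ContinuousAt (fun u : ℝ => s * (s + 1) / 2 * ((u : ℂ) * (1 - u))) u := by fun_prop
    exact (d0.mul d1).continuousWithinAt

theorem norm_trapezoidError_le (n : ℕ) {s : ℂ} (hs : s ≠ 1) {σ : ℝ} (hσ : -1 ≤ σ)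
    (hσs : σ ≤ s.re) :
    ‖trapezoidError n s‖ ≤ ‖s‖ * ‖s + 1‖ * (n + 1 : ℝ) ^ (-σ - 2) := by
  have hb : ∀ u ∈ uIoc (0 : ℝ) 1, ‖s * (s + 1) / 2 * (u * (1 - u)) *
      (((n + 1 : ℝ) : ℂ) + u) ^ (-s - 2)‖ ≤ ‖s‖ * ‖s + 1‖ * (n + 1 : ℝ) ^ (-σ - 2) := by
    intro u hu
    rw [uIoc_of_le zero_le_one] at hu
    have hn : (0 : ℝ) ≤ n := n.cast_nonneg
    have h1 : ‖(((n + 1 : ℝ) : ℂ) + u) ^ (-s - 2)‖ ≤ (n + 1 : ℝ) ^ (-σ - 2) := by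
      rw [← ofReal_add, norm_cpow_eq_rpow_re_of_pos (by linarith [hu.1])]
      calc (n + 1 + u : ℝ) ^ (-s - 2).re ≤ (n + 1 + u : ℝ) ^ (-σ - 2) := by
            refine Real.rpow_le_rpow_of_exponent_le (by linarith [hu.1]) ?_
            simp; linarith
        _ ≤ (n + 1 : ℝ) ^ (-σ - 2) :=
            Real.rpow_le_rpow_of_nonpos (by linarith) (by linarith [hu.1]) (by linarith)
    have h2 : ‖s * (s + 1) / 2 * (u * (1 - u))‖ ≤ ‖s‖ * ‖s + 1‖ := by
      have : ‖((u : ℂ) * (1 - u))‖ ≤ 1 := by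
        rw [show ((u : ℂ) * (1 - u)) = ((u * (1 - u) : ℝ) : ℂ) by push_cast; ring, norm_real,
          Real.norm_of_nonneg (mul_nonneg hu.1.le (by linarith [hu.2]))]
        nlinarith [hu.1, hu.2]
      rw [norm_mul, norm_div, norm_mul]
      simp only [norm_ofNat]
      have h3 : 0 ≤ ‖s‖ * ‖s + 1‖ := by positivity
      nlinarith [norm_nonneg ((u : ℂ) * (1 - u))]
    rw [norm_mul]
    gcongr
  have := intervalIntegral.norm_integral_le_of_norm_le_const hb
  rw [trapezoidError_eq_integral n hs]
  simpa using this

theorem sum_trapezoidError (m : ℕ) {s : ℂ} (hs : s ≠ 1) :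
    ∑ n ∈ Finset.range m, trapezoidError n s = ∑ n ∈ Finset.range m, 1 / (n + 1 : ℂ) ^ s - 1 / 2
      + (m + 1 : ℂ) ^ (-s) / 2 - ((m + 1 : ℂ) ^ (1 - s) - 1) / (1 - s) := by
  have hs' : 1 - s ≠ 0 := sub_ne_zero.mpr hs.symm
  induction m with
  | zero => simp
  | succ m ih =>
    rw [Finset.sum_range_succ, ih, Finset.sum_range_succ, trapezoidError]
    rw [show ((m + 1 : ℕ) : ℂ) + 1 = m + 2 by push_cast; ring, one_div ((m + 1 : ℂ) ^ s),
      ← cpow_neg]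
    ring

theorem tendsto_natCast_add_one_cpow {s : ℂ} (hs : s.re < 0) :
    Tendsto (fun m : ℕ => (m + 1 : ℂ) ^ s) atTop (𝓝 0) := by
  rw [tendsto_zero_iff_norm_tendsto_zero]
  have h1 : Tendsto (fun m : ℕ => ((m + 1 : ℕ) : ℝ)) atTop atTop :=
    tendsto_natCast_atTop_atTop.comp (tendsto_add_atTop_nat 1)
  have h2 := (tendsto_rpow_neg_atTop (y := -s.re) (by linarith)).comp h1
  refine h2.congr fun m => ?_
  rw [Function.comp_apply, neg_neg, show (m + 1 : ℂ) = ((m + 1 : ℕ) : ℂ) by push_cast; rfl,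
    norm_natCast_cpow_of_pos (Nat.succ_pos m)]

/-- The integral parts telescope in `sum_trapezoidError`, and for Re s > 1 the boundary terms tend
to 0. -/
theorem tsum_trapezoidError {s : ℂ} (hs : 1 < s.re) :
    ∑' n, trapezoidError n s = riemannZeta s - 1 / 2 - 1 / (s - 1) := by
  have hs1 : s ≠ 1 := fun h => by simp [h] at hs
  have hs' : s - 1 ≠ 0 := sub_ne_zero.mpr hs1
  have hs'' : 1 - s ≠ 0 := sub_ne_zero.mpr hs1.symm
  have hsum : Summable fun n => trapezoidError n s := by
    refine Summable.of_norm_bounded (g := fun n : ℕ => ‖s‖ * ‖s + 1‖ * (n + 1 : ℝ) ^ (-(0 : ℝ) - 2))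
      ?_ fun n => norm_trapezoidError_le n hs1 (by norm_num) (by linarith)
    refine Summable.mul_left _ ?_
    have := (summable_nat_add_iff 1).mpr (Real.summable_nat_rpow.mpr
      (show -(0 : ℝ) - 2 < -1 by norm_num))
    simpa using this
  have hz : Summable fun n : ℕ => 1 / (n + 1 : ℂ) ^ s := by
    have := (summable_nat_add_iff 1).mpr (Complex.summable_one_div_nat_cpow.mpr hs)
    simpa using this
  refine tendsto_nhds_unique hsum.hasSum.tendsto_sum_nat ?_
  have h1 := hz.hasSum.tendsto_sum_nat
  rw [← zeta_eq_tsum_one_div_nat_add_one_cpow hs] at h1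
  have h2 := tendsto_natCast_add_one_cpow (s := -s) (by simp; linarith)
  have h3 := tendsto_natCast_add_one_cpow (s := 1 - s) (by simp; linarith)
  have h4 := (((h1.sub_const (1 / 2)).add (h2.div_const 2))).sub
    ((h3.sub_const 1).div_const (1 - s))
  have e : riemannZeta s - 1 / 2 + 0 / 2 - (0 - 1) / (1 - s) =
      riemannZeta s - 1 / 2 - 1 / (s - 1) := by field_simp; ring
  rw [e] at h4
  exact h4.congr fun m => (sum_trapezoidError m hs1).symm

theorem differentiableAt_trapezoidError (n : ℕ) {s : ℂ} (hs : s ≠ 1) :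
    DifferentiableAt ℂ (trapezoidError n) s := by
  have hs' : 1 - s ≠ 0 := sub_ne_zero.mpr hs.symm
  have h : ∀ k : ℕ, ∀ f : ℂ → ℂ, DifferentiableAt ℂ f s →
      DifferentiableAt ℂ (fun s => ((n : ℂ) + (k + 1 : ℕ)) ^ f s) s := fun k f hf => by
    refine hf.const_cpow (Or.inl ?_)
    exact_mod_cast (by omega : n + (k + 1) ≠ 0)
  have h1 := h 0
  have h2 := h 1
  simp only [zero_add, Nat.cast_one, Nat.reduceAdd, Nat.cast_ofNat] at h1 h2
  unfold trapezoidError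
  have a1 := h1 (fun s => -s) (by fun_prop)
  have a2 := h2 (fun s => -s) (by fun_prop)
  have a3 := h1 (fun s => 1 - s) (by fun_prop)
  have a4 := h2 (fun s => 1 - s) (by fun_prop)
  exact ((a1.add a2).div_const 2).sub ((a4.sub a3).div (by fun_prop) hs')

/-- Identity theorem, starting near 2 + i. The bounded convex region makes the majorant uniform,
since the factor |s||s+1| grows with s; the condition Im > 0 keeps the pole out. -/
theorem riemannZeta_eq_tsum_trapezoidError {s : ℂ} (hs : -(9 / 10) < s.re) (him : 0 < s.im) :
    riemannZeta s = ∑' n, trapezoidError n s + 1 / 2 + 1 / (s - 1) := by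
  set B : ℝ := ‖s‖ + 4 with hB
  set U : Set ℂ := {z | -(9 / 10) < z.re} ∩ {z | 0 < z.im} ∩ Metric.ball 0 B with hUdef
  have hU : IsOpen U :=
    ((isOpen_lt continuous_const continuous_re).inter
      (isOpen_lt continuous_const continuous_im)).inter Metric.isOpen_ball
  have hconv : Convex ℝ U :=
    ((convex_halfSpace_re_gt _).inter (convex_halfSpace_im_gt _)).inter (convex_ball _ _)
  have hne : ∀ z ∈ U, z ≠ 1 := fun z hz h => by
    have := hz.1.2; simp [h] at this
  have hsum : Summable fun n : ℕ => B * (B + 1) * (n + 1 : ℝ) ^ (-(-(9 / 10) : ℝ) - 2) := by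
    refine Summable.mul_left _ ?_
    have := (summable_nat_add_iff 1).mpr (Real.summable_nat_rpow.mpr
      (show -(-(9 / 10) : ℝ) - 2 < -1 by norm_num))
    simpa using this
  have hd : DifferentiableOn ℂ (fun z => ∑' n, trapezoidError n z) U := by
    refine differentiableOn_tsum_of_summable_norm hsum
      (fun n z hz => (differentiableAt_trapezoidError n (hne z hz)).differentiableWithinAt) hU
      fun n z hz => ?_
    refine (norm_trapezoidError_le n (hne z hz) (by norm_num) (le_of_lt hz.1.1)).trans ?_
    have h1 : ‖z‖ < B := by simpa using hz.2
    have h2 : ‖z + 1‖ ≤ B + 1 := (norm_add_le _ _).trans (by simpa using h1.le)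
    gcongr
  have hf : AnalyticOnNhd ℂ (fun z => ∑' n, trapezoidError n z + 1 / 2 + 1 / (z - 1)) U := by
    refine DifferentiableOn.analyticOnNhd ((hd.add_const _).add fun z hz => ?_) hU
    have : DifferentiableAt ℂ (fun w : ℂ => 1 / (w - 1)) z :=
      (differentiableAt_const _).fun_div (by fun_prop) (sub_ne_zero.mpr (hne z hz))
    exact this.differentiableWithinAt
  have hζ : AnalyticOnNhd ℂ riemannZeta U :=
    DifferentiableOn.analyticOnNhd
      (fun z hz => (differentiableAt_riemannZeta (hne z hz)).differentiableWithinAt) hU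
  have hmem : (2 + I : ℂ) ∈ U := by
    refine ⟨⟨by simp; norm_num, by simp⟩, ?_⟩
    rw [Metric.mem_ball, dist_zero_right]
    have := norm_add_le (2 : ℂ) I
    simp at this
    linarith [norm_nonneg s]
  have hev : riemannZeta =ᶠ[𝓝 (2 + I)] fun z => ∑' n, trapezoidError n z + 1 / 2 + 1 / (z - 1) := by
    filter_upwards [(isOpen_lt continuous_const continuous_re).mem_nhds
      (show (2 + I : ℂ) ∈ {z : ℂ | 1 < z.re} by simp)] with z hz
    rw [tsum_trapezoidError hz]; ring
  exact hζ.eqOn_of_preconnected_of_eventuallyEq hf hconv.isPreconnected hmem hev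
    ⟨⟨hs, him⟩, by simp [hB]⟩

/-- Polynomial growth of the zeta function in `Re s ≥ -4/5`, `Im s ≥ 1`. -/
theorem exists_norm_riemannZeta_le :
    ∃ C : ℝ, 0 < C ∧ ∀ s : ℂ, -(4 / 5) ≤ s.re → 1 ≤ s.im → ‖riemannZeta s‖ ≤ C * ‖s‖ ^ 2 := by
  have hsum : Summable fun n : ℕ => (n + 1 : ℝ) ^ (-(-(4 / 5) : ℝ) - 2) := by
    have := (summable_nat_add_iff 1).mpr (Real.summable_nat_rpow.mpr
      (show -(-(4 / 5) : ℝ) - 2 < -1 by norm_num))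
    simpa using this
  set Z := ∑' n : ℕ, (n + 1 : ℝ) ^ (-(-(4 / 5) : ℝ) - 2)
  have hZ : 0 ≤ Z := tsum_nonneg fun n => by positivity
  refine ⟨2 * Z + 2, by positivity, fun s hs him => ?_⟩
  have hs1 : s ≠ 1 := fun h => by simp [h] at him; linarith
  have hns : 1 ≤ ‖s‖ := him.trans ((le_abs_self _).trans (abs_im_le_norm s))
  rw [riemannZeta_eq_tsum_trapezoidError (by linarith) (by linarith)]
  have h1 : ‖∑' n, trapezoidError n s‖ ≤ ‖s‖ * ‖s + 1‖ * Z :=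
    tsum_of_norm_bounded (hsum.hasSum.mul_left _)
      fun n => norm_trapezoidError_le n hs1 (by norm_num) hs
  have h2 : ‖s + 1‖ ≤ 2 * ‖s‖ := (norm_add_le _ _).trans (by simp; linarith)
  have h3 : ‖1 / (s - 1)‖ ≤ 1 := by
    rw [norm_div, norm_one]
    refine (div_le_one (norm_pos_iff.mpr (sub_ne_zero.mpr hs1))).mpr ?_
    refine him.trans (((le_abs_self _).trans (abs_im_le_norm (s - 1))).trans_eq' ?_)
    simp
  calc ‖∑' n, trapezoidError n s + 1 / 2 + 1 / (s - 1)‖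
      ≤ ‖s‖ * ‖s + 1‖ * Z + 1 / 2 + 1 := by
        refine (norm_add₃_le).trans ?_
        gcongr
        simp
    _ ≤ ‖s‖ * (2 * ‖s‖) * Z + 2 * ‖s‖ ^ 2 := by
        have : ‖s‖ * ‖s + 1‖ * Z ≤ ‖s‖ * (2 * ‖s‖) * Z := by gcongr
        nlinarith
    _ = (2 * Z + 2) * ‖s‖ ^ 2 := by ring

/-! ### Heights at which 1/ζ and ζ' are polynomially bounded -/

theorem deriv_ne_zero_of_analyticOrderAt_eq_one {f : ℂ → ℂ} {z : ℂ} (hf : AnalyticAt ℂ f z)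
    (h : analyticOrderAt f z = 1) : deriv f z ≠ 0 := by
  obtain ⟨g, hg, hg0, hfg⟩ := (hf.analyticOrderAt_eq_natCast (n := 1)).mp (by exact_mod_cast h)
  have h1 : HasDerivAt (fun w => (w - z) * g w) (1 * g z + (z - z) * deriv g z) z :=
    ((hasDerivAt_id z).sub_const z).fun_mul hg.differentiableAt.hasDerivAt
  have h2 : f =ᶠ[𝓝 z] fun w => (w - z) * g w := by
    filter_upwards [hfg] with w hw
    simpa using hw
  rw [h2.deriv_eq, h1.deriv]
  simpa using hg0

theorem inv_riemannZeta_eq_LSeries {s : ℂ} (hs : 1 < s.re) :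
    (riemannZeta s)⁻¹ = LSeries (fun n => (ArithmeticFunction.moebius n : ℂ)) s := by
  have := ArithmeticFunction.LSeries_zeta_mul_Lseries_moebius hs
  rw [ArithmeticFunction.LSeries_zeta_eq_riemannZeta hs] at this
  exact inv_eq_of_mul_eq_one_right this

theorem norm_LSeries_le_tsum {f : ℕ → ℂ} {σ : ℝ} (hf : LSeriesSummable f σ) :
    ∀ s : ℂ, s.re = σ → ‖LSeries f s‖ ≤ ∑' n, ‖LSeries.term f σ n‖ := fun s hs =>
  tsum_of_norm_bounded hf.norm.hasSum fun n => by
    rw [LSeries.norm_term_eq, LSeries.norm_term_eq, hs, ofReal_re]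

theorem exists_norm_inv_riemannZeta_le {σ : ℝ} (hσ : 1 < σ) :
    ∃ C : ℝ, 0 < C ∧ ∀ s : ℂ, s.re = σ → ‖(riemannZeta s)⁻¹‖ ≤ C := by
  refine ⟨∑' n, ‖LSeries.term (fun n => (ArithmeticFunction.moebius n : ℂ)) σ n‖ + 1,
    add_pos_of_nonneg_of_pos (tsum_nonneg fun n => norm_nonneg _) one_pos,
    fun s hs => ?_⟩
  rw [inv_riemannZeta_eq_LSeries (by rw [hs]; exact hσ)]
  exact (norm_LSeries_le_tsum (ArithmeticFunction.LSeriesSummable_moebius_iff.mpr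
    (by simpa using hσ)) s hs).trans (by linarith)

/-- `1 / ζ` and the derivative of `ζ` are bounded by `B` on the segment `-1/2 ≤ Re s ≤ 3/2`,
`Im s = τ`. -/
def HeightBound (B τ : ℝ) : Prop :=
  ∀ σ ∈ Icc (-(1 / 2) : ℝ) (3 / 2), riemannZeta (σ + τ * I) ≠ 0 ∧
    ‖(riemannZeta (σ + τ * I))⁻¹‖ ≤ B ∧ ‖deriv riemannZeta (σ + τ * I)‖ ≤ B

/-- `norm_ge_of_simple_zeros` is applied on discs about 2 + iT₀. Radius 2.8 stays in Re s ≥ -4/5,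
where ζ grows polynomially; radius 2.6 already covers -1/2 ≤ Re s ≤ 3/2 at heights within 1/2 of T₀.
There are O(log T) zeros nearby, and `exists_prod_abs_sub_ge` selects a height where their product
costs only a power of T. -/
theorem exists_heightBound_pow (hsimple : ∀ s : ℂ, riemannZeta s = 0 → deriv riemannZeta s ≠ 0) :
    ∃ C : ℕ, ∃ T₁ : ℝ, ∀ T : ℝ, T₁ ≤ T → ∃ τ ∈ Icc (T - 1) T, HeightBound (τ ^ C) τ := by
  obtain ⟨C₁, hC₁, hgrow⟩ := exists_norm_riemannZeta_le
  obtain ⟨c, hc, hinv⟩ := exists_norm_inv_riemannZeta_le (σ := 2) (by norm_num)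
  have hlog : 0 < Real.log ((28 / 10 : ℝ) / (27 / 10)) := Real.log_pos (by norm_num)
  -- At most A / log(28/27) zeros occur. Each costs a factor 45 ≥ 8 · 5.6: 8 from the choice of τ,
  -- 5.6 = 2R from the normalisation.
  set k : ℝ := Real.log 45 / Real.log ((28 / 10 : ℝ) / (27 / 10)) with hk
  have hk0 : 0 ≤ k := div_nonneg (Real.log_nonneg (by norm_num)) hlog.le
  obtain ⟨m, hm⟩ := exists_nat_ge (3 * (52 + k))
  -- The loss is exp(-(52 + k)A), with 52 = 2 · 2.6/(2.7 - 2.6) and A ≤ 3 log T₀; it is at least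
  -- T₀^{-m} ≥ τ^{-2m}. The extra four powers absorb c and the bound for ζ'.
  refine ⟨2 * m + 4, 10 + 5 * C₁ * c + 5 * c + 64 * C₁ + 5 * C₁, fun T hT => ?_⟩
  have hCc : 0 < C₁ * c := mul_pos hC₁ hc
  set T₀ : ℝ := T - 1 / 2 with hT₀
  have hT₀9 : 9 ≤ T₀ := by linarith
  set z₀ : ℂ := 2 + T₀ * I with hz₀
  have hz₀re : z₀.re = 2 := by simp [hz₀]
  have hz₀im : z₀.im = T₀ := by simp [hz₀]
  set f : ℂ → ℂ := fun w => riemannZeta (z₀ + w) with hf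
  set U : Set ℂ := {w | z₀ + w ≠ 1} with hU
  have hUo : IsOpen U := isOpen_ne_fun (by fun_prop) (by fun_prop)
  have hne1 : ∀ w : ℂ, ‖w‖ ≤ 28 / 10 → z₀ + w ≠ 1 := fun w hw h => by
    have h1 := congrArg Complex.im h
    have h2 := abs_im_le_norm w
    rw [add_im, hz₀im, one_im] at h1
    linarith [neg_abs_le w.im]
  have hd1 : ∀ w ∈ U, HasDerivAt f (deriv riemannZeta (z₀ + w)) w := fun w hw => by
    exact HasDerivAt.comp_const_add z₀ w (differentiableAt_riemannZeta hw).hasDerivAt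
  set M : ℝ := 4 * C₁ * T₀ ^ 2 + 1 with hM
  have hfM : ∀ w ∈ Metric.closedBall (0 : ℂ) (28 / 10), ‖f w‖ < M := fun w hw => by
    have hw : ‖w‖ ≤ 28 / 10 := by simpa using hw
    have h1 := abs_le.mp (abs_re_le_norm w)
    have h2 := abs_le.mp (abs_im_le_norm w)
    have h3 := hgrow (z₀ + w) (by rw [add_re, hz₀re]; linarith) (by rw [add_im, hz₀im]; linarith)
    have h4 : ‖z₀ + w‖ ≤ 2 * T₀ := by
      refine (norm_add_le _ _).trans ?_
      have : ‖z₀‖ ≤ 2 + T₀ := (norm_add_le _ _).trans (by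
        rw [norm_mul, norm_I, norm_real, Real.norm_of_nonneg (by linarith)]; simp)
      linarith
    have h5 : C₁ * ‖z₀ + w‖ ^ 2 ≤ C₁ * (2 * T₀) ^ 2 := by gcongr
    calc ‖f w‖ ≤ C₁ * (2 * T₀) ^ 2 := h3.trans h5
      _ < M := by rw [hM]; linarith
  have hmem0 : (0 : ℂ) ∈ Metric.closedBall (0 : ℂ) (28 / 10) :=
    Metric.mem_closedBall_self (by norm_num)
  have hf0 : f 0 ≠ 0 := by
    simp only [hf, add_zero]
    exact riemannZeta_ne_zero_of_one_le_re (by rw [hz₀re]; norm_num)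
  have hf0pos : 0 < ‖f 0‖ := norm_pos_iff.mpr hf0
  have hf0c : ‖f 0‖⁻¹ ≤ c := by
    have := hinv z₀ hz₀re
    rw [norm_inv] at this
    simpa [hf] using this
  have hfin : {w : ℂ | w ∈ Metric.ball 0 (27 / 10) ∧ f w = 0}.Finite := by
    have h1 := (isCompact_closedBall z₀ (27 / 10)).inter_riemannZetaZeros_finite
    refine (h1.preimage (f := fun w => z₀ + w)
      (by simp [Set.injOn_of_injective, add_right_injective])
      ).subset fun w hw => ⟨?_, hw.2⟩
    have : ‖w‖ < 27 / 10 := by simpa using hw.1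
    simpa using this.le
  obtain ⟨hcard, hlow⟩ := norm_ge_of_simple_zeros (f := f) (U := U) (r := 26 / 10) (r' := 27 / 10)
    (R := 28 / 10) (M := M) (by norm_num) (by norm_num) (by norm_num) hUo
    (fun w hw => hne1 w (by simpa using hw))
    (fun w hw => (hd1 w hw).differentiableAt.differentiableWithinAt) (fun w hw => (hfM w hw).le)
    hf0 (hfM 0 hmem0) hfin.toFinset (fun z => by simp)
    (fun ρ hρ => by
      simp only [Finite.mem_toFinset, mem_ofPred_eq, Metric.mem_ball, dist_zero_right] at hρ
      rw [(hd1 ρ (hne1 ρ (by linarith [hρ.1]))).deriv]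
      exact hsimple _ hρ.2)
  set S := hfin.toFinset
  set A := Real.log (M / ‖f 0‖) with hA
  have hA3 : A ≤ 3 * Real.log T₀ := by
    rw [show 3 * Real.log T₀ = Real.log (T₀ ^ 3) by rw [Real.log_pow]; norm_num]
    refine Real.log_le_log (by positivity) ?_
    rw [div_eq_mul_inv]
    calc M * ‖f 0‖⁻¹ ≤ M * c := by gcongr
      _ = (4 * (C₁ * c)) * T₀ ^ 2 + c := by rw [hM]; ring
      _ ≤ (4 * (C₁ * c)) * T₀ ^ 2 + c * T₀ ^ 2 := by
          gcongr
          exact le_mul_of_one_le_right hc.le (by nlinarith)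
      _ = (4 * (C₁ * c) + c) * T₀ ^ 2 := by ring
      _ ≤ T₀ * T₀ ^ 2 := by gcongr; linarith
      _ = T₀ ^ 3 := by ring
  have hA0 : 0 ≤ A :=
    Real.log_nonneg ((one_le_div hf0pos).mpr (hfM 0 hmem0).le)
  obtain ⟨τ, hτ, hprod⟩ := exists_prod_abs_sub_ge S (fun w => (z₀ + w).im) T₀
  have hτT : τ ∈ Icc (T - 1) T := ⟨by linarith [hτ.1], by linarith [hτ.2]⟩
  have hτ1 : 1 ≤ τ := by linarith [hτT.1]
  refine ⟨τ, hτT, fun σ hσ => ?_⟩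
  have hτT₀ : T₀ ≤ τ ^ 2 := by nlinarith [hτ.1]
  set z : ℂ := σ + τ * I - z₀ with hz
  have hzs : z₀ + z = σ + τ * I := by rw [hz]; ring
  have hznorm : z ∈ Metric.closedBall (0 : ℂ) (26 / 10) := by
    rw [Metric.mem_closedBall, dist_zero_right]
    refine abs_le_of_sq_le_sq' ?_ (by norm_num) |>.2
    rw [← normSq_eq_norm_sq, normSq_apply]
    have hre : z.re = σ - 2 := by simp [hz, hz₀re]
    have him : z.im = τ - T₀ := by simp [hz, hz₀im]
    rw [hre, him]
    nlinarith [hσ.1, hσ.2, hτ.1, hτ.2]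
  have hl := hlow z hznorm
  have hprod' : Real.exp (-(k * A)) ≤ ∏ ρ ∈ S, (‖z - ρ‖ / (2 * (28 / 10))) := by
    have h1 : (1 / 45 : ℝ) ^ S.card ≤ ∏ ρ ∈ S, (‖z - ρ‖ / (2 * (28 / 10))) := by
      rw [Finset.prod_div_distrib, Finset.prod_const, le_div_iff₀ (by positivity), ← mul_pow]
      calc (1 / 45 * (2 * (28 / 10)) : ℝ) ^ S.card ≤ (1 / 8) ^ S.card := by
            gcongr; norm_num
        _ ≤ ∏ ρ ∈ S, |τ - (z₀ + ρ).im| := hprod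
        _ ≤ ∏ ρ ∈ S, ‖z - ρ‖ := by
            gcongr with ρ _
            refine (le_of_eq ?_).trans (abs_im_le_norm (z - ρ))
            congr 1
            simp [hz]; ring
    refine le_trans ?_ h1
    rw [← Real.exp_log (show (0 : ℝ) < (1 / 45) ^ S.card by positivity), Real.exp_le_exp,
      Real.log_pow, one_div, Real.log_inv]
    have h2 : (S.card : ℝ) * Real.log 45 ≤ k * A := by
      rw [hk, div_mul_eq_mul_div, le_div_iff₀ hlog]
      nlinarith [Real.log_nonneg (show (1 : ℝ) ≤ 45 by norm_num)]
    linarith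
  have hlow2 : c⁻¹ * (τ ^ (2 * m))⁻¹ ≤ ‖f z‖ := by
    refine le_trans ?_ hl
    have h1 : (τ ^ (2 * m))⁻¹ ≤ Real.exp (-(2 * A * (26 / 10) / (27 / 10 - 26 / 10))) *
        Real.exp (-(k * A)) := by
      rw [← Real.exp_add]
      have h2 : (T₀ ^ m)⁻¹ = Real.exp (-(m * Real.log T₀)) := by
        rw [Real.exp_neg, ← Real.log_pow, Real.exp_log (by positivity)]
      calc (τ ^ (2 * m))⁻¹ ≤ (T₀ ^ m)⁻¹ := by
            rw [pow_mul]; gcongr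
        _ = Real.exp (-(m * Real.log T₀)) := h2
        _ ≤ _ := by
            rw [Real.exp_le_exp]
            have h3 : (52 + k) * A ≤ (52 + k) * (3 * Real.log T₀) := by gcongr
            have h4 : 3 * (52 + k) * Real.log T₀ ≤ m * Real.log T₀ := by
              gcongr
              exact Real.log_nonneg (by linarith)
            have h5 : 2 * A * (26 / 10) / (27 / 10 - 26 / 10) = 52 * A := by norm_num; ring
            rw [h5]
            linarith
    have h2 : c⁻¹ ≤ ‖f 0‖ := inv_le_of_inv_le₀ hf0pos hf0c
    rw [mul_assoc ‖f 0‖]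
    have h3 : Real.exp (-(2 * A * (26 / 10) / (27 / 10 - 26 / 10))) * Real.exp (-(k * A)) ≤
      Real.exp (-(2 * A * (26 / 10) / (27 / 10 - 26 / 10))) *
        ∏ ρ ∈ S, (‖z - ρ‖ / (2 * (28 / 10))) := by gcongr
    exact mul_le_mul h2 (h1.trans h3) (by positivity) hf0pos.le
  have hfz : f z = riemannZeta (σ + τ * I) := by simp only [hf, hzs]
  rw [hfz] at hlow2
  have hpos : 0 < ‖riemannZeta (σ + τ * I)‖ := lt_of_lt_of_le (by positivity) hlow2
  refine ⟨norm_pos_iff.mp hpos, ?_, ?_⟩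
  · rw [norm_inv]
    calc ‖riemannZeta (σ + τ * I)‖⁻¹ ≤ (c⁻¹ * (τ ^ (2 * m))⁻¹)⁻¹ := by gcongr
      _ = c * τ ^ (2 * m) := by rw [mul_inv, inv_inv, inv_inv]
      _ ≤ τ ^ 4 * τ ^ (2 * m) := by
          gcongr
          calc c ≤ τ := by linarith [hτT.1]
            _ ≤ τ ^ 4 := le_self_pow₀ hτ1 (by norm_num)
      _ = τ ^ (2 * m + 4) := by ring
  -- Cauchy's estimate for ζ': radius 1/4 keeps Re w ≥ -3/4, inside the range of the growth bound.
  · have h1 : ∀ w ∈ Metric.sphere (σ + τ * I : ℂ) (1 / 4), ‖riemannZeta w‖ ≤ C₁ * (2 * τ) ^ 2 := by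
      intro w hw
      have hw' : ‖w - (σ + τ * I)‖ = 1 / 4 := by simpa [dist_eq_norm] using hw
      have h2 := abs_le.mp ((abs_re_le_norm (w - (σ + τ * I))).trans_eq hw')
      have h3 := abs_le.mp ((abs_im_le_norm (w - (σ + τ * I))).trans_eq hw')
      simp only [sub_re, add_re, ofReal_re, mul_re, ofReal_im, I_re, I_im, sub_im, add_im,
        mul_im] at h2 h3
      refine (hgrow w (by linarith [hσ.1]) (by linarith [hτT.1])).trans ?_
      gcongr
      refine (norm_le_abs_re_add_abs_im w).trans ?_
      have h4 : |w.re| ≤ 2 := abs_le.mpr ⟨by linarith [hσ.1], by linarith [hσ.2]⟩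
      have h5 : |w.im| ≤ τ + 1 / 4 := abs_le.mpr ⟨by linarith, by linarith⟩
      linarith [hτT.1]
    have hball : ∀ w ∈ Metric.closedBall (σ + τ * I : ℂ) (1 / 4), w ≠ 1 := by
      intro w hw h
      have hw' : ‖w - (σ + τ * I)‖ ≤ 1 / 4 := by simpa [dist_eq_norm] using hw
      have h3 := abs_le.mp ((abs_im_le_norm (w - (σ + τ * I))).trans hw')
      rw [h] at h3
      simp at h3
      linarith [h3.1]
    have h2 := Complex.norm_deriv_le_of_forall_mem_sphere_norm_le (f := riemannZeta)
      (show (0 : ℝ) < 1 / 4 by norm_num)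
      (DifferentiableOn.diffContOnCl_ball (U := Metric.closedBall (σ + τ * I : ℂ) (1 / 4))
        (fun w hw => (differentiableAt_riemannZeta (hball w hw)).differentiableWithinAt)
        subset_rfl) h1
    calc ‖deriv riemannZeta (σ + τ * I)‖ ≤ C₁ * (2 * τ) ^ 2 / (1 / 4) := h2
      _ = (16 * C₁) * τ ^ 2 := by ring
      _ ≤ τ * τ ^ 2 := by gcongr; linarith [hτT.1]
      _ = τ ^ 3 := by ring
      _ ≤ τ ^ (2 * m + 4) := pow_le_pow_right₀ hτ1 (by omega)

/-! ### The digamma function and the functional equation -/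

/-- From (1 - x/n)ⁿ ≤ e^{-x}. The bound is uniform in n, as dominated convergence in
`tendsto_deriv_GammaSeq` requires. -/
theorem norm_GammaSeq_le {s : ℂ} (hs : 0 < s.re) {n : ℕ} (hn : n ≠ 0) :
    ‖GammaSeq s n‖ ≤ Real.Gamma s.re := by
  rw [GammaSeq_eq_approx_Gamma_integral hs hn, Real.Gamma_eq_integral hs]
  have hn0 : (0 : ℝ) < n := by positivity
  rw [intervalIntegral.integral_of_le hn0.le]
  refine (norm_integral_le_integral_norm _).trans ?_
  have hint := Real.GammaIntegral_convergent hs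
  calc ∫ x in Ioc 0 (n : ℝ), ‖(((1 - x / n) ^ n : ℝ) : ℂ) * (x : ℂ) ^ (s - 1)‖
      ≤ ∫ x in Ioc 0 (n : ℝ), Real.exp (-x) * x ^ (s.re - 1) := by
        refine integral_mono_of_nonneg (ae_of_all _ fun x => norm_nonneg _)
          (hint.mono_set Ioc_subset_Ioi_self) ?_
        filter_upwards [ae_restrict_mem measurableSet_Ioc] with x hx
        rw [norm_mul, norm_cpow_eq_rpow_re_of_pos hx.1, norm_real]
        have h1 : 0 ≤ 1 - x / n := by
          rw [sub_nonneg, div_le_one hn0]; exact hx.2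
        rw [Real.norm_of_nonneg (pow_nonneg h1 n), sub_re, one_re]
        gcongr
        · exact Real.rpow_nonneg hx.1.le _
        · exact Real.one_sub_div_pow_le_exp_neg hx.2
    _ ≤ ∫ x in Ioi 0, Real.exp (-x) * x ^ (s.re - 1) := by
        refine setIntegral_mono_set hint ?_ Ioc_subset_Ioi_self.eventuallyLE
        filter_upwards [ae_restrict_mem measurableSet_Ioi] with x hx
        exact mul_nonneg (Real.exp_pos _).le (Real.rpow_nonneg (le_of_lt hx) _)

theorem add_natCast_ne_zero_of_re_pos {s : ℂ} (hs : 0 < s.re) (j : ℕ) : s + j ≠ 0 := fun h => by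
  have := congrArg re h
  simp at this
  linarith [j.cast_nonneg (α := ℝ)]

theorem hasDerivAt_GammaSeq {s : ℂ} (hs : 0 < s.re) {n : ℕ} (hn : n ≠ 0) :
    HasDerivAt (fun z => GammaSeq z n)
      (GammaSeq s n * (log n - ∑ j ∈ Finset.range (n + 1), 1 / (s + j))) s := by
  have hn' : (n : ℂ) ≠ 0 := Nat.cast_ne_zero.mpr hn
  have h1 : HasDerivAt (fun z : ℂ => (n : ℂ) ^ z) ((n : ℂ) ^ s * log n) s := by
    simpa using (hasDerivAt_id s).const_cpow (Or.inl hn')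
  have h2 : HasDerivAt (fun z : ℂ => ∏ j ∈ Finset.range (n + 1), (z + j))
      ((∏ j ∈ Finset.range (n + 1), (s + j)) * ∑ j ∈ Finset.range (n + 1), 1 / (s + j)) s := by
    have h3 := HasDerivAt.fun_finsetProd (u := Finset.range (n + 1)) (f := fun j (z : ℂ) => z + j)
      (f' := fun _ => 1) (x := s) fun j _ => by simpa using (hasDerivAt_id s).add_const (j : ℂ)
    convert! h3 using 1
    rw [Finset.mul_sum]
    refine Finset.sum_congr rfl fun j hj => ?_
    rw [← Finset.mul_prod_erase _ _ hj]
    have := add_natCast_ne_zero_of_re_pos hs j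
    simp only [smul_eq_mul]
    field_simp
  have hprod : (∏ j ∈ Finset.range (n + 1), (s + j)) ≠ 0 :=
    Finset.prod_ne_zero_iff.mpr fun j _ => add_natCast_ne_zero_of_re_pos hs j
  have h4 := (h1.mul_const ((n.factorial : ℕ) : ℂ)).fun_div h2 hprod
  convert! h4 using 1
  rw [GammaSeq]
  field_simp

/-- Pointwise convergence passes to derivatives through Cauchy's formula on the circle of radius Re
s / 2, which stays in the right half-plane. -/
theorem tendsto_deriv_GammaSeq {s : ℂ} (hs : 0 < s.re) :
    Tendsto (fun n => deriv (fun z => GammaSeq z n) s) atTop (𝓝 (deriv Gamma s)) := by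
  set U : Set ℂ := {z | 0 < z.re} with hU
  have hUo : IsOpen U := isOpen_lt continuous_const continuous_re
  set r : ℝ := s.re / 2 with hr
  have hr0 : 0 < r := by positivity
  have hball : Metric.closedBall s r ⊆ U := fun z hz => by
    have h1 : ‖z - s‖ ≤ r := by simpa [dist_eq_norm] using hz
    have h2 := (abs_le.mp ((abs_re_le_norm (z - s)).trans h1)).1
    simp only [sub_re] at h2
    simp only [hU, mem_ofPred_eq]
    linarith
  have hΓ : DifferentiableOn ℂ Gamma U := fun z hz =>
    (differentiableAt_Gamma z fun m h => by
      have := add_natCast_ne_zero_of_re_pos hz m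
      exact this (by rw [h]; simp)).differentiableWithinAt
  have hG : ∀ n : ℕ, n ≠ 0 → DifferentiableOn ℂ (fun z => GammaSeq z n) U := fun n hn z hz =>
    (hasDerivAt_GammaSeq hz hn).differentiableAt.differentiableWithinAt
  have hmem := Metric.mem_ball_self (x := s) hr0
  rw [← two_pi_I_inv_smul_circleIntegral_sub_sq_inv_smul_of_differentiable hUo hball hΓ hmem]
  have key : Tendsto (fun n : ℕ => (2 * Real.pi * I : ℂ)⁻¹ •
      ∮ z in C(s, r), ((z - s) ^ 2)⁻¹ • GammaSeq z n) atTop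
      (𝓝 ((2 * Real.pi * I : ℂ)⁻¹ • ∮ z in C(s, r), ((z - s) ^ 2)⁻¹ • Gamma z)) := by
    refine Tendsto.const_smul ?_ _
    have hcm : ∀ θ : ℝ, circleMap s r θ ∈ Metric.closedBall s r := fun θ =>
      Metric.sphere_subset_closedBall (circleMap_mem_sphere s hr0.le θ)
    have hcont : ContinuousOn (fun z : ℂ => Real.Gamma z.re) U := fun z hz =>
      (ContinuousAt.comp (f := re) (Real.differentiableAt_Gamma (fun m h => by
        have h0 : 0 < z.re := hz
        rw [h] at h0
        linarith [m.cast_nonneg (α := ℝ)])).continuousAt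
        continuous_re.continuousAt).continuousWithinAt
    obtain ⟨B, hB⟩ := (isCompact_closedBall s r).exists_bound_of_continuousOn (hcont.mono hball)
    refine intervalIntegral.tendsto_integral_filter_of_dominated_convergence
      (fun _ => r * ((r ^ 2)⁻¹ * B)) ?_ ?_ ?_ ?_
    · filter_upwards [eventually_ne_atTop 0] with n hn
      refine Continuous.aestronglyMeasurable ?_
      have c1 : Continuous fun θ => GammaSeq (circleMap s r θ) n :=
        (hG n hn).continuousOn.comp_continuous (continuous_circleMap s r) fun θ => hball (hcm θ)
      have c2 : Continuous fun θ => ((circleMap s r θ - s) ^ 2)⁻¹ := by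
        refine Continuous.inv₀ (by fun_prop) fun θ => pow_ne_zero 2 ?_
        exact sub_ne_zero.mpr (circleMap_ne_center hr0.ne')
      have c3 : Continuous fun θ => deriv (circleMap s r) θ := by
        simp only [deriv_circleMap]; fun_prop
      exact c3.smul (c2.smul c1)
    · filter_upwards [eventually_ne_atTop 0] with n hn
      refine ae_of_all _ fun θ _ => ?_
      have h1 := norm_GammaSeq_le (hball (hcm θ)) hn
      have h2 : ‖GammaSeq (circleMap s r θ) n‖ ≤ B :=
        h1.trans ((Real.le_norm_self _).trans (hB _ (hcm θ)))
      rw [norm_smul, norm_smul, deriv_circleMap, norm_inv, norm_pow, norm_mul, norm_I, mul_one,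
        circleMap_sub_center, norm_circleMap_zero, abs_of_pos hr0]
      gcongr
    · exact intervalIntegrable_const
    · refine ae_of_all _ fun θ _ => ?_
      exact ((GammaSeq_tendsto_Gamma _).const_smul _).const_smul _
  refine key.congr' ?_
  filter_upwards [eventually_ne_atTop 0] with n hn
  exact two_pi_I_inv_smul_circleIntegral_sub_sq_inv_smul_of_differentiable hUo hball (hG n hn) hmem

theorem tendsto_digamma {s : ℂ} (hs : 0 < s.re) :
    Tendsto (fun n : ℕ => log n - ∑ j ∈ Finset.range (n + 1), 1 / (s + j)) atTop
      (𝓝 (digamma s)) := by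
  have hΓ := Gamma_ne_zero_of_re_pos hs
  have h1 := GammaSeq_tendsto_Gamma s
  refine ((tendsto_deriv_GammaSeq hs).div h1 hΓ).congr' ?_
  filter_upwards [eventually_ne_atTop 0, h1.eventually_ne hΓ] with n hn h0
  rw [Pi.div_apply, (hasDerivAt_GammaSeq hs hn).deriv]
  field_simp

/-- With x = j + 1/2 the summand is Re 1/(1/2 + j + it), and x/(x² + t²) ≥ 1/x - t²/x³. Terms with j
< m are dropped as nonnegative; beyond m the first part dominates a harmonic term and the second
telescopes. -/
theorem sum_re_inv_ge {t : ℝ} {m : ℕ} (hm : 1 ≤ m) {n : ℕ} (hn : m ≤ n) :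
    (harmonic n - harmonic m : ℝ) - t ^ 2 / m * (1 / m - 1 / n) ≤
      ∑ j ∈ Finset.range n, ((j : ℝ) + 1 / 2) / (((j : ℝ) + 1 / 2) ^ 2 + t ^ 2) := by
  induction n, hn using Nat.le_induction with
  | base =>
    simp only [sub_self, mul_zero]
    exact Finset.sum_nonneg fun j _ => by positivity
  | succ n hmn ih =>
    rw [Finset.sum_range_succ, harmonic_succ]
    have hm0 : (1 : ℝ) ≤ m := by exact_mod_cast hm
    have hn0 : (m : ℝ) ≤ n := by exact_mod_cast hmn
    have hnpos : (0 : ℝ) < n := by linarith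
    set x : ℝ := n + 1 / 2 with hx
    have hx0 : 0 < x := by positivity
    have h1 : 1 / x - t ^ 2 / x ^ 3 ≤ x / (x ^ 2 + t ^ 2) := by
      have : x / (x ^ 2 + t ^ 2) - (1 / x - t ^ 2 / x ^ 3) = t ^ 4 / (x ^ 3 * (x ^ 2 + t ^ 2)) := by
        have : x ^ 2 + t ^ 2 ≠ 0 := by positivity
        field_simp
        ring
      have h2 : 0 ≤ t ^ 4 / (x ^ 3 * (x ^ 2 + t ^ 2)) := by positivity
      linarith
    have h2 : 1 / ((n : ℝ) + 1) ≤ 1 / x := by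
      gcongr
      rw [hx]; linarith
    have h3 : t ^ 2 / x ^ 3 ≤ t ^ 2 / m * (1 / n - 1 / (n + 1)) := by
      have e : t ^ 2 / (m : ℝ) * (1 / n - 1 / (n + 1)) = t ^ 2 / (m * (n * (n + 1))) := by
        field_simp; ring
      rw [e]
      gcongr
      have h4 : (m : ℝ) ≤ x := by rw [hx]; linarith
      have h5 : (n : ℝ) * (n + 1) ≤ x ^ 2 := by rw [hx]; nlinarith
      calc (m : ℝ) * (n * (n + 1)) ≤ x * x ^ 2 := by gcongr
        _ = x ^ 3 := by ring
    push_cast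
    rw [← one_div]
    have e2 : t ^ 2 / (m : ℝ) * (1 / m - 1 / (n + 1)) =
        t ^ 2 / (m : ℝ) * (1 / m - 1 / n) + t ^ 2 / m * (1 / n - 1 / (n + 1)) := by ring
    rw [e2]
    linarith

theorem re_digamma_half_add_le {t : ℝ} (ht : 0 < t) :
    (digamma (1 / 2 + t * I)).re ≤ Real.log (t + 1) + 2 := by
  set s : ℂ := 1 / 2 + t * I with hs
  have hre : s.re = 1 / 2 := by simp [hs]
  have him : s.im = t := by simp [hs]
  -- Cutting at m ≈ t balances the two losses: the harmonic sum up to m is about log t, and t²/m² ≤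
  -- 1.
  set m : ℕ := ⌈t⌉₊ with hm
  have hm1 : 1 ≤ m := Nat.one_le_ceil_iff.mpr ht
  have htm : t ≤ m := Nat.le_ceil t
  have hmt : (m : ℝ) ≤ t + 1 := (Nat.ceil_lt_add_one ht.le).le
  have hm0 : (0 : ℝ) < m := by exact_mod_cast hm1
  refine le_of_tendsto ((continuous_re.tendsto _).comp (tendsto_digamma (s := s)
    (by rw [hre]; norm_num))) ?_
  filter_upwards [eventually_ge_atTop m] with n hn
  have hn1 : 1 ≤ n := hm1.trans hn
  have h1 := sum_re_inv_ge (t := t) (n := n + 1) hm1 (hn.trans (Nat.le_succ n))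
  have h0 : (log (n : ℂ)).re = Real.log n := by rw [← natCast_log, ofReal_re]
  have h2 : (∑ j ∈ Finset.range (n + 1), 1 / (s + j)).re =
      ∑ j ∈ Finset.range (n + 1), ((j : ℝ) + 1 / 2) / (((j : ℝ) + 1 / 2) ^ 2 + t ^ 2) := by
    rw [re_sum]
    refine Finset.sum_congr rfl fun j _ => ?_
    rw [one_div, inv_re, normSq_apply, add_re, add_im, hre, him, natCast_re, natCast_im]
    congr 1 <;> ring
  rw [Function.comp_apply, sub_re, h2, h0]
  have h3 := log_add_one_le_harmonic (n + 1)
  have h4 := harmonic_le_one_add_log m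
  have h5 : Real.log n ≤ Real.log ((n + 1 + 1 : ℕ) : ℝ) := by
    refine Real.log_le_log (by exact_mod_cast hn1) ?_
    push_cast; linarith
  have h6 : Real.log m ≤ Real.log (t + 1) := Real.log_le_log hm0 hmt
  have h7 : t ^ 2 / m * (1 / m - 1 / (n + 1 : ℕ)) ≤ 1 := by
    have : (0 : ℝ) ≤ 1 / ((n + 1 : ℕ) : ℝ) := by positivity
    calc t ^ 2 / m * (1 / m - 1 / (n + 1 : ℕ)) ≤ t ^ 2 / m * (1 / m) := by
          gcongr; linarith
      _ = (t / m) ^ 2 := by field_simp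
      _ ≤ 1 := pow_le_one₀ (by positivity) ((div_le_one hm0).mpr htm)
  linarith

/-- For Re z = π/4 one has cos(z + z̄) = 0, that is cos z cos z̄ = sin z sin z̄. Hence the tangent
in `logDerivFunctionalFactor` has modulus at most 1 on the critical line. -/
theorem sin_pi_div_four_add_norm_eq (y : ℝ) :
    ‖sin (Real.pi / 4 + y * I)‖ = ‖cos (Real.pi / 4 + y * I)‖ := by
  have e : ∀ z : ℂ, ‖z‖ ^ 2 = (z * (starRingEnd ℂ) z).re := fun z => by
    rw [mul_conj, ofReal_re, normSq_eq_norm_sq]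
  have hc : (starRingEnd ℂ) (Real.pi / 4 + y * I) = Real.pi / 4 - y * I := by
    simp [sub_eq_add_neg, conj_ofNat]
  have h : ‖sin (Real.pi / 4 + y * I)‖ ^ 2 = ‖cos (Real.pi / 4 + y * I)‖ ^ 2 := by
    rw [e, e, ← sin_conj, ← cos_conj, hc]
    congr 1
    have h1 : cos ((Real.pi / 4 + y * I) + (Real.pi / 4 - y * I)) = 0 := by
      rw [show ((Real.pi / 4 + y * I) + (Real.pi / 4 - y * I) : ℂ) = Real.pi / 2 by ring]
      exact cos_pi_div_two
    rw [cos_add] at h1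
    exact (sub_eq_zero.mp h1).symm
  exact (sq_eq_sq₀ (norm_nonneg _) (norm_nonneg _)).mp h

/-- The logarithmic derivative of the factor `χ` of the functional equation
`ζ (1 - s) = χ (s) ζ (s)`. -/
noncomputable def logDerivFunctionalFactor (s : ℂ) : ℂ :=
  -log (2 * Real.pi) + digamma s - Real.pi / 2 * tan (Real.pi * s / 2)

/-- An upper bound suffices because it is integrated against the nonnegative quantity W|M|². The
term -log 2π is discarded, and the tangent term costs at most 2. -/
theorem re_logDerivFunctionalFactor_le {t : ℝ} (ht : 0 < t) :
    (logDerivFunctionalFactor (1 / 2 + t * I)).re ≤ Real.log (t + 1) + 4 := by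
  have h1 := re_digamma_half_add_le ht
  have h2 : ‖tan (Real.pi * (1 / 2 + t * I) / 2)‖ ≤ 1 := by
    rw [show (Real.pi * (1 / 2 + t * I) / 2 : ℂ) = Real.pi / 4 + (Real.pi * t / 2 : ℝ) * I by
      push_cast; ring, tan_eq_sin_div_cos, norm_div, sin_pi_div_four_add_norm_eq]
    exact div_self_le_one _
  have h3 : 0 ≤ (log (2 * Real.pi : ℂ)).re := by
    rw [show (2 * Real.pi : ℂ) = ((2 * Real.pi : ℝ) : ℂ) by push_cast; rfl, log_ofReal_re]
    exact Real.log_nonneg (by linarith [Real.pi_gt_three])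
  have h4 : ‖(Real.pi / 2 : ℂ) * tan (Real.pi * (1 / 2 + t * I) / 2)‖ ≤ 2 := by
    rw [norm_mul, show (Real.pi / 2 : ℂ) = ((Real.pi / 2 : ℝ) : ℂ) by push_cast; rfl, norm_real,
      Real.norm_of_nonneg (by positivity)]
    nlinarith [Real.pi_le_four, Real.pi_pos, norm_nonneg (tan (Real.pi * (1 / 2 + t * I) / 2))]
  have h5 := (abs_le.mp ((abs_re_le_norm _).trans h4)).1
  rw [logDerivFunctionalFactor, sub_re, add_re, neg_re]
  linarith

theorem ne_of_im_pos {s : ℂ} (hs : 0 < s.im) (x : ℝ) : s ≠ x := fun h => by simp [h] at hs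

theorem cos_pi_mul_div_two_ne_zero {s : ℂ} (hs : 0 < s.im) : cos (Real.pi * s / 2) ≠ 0 := by
  rw [Complex.cos_ne_zero_iff]
  intro k hk
  have := congrArg im hk
  have e : (Real.pi * s / 2 : ℂ) = ((Real.pi / 2 : ℝ) : ℂ) * s := by push_cast; ring
  have e2 : ((2 * k + 1) * Real.pi / 2 : ℂ) = (((2 * k + 1) * Real.pi / 2 : ℝ) : ℂ) := by
    push_cast; ring
  rw [e, e2, re_ofReal_mul_im_eq, ofReal_im] at this
  have hp := Real.pi_pos
  nlinarith
where re_ofReal_mul_im_eq {x : ℝ} {z : ℂ} : ((x : ℂ) * z).im = x * z.im := by simp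

theorem differentiableAt_Gamma_of_im_pos {s : ℂ} (hs : 0 < s.im) : DifferentiableAt ℂ Gamma s :=
  differentiableAt_Gamma s fun m => by
    have := ne_of_im_pos hs (-m)
    push_cast at this
    exact this

theorem Gamma_ne_zero_of_im_pos {s : ℂ} (hs : 0 < s.im) : Gamma s ≠ 0 :=
  Gamma_ne_zero fun m => by
    have := ne_of_im_pos hs (-m)
    push_cast at this
    exact this

theorem differentiableAt_logDerivFunctionalFactor {s : ℂ} (hs : 0 < s.im) :
    DifferentiableAt ℂ logDerivFunctionalFactor s := by
  have hU : IsOpen {z : ℂ | 0 < z.im} := isOpen_lt continuous_const continuous_im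
  have hΓ : DifferentiableOn ℂ Gamma {z : ℂ | 0 < z.im} := fun z hz =>
    (differentiableAt_Gamma_of_im_pos hz).differentiableWithinAt
  have h1 : DifferentiableAt ℂ digamma s :=
    ((hΓ.deriv hU).differentiableAt (hU.mem_nhds hs)).div (differentiableAt_Gamma_of_im_pos hs)
      (Gamma_ne_zero_of_im_pos hs)
  have h2 : DifferentiableAt ℂ (fun s : ℂ => tan (Real.pi * s / 2)) s :=
    DifferentiableAt.comp (g := tan) s (differentiableAt_tan.mpr (cos_pi_mul_div_two_ne_zero hs))
      (by fun_prop)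
  exact (h1.const_add _).sub (h2.const_mul _)

theorem logDeriv_riemannZeta_one_sub {s : ℂ} (hs : 0 < s.im) (hζ : riemannZeta s ≠ 0) :
    -logDeriv riemannZeta (1 - s) = logDerivFunctionalFactor s + logDeriv riemannZeta s := by
  have hp : (2 * Real.pi : ℂ) ≠ 0 := by simp [Real.pi_ne_zero]
  have hs1 : s ≠ 1 := by simpa using ne_of_im_pos hs 1
  have hs0 : s ≠ 0 := by simpa using ne_of_im_pos hs 0
  have h1s : 1 - s ≠ 1 := by simpa using hs0
  have hev : (fun z => riemannZeta (1 - z)) =ᶠ[𝓝 s] fun z =>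
      2 * (2 * Real.pi : ℂ) ^ (-z) * Gamma z * cos (Real.pi * z / 2) * riemannZeta z := by
    filter_upwards [(isOpen_lt continuous_const continuous_im).mem_nhds hs] with z hz
    refine riemannZeta_one_sub (fun n => ?_) (by simpa using ne_of_im_pos hz 1)
    have := ne_of_im_pos hz (-n)
    push_cast at this
    exact this
  have d1 : HasDerivAt (fun z : ℂ => 2 * (2 * Real.pi : ℂ) ^ (-z))
      (2 * ((2 * Real.pi : ℂ) ^ (-s) * log (2 * Real.pi) * -1)) s :=
    ((hasDerivAt_neg s).const_cpow (Or.inl hp)).const_mul 2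
  have hp2 : (2 * Real.pi : ℂ) ^ (-s) ≠ 0 := by simp [cpow_eq_zero_iff, Real.pi_ne_zero]
  have dΓ := differentiableAt_Gamma_of_im_pos hs
  have hΓ := Gamma_ne_zero_of_im_pos hs
  have hcos := cos_pi_mul_div_two_ne_zero hs
  have d3 : HasDerivAt (fun z : ℂ => cos (Real.pi * z / 2))
      (-sin (Real.pi * s / 2) * (Real.pi / 2)) s := by
    have : HasDerivAt (fun z : ℂ => Real.pi * z / 2) (Real.pi / 2 : ℂ) s := by
      simpa using ((hasDerivAt_id s).const_mul (Real.pi : ℂ)).div_const 2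
    exact this.ccos
  have dζ := differentiableAt_riemannZeta hs1
  have d4 := ((d1.fun_mul dΓ.hasDerivAt).fun_mul d3).fun_mul dζ.hasDerivAt
  have d5 : HasDerivAt (fun z => riemannZeta (1 - z)) (-deriv riemannZeta (1 - s)) s := by
    have := HasDerivAt.comp_const_sub (𝕜 := ℂ) 1 s (differentiableAt_riemannZeta h1s).hasDerivAt
    simpa using this
  have e := d5.unique (d4.congr_of_eventuallyEq hev)
  have e0 := hev.self_of_nhds
  simp only at e0
  rw [logDeriv_apply, ← neg_div, e, e0, logDerivFunctionalFactor, digamma_def, logDeriv_apply,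
    logDeriv_apply, tan_eq_sin_div_cos]
  field_simp
  ring

/-- Multiplying by the conjugate, the reflection formula gives π/cosh πt and the product of cosines
gives cosh(πt)/2. The hyperbolic factors cancel exactly, so Stirling's formula is avoided. -/
theorem norm_sq_Gamma_mul_cos (t : ℝ) :
    ‖Gamma (3 / 2 - t * I) * cos (Real.pi * (3 / 2 - t * I) / 2)‖ ^ 2 =
      (1 / 4 + t ^ 2) * (Real.pi / 2) := by
  have hc : (starRingEnd ℂ) (3 / 2 - t * I) = 3 / 2 + t * I := by
    simp [sub_eq_add_neg, conj_ofNat]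
  have hc' : (starRingEnd ℂ) (Real.pi * (3 / 2 - t * I) / 2) = Real.pi * (3 / 2 + t * I) / 2 := by
    rw [map_div₀, map_mul, hc, conj_ofReal, conj_ofNat]
  have hne : ∀ t : ℝ, (1 / 2 + t * I : ℂ) ≠ 0 := fun t h => by
    have := congrArg re h; simp at this
  have g1 : Gamma (3 / 2 + t * I) = (1 / 2 + t * I) * Gamma (1 / 2 + t * I) := by
    rw [← Gamma_add_one _ (hne t)]; congr 1; ring
  have g2 : Gamma (3 / 2 - t * I) = (1 / 2 - t * I) * Gamma (1 / 2 - t * I) := by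
    have := hne (-t)
    push_cast at this
    rw [neg_mul, ← sub_eq_add_neg] at this
    rw [← Gamma_add_one _ this]; congr 1; ring
  have g3 : Gamma (1 / 2 + t * I) * Gamma (1 / 2 - t * I) = Real.pi / cos (Real.pi * t * I) := by
    have := Gamma_mul_Gamma_one_sub (1 / 2 + t * I)
    rw [show (1 : ℂ) - (1 / 2 + t * I) = 1 / 2 - t * I by ring,
      show (Real.pi * (1 / 2 + t * I) : ℂ) = Real.pi * t * I + Real.pi / 2 by ring,
      sin_add_pi_div_two] at this
    exact this
  have hcosh : cos (Real.pi * t * I) ≠ 0 := by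
    rw [cos_mul_I, ← ofReal_mul, ← ofReal_cosh]
    exact_mod_cast (Real.cosh_pos _).ne'
  have g4 : cos (Real.pi * (3 / 2 - t * I) / 2) * cos (Real.pi * (3 / 2 + t * I) / 2) =
      cos (Real.pi * t * I) / 2 := by
    have h1 := cos_add (Real.pi * (3 / 2 - t * I) / 2) (Real.pi * (3 / 2 + t * I) / 2)
    have h2 := cos_sub (Real.pi * (3 / 2 + t * I) / 2) (Real.pi * (3 / 2 - t * I) / 2)
    rw [show (Real.pi * (3 / 2 - t * I) / 2 + Real.pi * (3 / 2 + t * I) / 2 : ℂ) =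
      Real.pi / 2 + Real.pi by ring, cos_add_pi, cos_pi_div_two] at h1
    rw [show (Real.pi * (3 / 2 + t * I) / 2 - Real.pi * (3 / 2 - t * I) / 2 : ℂ) =
      Real.pi * t * I by ring] at h2
    rw [h2]
    linear_combination (-1 / 2 : ℂ) * h1
  have key : Gamma (3 / 2 - t * I) * cos (Real.pi * (3 / 2 - t * I) / 2) *
      (starRingEnd ℂ) (Gamma (3 / 2 - t * I) * cos (Real.pi * (3 / 2 - t * I) / 2)) =
      (((1 / 4 + t ^ 2) * (Real.pi / 2) : ℝ) : ℂ) := by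
    rw [map_mul, ← Gamma_conj, ← cos_conj, hc, hc', g1, g2]
    calc _ = ((1 / 2 - t * I) * (1 / 2 + t * I)) * (Gamma (1 / 2 + t * I) * Gamma (1 / 2 - t * I)) *
          (cos (Real.pi * (3 / 2 - t * I) / 2) * cos (Real.pi * (3 / 2 + t * I) / 2)) := by ring
      _ = _ := by
        have e : (1 / 2 - t * I) * (1 / 2 + t * I) = (1 / 4 + t ^ 2 : ℂ) := by
          linear_combination (-(t : ℂ) ^ 2) * I_sq
        rw [g3, g4, e]
        generalize cos (Real.pi * t * I) = w at hcosh
        push_cast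
        field_simp
  rw [mul_conj, normSq_eq_norm_sq] at key
  exact_mod_cast key

/-- On the line `Re s = -1/2` the reciprocal of the zeta function is bounded. -/
theorem exists_norm_inv_riemannZeta_neg_half_le :
    ∃ C : ℝ, 0 < C ∧ ∀ t : ℝ, ‖(riemannZeta (-(1 / 2) + t * I))⁻¹‖ ≤ C := by
  obtain ⟨c, hc, hinv⟩ := exists_norm_inv_riemannZeta_le (σ := 3 / 2) (by norm_num)
  set A : ℝ := (2 * (2 * Real.pi) ^ (-(3 / 2) : ℝ)) with hA
  have hA0 : 0 < A := by positivity
  refine ⟨A⁻¹ * 2 * c, by positivity, fun t => ?_⟩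
  set s : ℂ := 3 / 2 - t * I with hs
  have hre : s.re = 3 / 2 := by simp [hs]
  have hfe := riemannZeta_one_sub (s := s) (fun n h => by
    have := congrArg re h
    rw [hre] at this
    simp at this
    linarith [n.cast_nonneg (α := ℝ)]) (fun h => by
    have := congrArg re h
    rw [hre] at this
    norm_num at this)
  rw [show (1 : ℂ) - s = -(1 / 2) + t * I by rw [hs]; ring] at hfe
  have h1 : ‖Gamma s * cos (Real.pi * s / 2)‖⁻¹ ≤ 2 := by
    have h2 := norm_sq_Gamma_mul_cos t
    have h3 : (1 / 2 : ℝ) ≤ ‖Gamma s * cos (Real.pi * s / 2)‖ := by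
      refine le_of_sq_le_sq ?_ (norm_nonneg _)
      rw [h2]
      nlinarith [Real.pi_gt_three, sq_nonneg t]
    calc _ ≤ (1 / 2 : ℝ)⁻¹ := by gcongr
      _ = 2 := by norm_num
  have h4 : ‖(2 * (2 * Real.pi : ℂ) ^ (-s))‖ = A := by
    rw [norm_mul, show (2 * Real.pi : ℂ) = ((2 * Real.pi : ℝ) : ℂ) by push_cast; rfl,
      norm_cpow_eq_rpow_re_of_pos (by positivity), neg_re, hre, hA]
    simp
  rw [hfe, show 2 * (2 * Real.pi : ℂ) ^ (-s) * Gamma s * cos (Real.pi * s / 2) * riemannZeta s =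
    (2 * (2 * Real.pi : ℂ) ^ (-s)) * (Gamma s * cos (Real.pi * s / 2)) * riemannZeta s by ring,
    mul_inv, mul_inv, norm_mul, norm_mul, norm_inv, norm_inv, h4]
  gcongr
  exact hinv s hre
where le_of_sq_le_sq {x y : ℝ} (h : x ^ 2 ≤ y ^ 2) (hy : 0 ≤ y) : x ≤ y :=
  le_of_abs_le (abs_le_of_sq_le_sq h hy)

/-! ### Sums over squarefree integers -/

/-- The sum of `μ(n)² / n` over `1 ≤ n ≤ N`. -/
noncomputable def squarefreeSum (N : ℕ) : ℝ :=
  ∑ n ∈ Finset.Icc 1 N, (ArithmeticFunction.moebius n : ℝ) ^ 2 / n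

/-- The sum of `μ(n)² log n / n` over `1 ≤ n ≤ N`. -/
noncomputable def squarefreeLogSum (N : ℕ) : ℝ :=
  ∑ n ∈ Finset.Icc 1 N, (ArithmeticFunction.moebius n : ℝ) ^ 2 * Real.log n / n

theorem moebius_sq_le_one (n : ℕ) : (ArithmeticFunction.moebius n : ℝ) ^ 2 ≤ 1 := by
  have := ArithmeticFunction.abs_moebius_le_one (n := n)
  have h : |(ArithmeticFunction.moebius n : ℝ)| ≤ 1 := by exact_mod_cast this
  exact (sq_le_one_iff_abs_le_one _).mpr h

theorem squarefreeSum_nonneg (N : ℕ) : 0 ≤ squarefreeSum N :=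
  Finset.sum_nonneg fun n _ => by positivity

theorem squarefreeSum_le (N : ℕ) : squarefreeSum N ≤ 1 + Real.log N := by
  refine le_trans ?_ (harmonic_le_one_add_log N)
  rw [harmonic_eq_sum_Icc]
  push_cast
  refine Finset.sum_le_sum fun n _ => ?_
  rw [← one_div]
  gcongr
  exact moebius_sq_le_one n

/-- Write n = b²a with a squarefree, both at most N. Distinct n give distinct pairs, so the harmonic
sum is at most S(N) ∑ 1/b² ≤ S(N) π²/6. -/
theorem harmonic_le_squarefreeSum (N : ℕ) :
    (harmonic N : ℝ) ≤ Real.pi ^ 2 / 6 * squarefreeSum N := by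
  have hdec : ∀ n : ℕ, ∃ p : ℕ × ℕ, p.2 ^ 2 * p.1 = n ∧ Squarefree p.1 := fun n => by
    obtain ⟨a, b, h⟩ := Nat.sq_mul_squarefree n
    exact ⟨(a, b), h⟩
  choose p hp using hdec
  have hinj : Function.Injective p := fun m n h => by rw [← (hp m).1, ← (hp n).1, h]
  set F : ℕ × ℕ → ℝ := fun q =>
    (ArithmeticFunction.moebius q.1 : ℝ) ^ 2 / q.1 * (1 / (q.2 : ℝ) ^ 2) with hF
  have hFp : ∀ n : ℕ, (n : ℝ)⁻¹ = F (p n) := fun n => by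
    have h1 : (ArithmeticFunction.moebius (p n).1 : ℝ) ^ 2 = 1 := by
      exact_mod_cast ArithmeticFunction.moebius_sq_eq_one_of_squarefree (hp n).2
    have h2 : (n : ℝ) = ((p n).2 : ℝ) ^ 2 * (p n).1 := by exact_mod_cast (hp n).1.symm
    simp only [hF]
    rw [h1, h2, mul_inv]
    ring
  have himg : (Finset.Icc 1 N).image p ⊆ Finset.Icc 1 N ×ˢ Finset.Icc 1 N := fun q hq => by
    obtain ⟨n, hn, rfl⟩ := Finset.mem_image.mp hq
    rw [Finset.mem_Icc] at hn
    have h1 := (hp n).1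
    have h2 : (p n).1 ≠ 0 := fun h => by rw [h, mul_zero] at h1; omega
    have h3 : (p n).2 ≠ 0 := fun h => by rw [h] at h1; simp at h1; omega
    have h4 : 1 ≤ (p n).1 := Nat.one_le_iff_ne_zero.mpr h2
    have h5 : 1 ≤ (p n).2 := Nat.one_le_iff_ne_zero.mpr h3
    rw [Finset.mem_product, Finset.mem_Icc, Finset.mem_Icc]
    exact ⟨⟨h4, (Nat.le_of_dvd (by omega) (Dvd.intro_left _ h1)).trans hn.2⟩, ⟨h5, by nlinarith⟩⟩
  calc (harmonic N : ℝ) = ∑ n ∈ Finset.Icc 1 N, F (p n) := by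
        rw [harmonic_eq_sum_Icc]
        push_cast
        exact Finset.sum_congr rfl fun n _ => hFp n
    _ = ∑ q ∈ (Finset.Icc 1 N).image p, F q :=
        (Finset.sum_image fun m _ n _ h => hinj h).symm
    _ ≤ ∑ q ∈ Finset.Icc 1 N ×ˢ Finset.Icc 1 N, F q :=
        Finset.sum_le_sum_of_subset_of_nonneg himg fun q _ _ => by positivity
    _ = squarefreeSum N * ∑ b ∈ Finset.Icc 1 N, 1 / (b : ℝ) ^ 2 := by
        rw [Finset.sum_product, squarefreeSum, Finset.sum_mul_sum]
    _ ≤ squarefreeSum N * (Real.pi ^ 2 / 6) := by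
        gcongr
        · exact squarefreeSum_nonneg N
        · exact sum_le_hasSum _ (fun b _ => by positivity) hasSum_zeta_two
    _ = _ := mul_comm _ _

theorem log_le_squarefreeSum {N : ℕ} (hN : 1 ≤ N) :
    6 / Real.pi ^ 2 * Real.log N ≤ squarefreeSum N := by
  have h1 := harmonic_le_squarefreeSum N
  have h2 := log_add_one_le_harmonic N
  have h3 : Real.log N ≤ Real.log (N + 1 : ℕ) :=
    Real.log_le_log (by exact_mod_cast hN) (by push_cast; linarith)
  have hp := Real.pi_pos
  rw [div_mul_eq_mul_div, div_le_iff₀ (by positivity)]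
  linarith

/-- Partial summation, L = S(N) log N - ∫ S(x) dx/x, with S(x) ≥ (6/π²) log x inside the integral.
As an induction, the squared increments Δ² of log are absorbed by the telescoping 2 - 2/N. -/
theorem two_mul_squarefreeLogSum_le {N : ℕ} (hN : 1 ≤ N) :
    2 * squarefreeLogSum N ≤ 2 * squarefreeSum N * Real.log N -
      6 / Real.pi ^ 2 * Real.log N ^ 2 + 6 / Real.pi ^ 2 * (2 - 2 / N) := by
  induction N, hN using Nat.le_induction with
  | base => simp [squarefreeLogSum]
  | succ N hN ih =>
    set c : ℝ := 6 / Real.pi ^ 2 with hc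
    have hc0 : 0 < c := by positivity
    have hN0 : (0 : ℝ) < N := by exact_mod_cast hN
    have hS := log_le_squarefreeSum hN
    have e1 : squarefreeLogSum (N + 1) = squarefreeLogSum N +
        (ArithmeticFunction.moebius (N + 1) : ℝ) ^ 2 / (N + 1 : ℕ) * Real.log (N + 1 : ℕ) := by
      rw [squarefreeLogSum, Finset.sum_Icc_succ_top (by omega), ← squarefreeLogSum]; ring
    have e2 : squarefreeSum (N + 1) = squarefreeSum N +
        (ArithmeticFunction.moebius (N + 1) : ℝ) ^ 2 / (N + 1 : ℕ) := by
      rw [squarefreeSum, Finset.sum_Icc_succ_top (by omega), ← squarefreeSum]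
    rw [e1, e2]
    set w : ℝ := (ArithmeticFunction.moebius (N + 1) : ℝ) ^ 2 / (N + 1 : ℕ)
    set Δ : ℝ := Real.log (N + 1 : ℕ) - Real.log N with hΔ
    have hlog : Real.log (N + 1 : ℕ) = Real.log N + Δ := by rw [hΔ]; ring
    have hΔ0 : 0 ≤ Δ := by
      rw [hΔ, sub_nonneg]
      exact Real.log_le_log hN0 (by push_cast; linarith)
    have hΔ1 : Δ ≤ 1 / N := by
      rw [hΔ, ← Real.log_div (by positivity) hN0.ne']
      refine (Real.log_le_sub_one_of_pos (by positivity)).trans (le_of_eq ?_)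
      push_cast; field_simp; ring
    have hΔ2 : Δ ^ 2 ≤ 2 / N - 2 / (N + 1 : ℕ) := by
      have h1 : Δ ^ 2 ≤ (1 / (N : ℝ)) ^ 2 := by gcongr
      refine h1.trans ?_
      have h2 : (2 : ℝ) / N - 2 / (N + 1 : ℕ) - (1 / (N : ℝ)) ^ 2 =
          ((N : ℝ) - 1) / (N ^ 2 * (N + 1)) := by
        push_cast; field_simp; ring
      have h3 : (1 : ℝ) ≤ N := by exact_mod_cast hN
      have h4 : 0 ≤ ((N : ℝ) - 1) / (N ^ 2 * (N + 1)) :=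
        div_nonneg (by linarith) (by positivity)
      linarith
    rw [hlog]
    have h5 : c * Real.log N * Δ ≤ squarefreeSum N * Δ := by gcongr
    have h6 : c * Δ ^ 2 ≤ c * (2 / N - 2 / (N + 1 : ℕ)) := by gcongr
    nlinarith

/-! ### The polynomial weight and oscillatory integrals -/

/-- Take (1 - (1-2x)^{2m})^K: the base is divisible by 4x(1-x), and as m → ∞ it tends to 1 on the
open interval. A polynomial is wanted because the weight must be entire. -/
theorem exists_weight_polynomial (K : ℕ) {η : ℝ} (hη : 0 < η) :
    ∃ P : Polynomial ℝ, Polynomial.X ^ K ∣ P ∧ (Polynomial.X - 1) ^ K ∣ P ∧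
      (∀ x ∈ Icc (0 : ℝ) 1, P.eval x ∈ Icc (0 : ℝ) 1) ∧
      1 - η ≤ ∫ x in (0 : ℝ)..1, P.eval x := by
  set P : ℕ → Polynomial ℝ := fun m => (1 - ((1 - 2 * Polynomial.X) ^ 2) ^ m) ^ K with hP
  have heval : ∀ m x, (P m).eval x = (1 - ((1 - 2 * x) ^ 2) ^ m) ^ K := fun m x => by simp [hP]
  have hdvd : ∀ m, (4 * Polynomial.X * (1 - Polynomial.X) : Polynomial ℝ) ∣
      1 - ((1 - 2 * Polynomial.X) ^ 2) ^ m := fun m => by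
    have := sub_dvd_pow_sub_pow (1 : Polynomial ℝ) ((1 - 2 * Polynomial.X) ^ 2) m
    rw [one_pow] at this
    convert! this using 1
    ring
  have hmem : ∀ m, ∀ x ∈ Icc (0 : ℝ) 1, (P m).eval x ∈ Icc (0 : ℝ) 1 := fun m x hx => by
    have h1 : ((1 - 2 * x) ^ 2) ^ m ≤ 1 := pow_le_one₀ (sq_nonneg _) (by nlinarith [hx.1, hx.2])
    have h2 : 0 ≤ ((1 - 2 * x) ^ 2) ^ m := by positivity
    rw [heval]
    exact ⟨pow_nonneg (by linarith) K, pow_le_one₀ (by linarith) (by linarith)⟩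
  have hlim : Tendsto (fun m => ∫ x in (0 : ℝ)..1, (P m).eval x) atTop
      (𝓝 (∫ _x in (0 : ℝ)..1, (1 : ℝ))) := by
    refine intervalIntegral.tendsto_integral_filter_of_dominated_convergence (fun _ => 1)
      (Eventually.of_forall fun m => (P m).continuous.aestronglyMeasurable)
      (Eventually.of_forall fun m => ae_of_all _ fun x hx => ?_) intervalIntegrable_const ?_
    · rw [uIoc_of_le zero_le_one] at hx
      have := hmem m x ⟨hx.1.le, hx.2⟩
      rw [Real.norm_of_nonneg this.1]
      exact this.2
    · have hae : ∀ᵐ x : ℝ, x ≠ 1 := by simp [ae_iff]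
      filter_upwards [hae] with x hx1 hx
      rw [uIoc_of_le zero_le_one] at hx
      have hx' : x < 1 := lt_of_le_of_ne hx.2 hx1
      have h1 := tendsto_pow_atTop_nhds_zero_of_lt_one (sq_nonneg (1 - 2 * x))
        (by nlinarith [hx.1])
      have h2 := (h1.const_sub 1).pow K
      rw [sub_zero, one_pow] at h2
      exact h2.congr fun m => (heval m x).symm
  simp only [intervalIntegral.integral_const, sub_zero, smul_eq_mul, mul_one] at hlim
  obtain ⟨m, hm⟩ := (hlim.eventually (lt_mem_nhds (show 1 - η < 1 by linarith))).exists
  refine ⟨P m, ?_, ?_, hmem m, hm.le⟩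
  · exact pow_dvd_pow_of_dvd ((Dvd.intro (4 * (1 - Polynomial.X)) (by ring)).trans (hdvd m)) K
  · exact pow_dvd_pow_of_dvd ((Dvd.intro (-4 * Polynomial.X) (by ring)).trans (hdvd m)) K

theorem exists_norm_aeval_le (P : Polynomial ℝ) (B : ℝ) :
    ∃ C : ℝ, 0 ≤ C ∧ ∀ z : ℂ, ‖z‖ ≤ B → ‖Polynomial.aeval z P‖ ≤ C := by
  obtain ⟨C, hC⟩ := (isCompact_closedBall (0 : ℂ) B).exists_bound_of_continuousOn
    (f := fun z => Polynomial.aeval z P) P.continuous_aeval.continuousOn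
  exact ⟨max C 0, le_max_right _ _, fun z hz => (hC z (by simpa using hz)).trans (le_max_left _ _)⟩

theorem exists_norm_aeval_le_pow {P : Polynomial ℝ} {K : ℕ} (h0 : Polynomial.X ^ K ∣ P)
    (h1 : (Polynomial.X - 1) ^ K ∣ P) (B : ℝ) :
    ∃ C : ℝ, 0 ≤ C ∧ ∀ z : ℂ, ‖z‖ ≤ B →
      ‖Polynomial.aeval z P‖ ≤ C * ‖z‖ ^ K ∧ ‖Polynomial.aeval z P‖ ≤ C * ‖z - 1‖ ^ K := by
  obtain ⟨Q, hQ⟩ := h0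
  obtain ⟨R, hR⟩ := h1
  obtain ⟨C, hC0, hC⟩ := exists_norm_aeval_le Q B
  obtain ⟨D, hD0, hD⟩ := exists_norm_aeval_le R B
  refine ⟨C + D, by positivity, fun z hz => ⟨?_, ?_⟩⟩
  · rw [hQ, map_mul, map_pow, Polynomial.aeval_X, norm_mul, norm_pow, mul_comm]
    gcongr
    exact (hC z hz).trans (by linarith)
  · rw [hR, map_mul, map_pow, map_sub, Polynomial.aeval_X, map_one, norm_mul, norm_pow, mul_comm]
    gcongr
    exact (hD z hz).trans (by linarith)

theorem aeval_ofReal (P : Polynomial ℝ) (x : ℝ) :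
    Polynomial.aeval (x : ℂ) P = (P.eval x : ℝ) :=
  Polynomial.aeval_algebraMap_apply_eq_algebraMap_eval x P

/-- The weight `s ↦ P ((s - 1/2) / (i τ))`, which is `P (t / τ)` at `s = 1/2 + i t`. -/
noncomputable def weight (P : Polynomial ℝ) (τ : ℝ) (s : ℂ) : ℂ :=
  Polynomial.aeval ((s - 1 / 2) / (I * τ)) P

theorem differentiable_weight (P : Polynomial ℝ) (τ : ℝ) : Differentiable ℂ (weight P τ) := by
  have h1 : Differentiable ℂ (fun z : ℂ => Polynomial.aeval z P) := P.differentiable_aeval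
  have h2 : Differentiable ℂ (fun s : ℂ => (s - 1 / 2) / (I * τ)) := by fun_prop
  exact h1.comp h2

theorem weight_arg_eq (τ δ t : ℝ) :
    ((1 / 2 + δ + t * I : ℂ) - 1 / 2) / (I * τ) = (t - δ * I) / τ := by
  rcases eq_or_ne τ 0 with rfl | h
  · simp
  have : (τ : ℂ) ≠ 0 := by exact_mod_cast h
  field_simp
  linear_combination (2 * δ : ℂ) * I_sq

theorem weight_eq (P : Polynomial ℝ) (τ δ t : ℝ) :
    weight P τ (1 / 2 + δ + t * I) = Polynomial.aeval ((t - δ * I) / τ : ℂ) P := by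
  rw [weight, weight_arg_eq]

theorem weight_half (P : Polynomial ℝ) (τ t : ℝ) :
    weight P τ (1 / 2 + t * I) = (P.eval (t / τ) : ℝ) := by
  have := weight_eq P τ 0 t
  simp only [ofReal_zero, add_zero, zero_mul, sub_zero] at this
  rw [this, ← ofReal_div, aeval_ofReal]

theorem weight_conj (P : Polynomial ℝ) (τ : ℝ) (s : ℂ) :
    (starRingEnd ℂ) (weight P τ s) = weight P τ (1 - (starRingEnd ℂ) s) := by
  rw [weight, weight, ← Polynomial.aeval_conj]
  congr 1
  rw [map_div₀, map_sub, map_mul, conj_I, conj_ofReal, map_div₀, map_one, conj_ofNat]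
  rw [show (1 : ℂ) - (starRingEnd ℂ) s - 1 / 2 = -((starRingEnd ℂ) s - 1 / 2) by ring, neg_mul,
    div_neg, neg_div]

theorem norm_sub_mul_I_le {x δ : ℝ} (hx : x ∈ Icc (0 : ℝ) 1) (hδ : δ ∈ Icc (0 : ℝ) 1) :
    ‖(x - δ * I : ℂ)‖ ≤ 2 := by
  refine (norm_sub_le _ _).trans ?_
  rw [norm_mul, norm_I, norm_real, norm_real, Real.norm_of_nonneg hx.1, Real.norm_of_nonneg hδ.1]
  linarith [hx.2, hδ.2]

theorem hasDerivAt_line (τ δ t : ℝ) :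
    HasDerivAt (fun t : ℝ => (t - δ * I : ℂ) / τ) (1 / τ) t :=
  ((hasDerivAt_id t).ofReal_comp.sub_const _).div_const _

/-- Repeated integration by parts: an oscillatory integral against a polynomial that vanishes to
order `K` at both ends. -/
theorem exists_norm_integral_mul_exp_le (n : ℕ) :
    ∀ (K : ℕ) (P : Polynomial ℝ), Polynomial.X ^ K ∣ P → (Polynomial.X - 1) ^ K ∣ P →
      Polynomial.derivative^[n] P = 0 →
      ∃ C : ℝ, 0 ≤ C ∧ ∀ τ b δ N l : ℝ, 1 ≤ τ → b ∈ Icc (0 : ℝ) 1 → δ ∈ Icc (0 : ℝ) 1 →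
        N ∈ Icc 1 τ → 1 / N ≤ |l| →
        ‖∫ t in b..τ, Polynomial.aeval ((t - δ * I) / τ : ℂ) P * exp (I * l * t)‖ ≤
          C * (N * (N / τ) ^ K) := by
  induction n with
  | zero =>
    intro K P _ _ hP
    refine ⟨0, le_rfl, fun τ b δ N l _ _ _ _ _ => ?_⟩
    rw [Function.iterate_zero, id_eq] at hP
    simp [hP]
  | succ n ih =>
    intro K P h0 h1 hP
    -- Differentiating lowers the order of vanishing by one. The factor 1/(τ|l|) ≤ N/τ from the
    -- integration by parts restores that power; the induction ends when the derivatives of P run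
    -- out.
    obtain ⟨C, hC0, hC⟩ := ih (K - 1) (Polynomial.derivative P)
      (Polynomial.pow_sub_one_dvd_derivative_of_pow_dvd h0)
      (Polynomial.pow_sub_one_dvd_derivative_of_pow_dvd h1) (by
        rwa [Function.iterate_succ_apply] at hP)
    obtain ⟨D, hD0, hD⟩ := exists_norm_aeval_le_pow h0 h1 2
    refine ⟨2 * D * 2 ^ K + C, by positivity, fun τ b δ N l hτ hb hδ hN hl => ?_⟩
    have hτ0 : 0 < τ := by linarith
    have hτc : (τ : ℂ) ≠ 0 := by exact_mod_cast hτ0.ne'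
    have hN0 : 0 < N := by linarith [hN.1]
    have hl0 : 0 < |l| := lt_of_lt_of_le (by positivity) hl
    have hlc : (l : ℂ) ≠ 0 := by exact_mod_cast abs_pos.mp hl0
    have hlinv : |l|⁻¹ ≤ N := inv_le_of_inv_le₀ hN0 (by simpa using hl)
    set z : ℝ → ℂ := fun t => (t - δ * I) / τ with hz
    have hzn : ∀ t, ‖z t‖ = ‖(t - δ * I : ℂ)‖ / τ := fun t => by
      rw [hz, norm_div, norm_real, Real.norm_of_nonneg hτ0.le]
    have hzτ : ‖z τ - 1‖ ≤ 1 / τ := by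
      rw [show z τ - 1 = -(δ * I) / τ by rw [hz]; field_simp; ring, norm_div, norm_neg, norm_mul,
        norm_I, norm_real, norm_real, Real.norm_of_nonneg hτ0.le, Real.norm_of_nonneg hδ.1]
      gcongr
      linarith [hδ.2]
    have hzb : ‖z b‖ ≤ 2 / τ := by
      rw [hzn]
      gcongr
      exact norm_sub_mul_I_le hb hδ
    have hexp : ∀ t : ℝ, ‖exp (I * l * t)‖ = 1 := fun t => by
      rw [show (I * l * t : ℂ) = ((l * t : ℝ) : ℂ) * I by push_cast; ring, norm_exp_ofReal_mul_I]
    have hK : (1 : ℝ) / τ ≤ N / τ := by gcongr; exact hN.1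
    have hPb : ‖Polynomial.aeval (z b) P‖ ≤ D * 2 ^ K * (N / τ) ^ K := by
      refine (hD (z b) (hzb.trans ((div_le_iff₀ hτ0).mpr (by linarith)))).1.trans ?_
      rw [mul_assoc, ← mul_pow]
      gcongr
      refine hzb.trans ?_
      calc 2 / τ = 2 * (1 / τ) := by ring
        _ ≤ 2 * (N / τ) := by gcongr
    have hPτ : ‖Polynomial.aeval (z τ) P‖ ≤ D * 2 ^ K * (N / τ) ^ K := by
      have h2 : ‖z τ‖ ≤ 2 := by
        have h3 : (1 : ℝ) / τ ≤ 1 := (div_le_one hτ0).mpr hτ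
        calc ‖z τ‖ = ‖(z τ - 1) + 1‖ := by ring_nf
          _ ≤ ‖z τ - 1‖ + ‖(1 : ℂ)‖ := norm_add_le _ _
          _ ≤ 2 := by rw [norm_one]; linarith
      refine (hD (z τ) h2).2.trans ?_
      rw [mul_assoc, ← mul_pow]
      gcongr
      refine hzτ.trans (hK.trans ?_)
      have : 0 ≤ N / τ := by positivity
      linarith
    have hdz := hasDerivAt_line τ δ
    have hdP : ∀ t : ℝ, HasDerivAt (fun t => Polynomial.aeval (z t) P)
        (Polynomial.aeval (z t) (Polynomial.derivative P) * (1 / τ)) t := fun t =>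
      (P.hasDerivAt_aeval (z t)).comp t (hdz t)
    have hdE : ∀ t : ℝ, HasDerivAt (fun t : ℝ => exp (I * l * t) / (I * l)) (exp (I * l * t)) t :=
      fun t => by
        have h2 : HasDerivAt (fun t : ℝ => I * l * t) (I * l) t := by
          simpa using (hasDerivAt_id t).ofReal_comp.const_mul (I * l)
        have h3 := h2.cexp.div_const (I * l)
        rwa [mul_div_assoc, div_self (mul_ne_zero I_ne_zero hlc), mul_one] at h3
    have hzc : Continuous z := by
      simp only [hz]; fun_prop
    have hparts := intervalIntegral.integral_mul_deriv_eq_deriv_mul (a := b) (b := τ)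
      (u := fun t => Polynomial.aeval (z t) P) (v := fun t : ℝ => exp (I * l * t) / (I * l))
      (fun t _ => hdP t) (fun t _ => hdE t)
      (((Polynomial.continuous_aeval _).comp hzc).mul continuous_const |>.intervalIntegrable _ _)
      ((by fun_prop : Continuous fun t : ℝ => exp (I * l * t)).intervalIntegrable _ _)
    rw [hparts]
    have e : (∫ t in b..τ, Polynomial.aeval (z t) (Polynomial.derivative P) * (1 / τ) *
        (exp (I * l * t) / (I * l))) = (1 / (τ * (I * l))) *
        ∫ t in b..τ, Polynomial.aeval (z t) (Polynomial.derivative P) * exp (I * l * t) := by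
      rw [← intervalIntegral.integral_const_mul]
      congr 1
      ext t
      field_simp
    rw [e]
    have hnl : ‖(I * l : ℂ)‖ = |l| := by rw [norm_mul, norm_I, norm_real, one_mul, Real.norm_eq_abs]
    have b1 : ∀ t, ‖Polynomial.aeval (z t) P‖ ≤ D * 2 ^ K * (N / τ) ^ K →
        ‖Polynomial.aeval (z t) P * (exp (I * l * t) / (I * l))‖ ≤
          D * 2 ^ K * (N / τ) ^ K * N := fun t ht => by
      rw [norm_mul, norm_div, hexp, hnl, one_div]
      gcongr
    have b2 : ‖(1 / (τ * (I * l))) * ∫ t in b..τ,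
        Polynomial.aeval (z t) (Polynomial.derivative P) * exp (I * l * t)‖ ≤
        C * (N * (N / τ) ^ K) := by
      have h2 := hC τ b δ N l hτ hb hδ hN hl
      rw [norm_mul, norm_div, norm_one, norm_mul, hnl, norm_real, Real.norm_of_nonneg hτ0.le]
      have h3 : N / τ ≤ 1 := (div_le_one hτ0).mpr hN.2
      -- For K = 0 the subtraction K - 1 truncates to 0, and N ≤ τ is used instead.
      have h4 : N / τ * (N / τ) ^ (K - 1) ≤ (N / τ) ^ K := by
        rcases Nat.eq_zero_or_pos K with rfl | hKpos
        · simpa using h3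
        · rw [← pow_succ', Nat.sub_add_cancel hKpos]
      calc 1 / (τ * |l|) * _ ≤ (N / τ) * (C * (N * (N / τ) ^ (K - 1))) := by
            refine mul_le_mul ?_ h2 (norm_nonneg _) (by positivity)
            rw [one_div, mul_inv, mul_comm, div_eq_mul_inv]
            gcongr
        _ = C * (N * (N / τ * (N / τ) ^ (K - 1))) := by ring
        _ ≤ _ := by gcongr
    calc _ ≤ D * 2 ^ K * (N / τ) ^ K * N + D * 2 ^ K * (N / τ) ^ K * N +
          C * (N * (N / τ) ^ K) :=
        (norm_sub_le _ _).trans (add_le_add ((norm_sub_le _ _).trans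
          (add_le_add (b1 τ hPτ) (b1 b hPb))) b2)
      _ = _ := by ring

theorem exists_norm_integral_weight_mul_exp_le {P : Polynomial ℝ} {K : ℕ}
    (h0 : Polynomial.X ^ K ∣ P) (h1 : (Polynomial.X - 1) ^ K ∣ P) :
    ∃ C : ℝ, 0 ≤ C ∧ ∀ τ b δ N l : ℝ, 1 ≤ τ → b ∈ Icc (0 : ℝ) 1 → δ ∈ Icc (0 : ℝ) 1 →
      N ∈ Icc 1 τ → 1 / N ≤ |l| →
      ‖∫ t in b..τ, weight P τ (1 / 2 + δ + t * I) * exp (I * l * t)‖ ≤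
        C * (N * (N / τ) ^ K) := by
  simp only [weight_eq]
  exact exists_norm_integral_mul_exp_le (P.natDegree + 1) K P h0 h1
    (Polynomial.iterate_derivative_eq_zero (Nat.lt_succ_self _))

/-- Moving off the critical line shifts the argument of P by δ/τ, hence its value by O(1/τ), over a
range of length at most τ. The missing piece [0, b] adds O(1). -/
theorem exists_norm_integral_weight_sub_le (P : Polynomial ℝ) :
    ∃ C : ℝ, 0 ≤ C ∧ ∀ τ b δ : ℝ, 1 ≤ τ → b ∈ Icc (0 : ℝ) 1 → δ ∈ Icc (0 : ℝ) 1 →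
      ‖(∫ t in b..τ, weight P τ (1 / 2 + δ + t * I)) - τ * (∫ x in (0 : ℝ)..1, P.eval x : ℝ)‖
        ≤ C := by
  obtain ⟨A, hA0, hA⟩ := exists_norm_aeval_le P 2
  obtain ⟨L, hL0, hL⟩ := exists_norm_aeval_le (Polynomial.derivative P) 2
  refine ⟨A + L, by positivity, fun τ b δ hτ hb hδ => ?_⟩
  have hτ0 : 0 < τ := by linarith
  have hτc : (τ : ℂ) ≠ 0 := by exact_mod_cast hτ0.ne'
  have hlip : ∀ x ∈ Icc (0 : ℝ) 1, ‖Polynomial.aeval (x - δ * I / τ : ℂ) P -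
      Polynomial.aeval (x : ℂ) P‖ ≤ L * (1 / τ) := fun x hx => by
    have hdτ : ‖(δ * I / τ : ℂ)‖ ≤ 1 / τ := by
      rw [norm_div, norm_mul, norm_I, norm_real, norm_real, Real.norm_of_nonneg hτ0.le,
        Real.norm_of_nonneg hδ.1]
      gcongr
      linarith [hδ.2]
    have h1τ : 1 / τ ≤ 1 := (div_le_one hτ0).mpr hτ
    have hxn : ‖(x : ℂ)‖ ≤ 1 := by rw [norm_real, Real.norm_of_nonneg hx.1]; exact hx.2
    have h2 := (convex_closedBall (0 : ℂ) 2).norm_image_sub_le_of_norm_hasDerivWithin_le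
      (f := fun z => Polynomial.aeval z P)
      (fun z _ => (P.hasDerivAt_aeval z).hasDerivWithinAt)
      (fun z hz => hL z (by simpa using hz)) (x := (x : ℂ)) (y := (x - δ * I / τ : ℂ))
      (by simpa using hxn.trans one_le_two) (by
        rw [Metric.mem_closedBall, dist_zero_right]
        exact (norm_sub_le _ _).trans (by linarith))
    refine h2.trans ?_
    gcongr
    rwa [show (x - δ * I / τ - x : ℂ) = -(δ * I / τ) by ring, norm_neg]
  have hc0 : Continuous fun t : ℝ => Polynomial.aeval ((t / τ : ℝ) : ℂ) P :=
    P.continuous_aeval.comp (by fun_prop)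
  have hc1 : Continuous fun t : ℝ => weight P τ (1 / 2 + δ + t * I) :=
    (differentiable_weight P τ).continuous.comp (by fun_prop)
  have e1 : (τ : ℂ) * (∫ x in (0 : ℝ)..1, P.eval x : ℝ) =
      ∫ t in (0 : ℝ)..τ, Polynomial.aeval ((t / τ : ℝ) : ℂ) P := by
    simp only [aeval_ofReal]
    rw [intervalIntegral.integral_ofReal,
      intervalIntegral.integral_comp_div (fun x => P.eval x) hτ0.ne']
    rw [zero_div, div_self hτ0.ne', smul_eq_mul, ofReal_mul]
  have e2 := intervalIntegral.integral_add_adjacent_intervals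
    (hc0.intervalIntegrable (μ := volume) 0 b) (hc0.intervalIntegrable b τ)
  rw [e1, ← e2, ← sub_sub, sub_right_comm,
    ← intervalIntegral.integral_sub (hc1.intervalIntegrable _ _) (hc0.intervalIntegrable _ _)]
  have hbτ : b ≤ τ := hb.2.trans hτ
  have b1 : ‖∫ t in b..τ, (weight P τ (1 / 2 + δ + t * I) -
      Polynomial.aeval ((t / τ : ℝ) : ℂ) P)‖ ≤ L := by
    refine (intervalIntegral.norm_integral_le_of_norm_le_const (C := L * (1 / τ)) fun t ht => ?_
      ).trans ?_
    · rw [uIoc_of_le hbτ] at ht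
      have := hlip (t / τ) ⟨div_nonneg (hb.1.trans ht.1.le) hτ0.le, (div_le_one hτ0).mpr ht.2⟩
      rw [weight_eq, sub_div]
      push_cast at this ⊢
      exact this
    · rw [abs_of_nonneg (sub_nonneg.mpr hbτ)]
      calc L * (1 / τ) * (τ - b) ≤ L * (1 / τ) * τ := by gcongr; linarith [hb.1]
        _ = L := by field_simp
  have b2 : ‖∫ t in (0 : ℝ)..b, Polynomial.aeval ((t / τ : ℝ) : ℂ) P‖ ≤ A := by
    refine (intervalIntegral.norm_integral_le_of_norm_le_const (C := A) fun t ht => ?_).trans ?_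
    · rw [uIoc_of_le hb.1] at ht
      refine hA _ ?_
      rw [norm_real, Real.norm_of_nonneg (div_nonneg ht.1.le hτ0.le)]
      exact ((div_le_one hτ0).mpr (ht.2.trans hbτ)).trans one_le_two
    · rw [sub_zero, abs_of_nonneg hb.1]
      exact mul_le_of_le_one_right hA0 hb.2
  refine (norm_sub_le _ _).trans ?_
  linarith

/-! ### The mollifier and weighted mean values -/

/-- The partial sum `∑ μ(n) n^{-s}` over `1 ≤ n ≤ N`. -/
noncomputable def mollifier (N : ℕ) (s : ℂ) : ℂ :=
  ∑ n ∈ Finset.Icc 1 N, (ArithmeticFunction.moebius n : ℂ) * (n : ℂ) ^ (-s)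

theorem natCast_cpow_line {n : ℕ} (hn : n ≠ 0) (s : ℂ) (t : ℝ) :
    (n : ℂ) ^ (s + t * I) = (n : ℂ) ^ s * exp (I * Real.log n * t) := by
  have hn' : (n : ℂ) ≠ 0 := Nat.cast_ne_zero.mpr hn
  rw [cpow_add _ _ hn', cpow_def_of_ne_zero hn' (t * I), natCast_log]
  congr 2
  ring

/-- From log x ≥ 1 - 1/x. Only n is bounded by N, since m runs over a whole Dirichlet series; for m
> n the bound 1/(n+1) is still at least 1/(2N). -/
theorem abs_log_sub_log_ge {m n N : ℕ} (hm : m ≠ 0) (hn : n ≠ 0) (hmn : m ≠ n) (hN : n ≤ N) :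
    1 / (2 * N : ℝ) ≤ |Real.log n - Real.log m| := by
  have hm0 : (0 : ℝ) < m := by positivity
  have hn0 : (0 : ℝ) < n := by positivity
  have hn1 : (1 : ℝ) ≤ n := by exact_mod_cast Nat.one_le_iff_ne_zero.mpr hn
  have hNn : (n : ℝ) ≤ N := by exact_mod_cast hN
  rcases lt_or_gt_of_ne hmn with h | h
  · have h1 := Real.one_sub_inv_le_log_of_pos (x := (n : ℝ) / m) (by positivity)
    rw [Real.log_div hn0.ne' hm0.ne', inv_div] at h1
    refine le_trans ?_ (h1.trans (le_abs_self _))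
    have h2 : (m : ℝ) + 1 ≤ n := by exact_mod_cast h
    calc 1 / (2 * N : ℝ) ≤ 1 / n := by gcongr; linarith
      _ ≤ 1 - m / n := by
        rw [div_le_iff₀ hn0, sub_mul, div_mul_cancel₀ _ hn0.ne']; linarith
  · have h1 := Real.one_sub_inv_le_log_of_pos (x := (m : ℝ) / n) (by positivity)
    rw [Real.log_div hm0.ne' hn0.ne', inv_div] at h1
    rw [abs_sub_comm]
    refine le_trans ?_ (h1.trans (le_abs_self _))
    have h2 : (n : ℝ) + 1 ≤ m := by exact_mod_cast h
    calc 1 / (2 * N : ℝ) ≤ 1 / (n + 1) := by gcongr; linarith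
      _ ≤ 1 - n / m := by
        rw [div_le_iff₀ (by linarith), sub_mul, div_mul_eq_mul_div, le_sub_iff_add_le,
          ← le_sub_iff_add_le', div_le_iff₀ hm0]
        nlinarith

theorem continuous_LSeries_term (a : ℕ → ℂ) (s : ℂ) (m : ℕ) :
    Continuous fun t : ℝ => LSeries.term a (s + t * I) m := by
  rcases eq_or_ne m 0 with rfl | hm
  · simpa using continuous_const
  have hm' : (m : ℂ) ≠ 0 := Nat.cast_ne_zero.mpr hm
  simp only [LSeries.term_of_ne_zero hm]
  refine Continuous.div continuous_const ?_ fun t => by simp [cpow_eq_zero_iff, hm']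
  exact Continuous.const_cpow (by fun_prop) (Or.inl hm')

theorem norm_natCast_cpow_line {n : ℕ} (hn : n ≠ 0) (s : ℂ) (t : ℝ) :
    ‖(n : ℂ) ^ (s + t * I)‖ = (n : ℝ) ^ s.re := by
  rw [norm_natCast_cpow_of_pos (Nat.pos_of_ne_zero hn)]; simp

/-- The integral of a Dirichlet series times a Dirichlet polynomial against a weight: only the
diagonal terms matter. -/
theorem exists_norm_integral_LSeries_mul_mollifier_sub_le {P : Polynomial ℝ} {K : ℕ}
    (h0 : Polynomial.X ^ K ∣ P) (h1 : (Polynomial.X - 1) ^ K ∣ P) :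
    ∃ C : ℝ, 0 ≤ C ∧ ∀ (τ b δ : ℝ) (N : ℕ) (a : ℕ → ℂ), 1 ≤ τ → b ∈ Icc (0 : ℝ) 1 →
      δ ∈ Icc (0 : ℝ) 1 → 1 ≤ N → 2 * N ≤ τ → LSeriesSummable a (1 / 2 + δ) →
      ‖(∫ t in b..τ, LSeries a (1 / 2 + δ + t * I) * mollifier N (1 - (1 / 2 + δ + t * I)) *
          weight P τ (1 / 2 + δ + t * I)) -
        (∑ n ∈ Finset.Icc 1 N, a n * ArithmeticFunction.moebius n / n) *
          (τ * (∫ x in (0 : ℝ)..1, P.eval x : ℝ))‖ ≤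
      C * ∑ n ∈ Finset.Icc 1 N, ‖a n‖ / n +
        C * (∑' m, ‖LSeries.term a (1 / 2 + δ) m‖) * (N ^ 2 * (2 * N * (2 * N / τ) ^ K)) := by
  obtain ⟨C₁, hC₁0, hosc⟩ := exists_norm_integral_weight_mul_exp_le h0 h1
  obtain ⟨C₂, hC₂0, hdiag⟩ := exists_norm_integral_weight_sub_le P
  obtain ⟨B, hB0, hB⟩ := exists_norm_aeval_le P 2
  refine ⟨C₁ + C₂, by positivity, fun τ b δ N a hτ hb hδ hN hNτ ha => ?_⟩
  have hτ0 : 0 < τ := by linarith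
  have hbτ : b ≤ τ := hb.2.trans hτ
  have hN1 : (1 : ℝ) ≤ N := by exact_mod_cast hN
  set σ : ℂ := 1 / 2 + δ with hσ
  have hσre : σ.re = 1 / 2 + δ := by simp [hσ]
  set W : ℝ → ℂ := fun t => weight P τ (σ + t * I) with hW
  have hWc : Continuous W := (differentiable_weight P τ).continuous.comp (by fun_prop)
  have hWB : ∀ t ∈ Ioc b τ, ‖W t‖ ≤ B := fun t ht => by
    simp only [hW, hσ, weight_eq]
    refine hB _ ?_
    have ht0 : 0 ≤ t := hb.1.trans ht.1.le
    rw [norm_div, norm_real, Real.norm_of_nonneg hτ0.le, div_le_iff₀ hτ0]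
    refine (norm_sub_le _ _).trans ?_
    rw [norm_mul, norm_I, norm_real, norm_real, Real.norm_of_nonneg ht0, Real.norm_of_nonneg hδ.1]
    linarith [ht.2, hδ.2]
  set A : ℝ := ∑' m, ‖LSeries.term a σ m‖ with hA
  set E : ℝ := 2 * N * (2 * N / τ) ^ K with hE
  have hE0 : 0 ≤ E := by positivity
  have hosc' : ∀ l : ℝ, 1 / (2 * N : ℝ) ≤ |l| →
      ‖∫ t in b..τ, W t * exp (I * l * t)‖ ≤ C₁ * E := fun l hl =>
    hosc τ b δ (2 * N) l hτ hb hδ ⟨by linarith, hNτ⟩ hl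
  -- For fixed n, sum and integral are interchanged. In the term m = n the powers reduce to the
  -- constant 1/n; every other term oscillates with frequency log n - log m and falls under `hosc'`.
  have hone : ∀ n ∈ Finset.Icc 1 N, ‖(∫ t in b..τ, LSeries a (σ + t * I) *
      (n : ℂ) ^ (σ - 1 + t * I) * W t) - a n / n * (∫ t in b..τ, W t)‖ ≤ A * N * (C₁ * E) := by
    intro n hn
    rw [Finset.mem_Icc] at hn
    have hn0 : n ≠ 0 := by omega
    have hnc : (n : ℂ) ≠ 0 := Nat.cast_ne_zero.mpr hn0
    have hn1 : (1 : ℝ) ≤ n := by exact_mod_cast hn.1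
    have hnN : (n : ℝ) ≤ N := by exact_mod_cast hn.2
    have hnσ : (n : ℝ) ^ (σ - 1).re ≤ N := by
      rw [sub_re, hσre, one_re]
      calc (n : ℝ) ^ (1 / 2 + δ - 1) ≤ (n : ℝ) ^ (1 : ℝ) :=
            Real.rpow_le_rpow_of_exponent_le hn1 (by linarith [hδ.2])
        _ ≤ N := by rwa [Real.rpow_one]
    set F : ℕ → ℝ → ℂ := fun m t =>
      LSeries.term a (σ + t * I) m * (n : ℂ) ^ (σ - 1 + t * I) * W t with hF
    have hcn : Continuous fun t : ℝ => (n : ℂ) ^ (σ - 1 + t * I) :=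
      Continuous.const_cpow (by fun_prop) (Or.inl hnc)
    have hterm : ∀ (m : ℕ) (t : ℝ), ‖LSeries.term a (σ + t * I) m‖ = ‖LSeries.term a σ m‖ :=
      fun m t => by rw [LSeries.norm_term_eq, LSeries.norm_term_eq]; simp
    have hsumF : HasSum (fun m => ∫ t in b..τ, F m t)
        (∫ t in b..τ, LSeries a (σ + t * I) * (n : ℂ) ^ (σ - 1 + t * I) * W t) := by
      refine intervalIntegral.hasSum_integral_of_dominated_convergence
        (fun m _ => ‖LSeries.term a σ m‖ * N * B) (fun m => ?_) (fun m => ?_) ?_ ?_ ?_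
      · exact (((continuous_LSeries_term a σ m).mul hcn).mul hWc).aestronglyMeasurable
      · refine ae_of_all _ fun t ht => ?_
        rw [uIoc_of_le hbτ] at ht
        simp only [hF]
        rw [norm_mul, norm_mul, hterm, norm_natCast_cpow_line hn0]
        gcongr
        exact hWB t ht
      · exact ae_of_all _ fun t _ => (ha.norm.mul_right _).mul_right _
      · exact intervalIntegrable_const
      · refine ae_of_all _ fun t _ => ?_
        have hs : LSeriesSummable a (σ + t * I) :=
          ha.of_re_le_re (by simp)
        exact (hs.hasSum.mul_right _).mul_right _
    have hdiagterm : (∫ t in b..τ, F n t) = a n / n * (∫ t in b..τ, W t) := by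
      rw [← intervalIntegral.integral_const_mul]
      congr 1
      ext t
      simp only [hF, LSeries.term_of_ne_zero hn0]
      congr 1
      rw [show σ - 1 + t * I = (σ + t * I) - 1 by ring, cpow_sub _ _ hnc, cpow_one]
      have : (n : ℂ) ^ (σ + t * I) ≠ 0 := by simp [cpow_eq_zero_iff, hnc]
      field_simp
    have hoff : ∀ m, ‖(∫ t in b..τ, F m t) - (if m = n then ∫ t in b..τ, F n t else 0)‖ ≤
        ‖LSeries.term a σ m‖ * (N * (C₁ * E)) := by
      intro m
      by_cases hmn : m = n
      · subst hmn
        simp only [if_true, sub_self, norm_zero]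
        positivity
      rw [if_neg hmn, sub_zero]
      rcases eq_or_ne m 0 with rfl | hm
      · simp [hF]
      have e : ∀ t : ℝ, F m t = LSeries.term a σ m * (n : ℂ) ^ (σ - 1) *
          (W t * exp (I * ((Real.log n - Real.log m : ℝ) : ℂ) * t)) := fun t => by
        simp only [hF]
        rw [LSeries.term_of_ne_zero hm, LSeries.term_of_ne_zero hm, natCast_cpow_line hm,
          natCast_cpow_line hn0, show I * ((Real.log n - Real.log m : ℝ) : ℂ) * t =
            I * Real.log n * t - I * Real.log m * t by push_cast; ring, exp_sub]
        have := exp_ne_zero (I * Real.log m * t)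
        have hmc : (m : ℂ) ^ σ ≠ 0 := by simp [cpow_eq_zero_iff, hm]
        field_simp
      simp only [e]
      rw [intervalIntegral.integral_const_mul, norm_mul, norm_mul, mul_assoc]
      have hl := hosc' _ (abs_log_sub_log_ge hm hn0 hmn hn.2)
      have hnσ' : ‖(n : ℂ) ^ (σ - 1)‖ ≤ N := by
        rwa [norm_natCast_cpow_of_pos (Nat.pos_of_ne_zero hn0)]
      gcongr
    rw [← hdiagterm]
    have hs := hsumF.sub (hasSum_ite_eq n (∫ t in b..τ, F n t))
    rw [← hs.tsum_eq, mul_assoc]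
    exact tsum_of_norm_bounded (ha.norm.hasSum.mul_right _) hoff
  have hcL : ContinuousOn (fun t : ℝ => LSeries a (σ + t * I)) (uIcc b τ) := by
    refine continuousOn_tsum (fun m => (continuous_LSeries_term a σ m).continuousOn)
      ha.norm fun m t _ => ?_
    rw [LSeries.norm_term_eq, LSeries.norm_term_eq]; simp
  have hsplit : (∫ t in b..τ, LSeries a (σ + t * I) * mollifier N (1 - (σ + t * I)) * W t) =
      ∑ n ∈ Finset.Icc 1 N, (ArithmeticFunction.moebius n : ℂ) *
        ∫ t in b..τ, LSeries a (σ + t * I) * (n : ℂ) ^ (σ - 1 + t * I) * W t := by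
    simp only [← intervalIntegral.integral_const_mul]
    rw [← intervalIntegral.integral_finsetSum]
    · refine intervalIntegral.integral_congr fun t _ => ?_
      simp only [mollifier, Finset.mul_sum, Finset.sum_mul]
      refine Finset.sum_congr rfl fun n _ => ?_
      rw [show -(1 - (σ + t * I)) = σ - 1 + t * I by ring]
      ring
    · intro n hn
      have hnc : (n : ℂ) ≠ 0 := by
        rw [Finset.mem_Icc] at hn
        exact Nat.cast_ne_zero.mpr (by omega)
      have hcn : Continuous fun t : ℝ => (n : ℂ) ^ (σ - 1 + t * I) :=
        Continuous.const_cpow (by fun_prop) (Or.inl hnc)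
      exact (continuousOn_const.mul ((hcL.mul hcn.continuousOn).mul
        hWc.continuousOn)).intervalIntegrable
  have hμ : ∀ n : ℕ, ‖(ArithmeticFunction.moebius n : ℂ)‖ ≤ 1 := fun n => by
    rw [norm_intCast]
    exact_mod_cast ArithmeticFunction.abs_moebius_le_one (n := n)
  rw [hsplit]
  set I₀ : ℂ := τ * (∫ x in (0 : ℝ)..1, P.eval x : ℝ) with hI₀
  have hdiag' : ‖(∫ t in b..τ, W t) - I₀‖ ≤ C₂ := hdiag τ b δ hτ hb hδ
  rw [Finset.sum_mul, ← Finset.sum_sub_distrib]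
  have hfin : ∀ n ∈ Finset.Icc 1 N, ‖(ArithmeticFunction.moebius n : ℂ) *
      (∫ t in b..τ, LSeries a (σ + t * I) * (n : ℂ) ^ (σ - 1 + t * I) * W t) -
      a n * ArithmeticFunction.moebius n / n * I₀‖ ≤ C₂ * (‖a n‖ / n) + A * N * (C₁ * E) := by
    intro n hn
    have e : (ArithmeticFunction.moebius n : ℂ) *
      (∫ t in b..τ, LSeries a (σ + t * I) * (n : ℂ) ^ (σ - 1 + t * I) * W t) -
      a n * ArithmeticFunction.moebius n / n * I₀ = (ArithmeticFunction.moebius n : ℂ) *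
      (a n / n * ((∫ t in b..τ, W t) - I₀) + ((∫ t in b..τ, LSeries a (σ + t * I) *
        (n : ℂ) ^ (σ - 1 + t * I) * W t) - a n / n * (∫ t in b..τ, W t))) := by ring
    rw [e, norm_mul]
    refine (mul_le_of_le_one_left (norm_nonneg _) (hμ n)).trans ((norm_add_le _ _).trans ?_)
    refine add_le_add ?_ (hone n hn)
    rw [norm_mul, norm_div, norm_natCast, mul_comm]
    gcongr
  have hA0 : 0 ≤ A := tsum_nonneg fun m => norm_nonneg _
  have hsum0 : 0 ≤ ∑ n ∈ Finset.Icc 1 N, ‖a n‖ / n := Finset.sum_nonneg fun n _ => by positivity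
  calc _ ≤ ∑ n ∈ Finset.Icc 1 N, (C₂ * (‖a n‖ / n) + A * N * (C₁ * E)) :=
        norm_sum_le_of_le _ hfin
    _ = C₂ * ∑ n ∈ Finset.Icc 1 N, ‖a n‖ / n + C₁ * A * (N ^ 2 * E) := by
        rw [Finset.sum_add_distrib, ← Finset.mul_sum, Finset.sum_const, Nat.card_Icc,
          Nat.add_sub_cancel, nsmul_eq_mul]
        ring
    _ ≤ _ := by
        gcongr
        · linarith
        · linarith

/-- At heights τ and b ∈ [0, 1] the argument of P is within O(1/τ) of its zero of order K at 1,
respectively 0. This saving τ^{-K} controls the horizontal edges. -/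
theorem exists_norm_weight_le {P : Polynomial ℝ} {K : ℕ} (h0 : Polynomial.X ^ K ∣ P)
    (h1 : (Polynomial.X - 1) ^ K ∣ P) :
    ∃ D : ℝ, 0 ≤ D ∧ ∀ τ σ : ℝ, 1 ≤ τ → σ ∈ Icc (-(1 / 2) : ℝ) (3 / 2) →
      ‖weight P τ (σ + τ * I)‖ ≤ D / τ ^ K ∧
      (∀ b ∈ Icc (0 : ℝ) 1, ‖weight P τ (σ + b * I)‖ ≤ D / τ ^ K) ∧
      ∀ t ∈ Icc 0 τ, ‖weight P τ (σ + t * I)‖ ≤ D := by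
  obtain ⟨A, hA0, hA⟩ := exists_norm_aeval_le P 2
  obtain ⟨C, hC0, hC⟩ := exists_norm_aeval_le_pow h0 h1 2
  refine ⟨A + C * 2 ^ K, by positivity, fun τ σ hτ hσ => ?_⟩
  have hτ0 : 0 < τ := by linarith
  have hτc : (τ : ℂ) ≠ 0 := by exact_mod_cast hτ0.ne'
  have harg : ∀ t : ℝ, weight P τ (σ + t * I) =
      Polynomial.aeval ((t - (σ - 1 / 2 : ℝ) * I) / τ : ℂ) P := fun t => by
    rw [← weight_eq]; congr 1; push_cast; ring
  have hδ : ‖((σ - 1 / 2 : ℝ) * I : ℂ)‖ ≤ 1 := by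
    rw [norm_mul, norm_I, mul_one, norm_real, Real.norm_eq_abs, abs_le]
    constructor <;> linarith [hσ.1, hσ.2]
  have hz : ∀ t ∈ Icc 0 τ, ‖((t - (σ - 1 / 2 : ℝ) * I) / τ : ℂ)‖ ≤ (t + 1) / τ := fun t ht => by
    rw [norm_div, norm_real, Real.norm_of_nonneg hτ0.le]
    gcongr
    refine (norm_sub_le _ _).trans ?_
    rw [norm_real, Real.norm_of_nonneg ht.1]
    linarith
  have hz2 : ∀ t ∈ Icc 0 τ, ‖((t - (σ - 1 / 2 : ℝ) * I) / τ : ℂ)‖ ≤ 2 := fun t ht =>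
    (hz t ht).trans ((div_le_iff₀ hτ0).mpr (by linarith [ht.2]))
  have hAD : 0 ≤ C * 2 ^ K := by positivity
  have hCD : C ≤ C * 2 ^ K := le_mul_of_one_le_right hC0 (one_le_pow₀ (by norm_num))
  refine ⟨?_, fun b hb => ?_, fun t ht => ?_⟩
  · rw [harg]
    refine (hC _ (hz2 τ ⟨hτ0.le, le_rfl⟩)).2.trans ?_
    have e : ((τ - (σ - 1 / 2 : ℝ) * I) / τ : ℂ) - 1 = -((σ - 1 / 2 : ℝ) * I) / τ := by
      rw [sub_div, div_self hτc]; ring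
    rw [e, norm_div, norm_neg, norm_real, Real.norm_of_nonneg hτ0.le, div_pow, ← mul_div_assoc]
    gcongr
    calc C * ‖((σ - 1 / 2 : ℝ) * I : ℂ)‖ ^ K ≤ C * 1 ^ K := by gcongr
      _ ≤ A + C * 2 ^ K := by rw [one_pow, mul_one]; linarith
  · have hbτ : b ∈ Icc 0 τ := ⟨hb.1, hb.2.trans hτ⟩
    rw [harg]
    refine (hC _ (hz2 b hbτ)).1.trans ?_
    have h2 : ‖((b - (σ - 1 / 2 : ℝ) * I) / τ : ℂ)‖ ≤ 2 / τ :=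
      (hz b hbτ).trans (by gcongr; linarith [hb.2])
    calc C * ‖((b - (σ - 1 / 2 : ℝ) * I) / τ : ℂ)‖ ^ K ≤ C * (2 / τ) ^ K := by gcongr
      _ = C * 2 ^ K / τ ^ K := by rw [div_pow]; ring
      _ ≤ _ := by gcongr; linarith
  · rw [harg]
    exact (hA _ (hz2 t ht)).trans (by linarith)

theorem norm_moebius_le_one (n : ℕ) : ‖(ArithmeticFunction.moebius n : ℂ)‖ ≤ 1 := by
  rw [norm_intCast]
  exact_mod_cast ArithmeticFunction.abs_moebius_le_one (n := n)

theorem norm_mollifier_le (N : ℕ) {s : ℂ} (hs : -1 ≤ s.re) : ‖mollifier N s‖ ≤ (N : ℝ) ^ 2 := by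
  have h : ∀ n ∈ Finset.Icc 1 N, ‖(ArithmeticFunction.moebius n : ℂ) * (n : ℂ) ^ (-s)‖ ≤ N := by
    intro n hn
    rw [Finset.mem_Icc] at hn
    have hn1 : (1 : ℝ) ≤ n := by exact_mod_cast hn.1
    rw [norm_mul, norm_natCast_cpow_of_pos hn.1]
    refine (mul_le_of_le_one_left (by positivity) (norm_moebius_le_one n)).trans ?_
    calc (n : ℝ) ^ (-s).re ≤ (n : ℝ) ^ (1 : ℝ) :=
          Real.rpow_le_rpow_of_exponent_le hn1 (by rw [neg_re]; linarith)
      _ ≤ N := by rw [Real.rpow_one]; exact_mod_cast hn.2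
  refine (norm_sum_le_of_le _ h).trans (le_of_eq ?_)
  rw [Finset.sum_const, Nat.card_Icc, Nat.add_sub_cancel, nsmul_eq_mul, sq]

theorem differentiable_mollifier (N : ℕ) : Differentiable ℂ (mollifier N) := by
  refine Differentiable.fun_sum fun n hn => ?_
  rw [Finset.mem_Icc] at hn
  have hnc : (n : ℂ) ≠ 0 := Nat.cast_ne_zero.mpr (by omega)
  exact (Differentiable.const_cpow differentiable_neg (Or.inl hnc)).const_mul _

theorem mollifier_conj (N : ℕ) (s : ℂ) :
    (starRingEnd ℂ) (mollifier N s) = mollifier N ((starRingEnd ℂ) s) := by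
  rw [mollifier, mollifier, map_sum]
  refine Finset.sum_congr rfl fun n _ => ?_
  rw [map_mul, ← map_neg, conj_intCast', ← natCast_cpow_conj]
where
  conj_intCast' {k : ℤ} : (starRingEnd ℂ) (k : ℂ) = k := by simp
  natCast_cpow_conj {n : ℕ} {w : ℂ} :
      (n : ℂ) ^ ((starRingEnd ℂ) w) = (starRingEnd ℂ) ((n : ℂ) ^ w) := by
    rw [cpow_conj _ _ (by rw [natCast_arg]; exact Real.pi_ne_zero.symm)]; simp

/-- The coefficients of the mollifier, extended by zero. -/
noncomputable def mollifierCoeff (N : ℕ) (n : ℕ) : ℂ :=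
  if n ∈ Finset.Icc 1 N then (ArithmeticFunction.moebius n : ℂ) else 0

theorem hasSum_mollifierCoeff (N : ℕ) (s : ℂ) :
    LSeriesHasSum (mollifierCoeff N) s (mollifier N s) := by
  have hterm : mollifier N s = ∑ n ∈ Finset.Icc 1 N, LSeries.term (mollifierCoeff N) s n := by
    refine Finset.sum_congr rfl fun n hn => ?_
    have hn0 : n ≠ 0 := by rw [Finset.mem_Icc] at hn; omega
    rw [LSeries.term_of_ne_zero hn0, mollifierCoeff, if_pos hn, cpow_neg, div_eq_mul_inv]
  rw [LSeriesHasSum, hterm]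
  refine hasSum_sum_of_ne_finset_zero fun n hn => ?_
  rw [LSeries.term_def, mollifierCoeff, if_neg hn]
  simp

/-- Comparison with the absolutely convergent series of |μ(n)| n^{-3/2} makes the bound independent
of N. -/
theorem exists_norm_mollifier_three_half_le :
    ∃ Z : ℝ, 0 ≤ Z ∧ ∀ (N : ℕ), ∑' n, ‖LSeries.term (mollifierCoeff N) (3 / 2) n‖ ≤ Z ∧
      ∀ s : ℂ, s.re = 3 / 2 → ‖mollifier N s‖ ≤ Z := by
  have hsum : LSeriesSummable (fun n => (ArithmeticFunction.moebius n : ℂ)) (3 / 2) :=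
    ArithmeticFunction.LSeriesSummable_moebius_iff.mpr (by norm_num)
  refine ⟨∑' n, ‖LSeries.term (fun n => (ArithmeticFunction.moebius n : ℂ)) (3 / 2) n‖,
    tsum_nonneg fun n => norm_nonneg _, fun N => ?_⟩
  have hle : ∀ n, ‖LSeries.term (mollifierCoeff N) (3 / 2) n‖ ≤
      ‖LSeries.term (fun n => (ArithmeticFunction.moebius n : ℂ)) (3 / 2) n‖ := fun n => by
    refine LSeries.norm_term_le _ ?_
    rw [mollifierCoeff]
    split_ifs
    · rfl
    · simp
  have h1 := Summable.tsum_le_tsum hle (hasSum_mollifierCoeff N (3 / 2)).summable.norm hsum.norm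
  refine ⟨h1, fun s hs => ?_⟩
  rw [← (hasSum_mollifierCoeff N s).LSeries_eq]
  have h2 := norm_LSeries_le_tsum (σ := 3 / 2) (f := mollifierCoeff N)
    (hasSum_mollifierCoeff N _).LSeriesSummable s hs
  push_cast at h2
  exact h2.trans h1

/-! ### Residue sums over the zeros and the first moment -/

/-- The bottom edge must avoid the pole at 1, so it sits at a positive height. A compact rectangle
contains finitely many zeros, so some b in (0, 1) misses their ordinates. -/
theorem exists_heightBound_low : ∃ b ∈ Ioo (0 : ℝ) 1, ∃ B : ℝ, 0 ≤ B ∧ HeightBound B b := by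
  have hK : IsCompact (Icc (-(1 / 2) : ℝ) (3 / 2) ×ℂ Icc (0 : ℝ) 1) :=
    isCompact_Icc.reProdIm isCompact_Icc
  have hfin := (hK.inter_riemannZetaZeros_finite.image im)
  obtain ⟨b, hb, hbz⟩ := (Ioo_infinite (zero_lt_one' ℝ)).exists_notMem_finite hfin
  have hne : ∀ σ ∈ Icc (-(1 / 2) : ℝ) (3 / 2), riemannZeta (σ + b * I) ≠ 0 := fun σ hσ h =>
    hbz ⟨σ + b * I, ⟨horizontal_mem hσ ⟨hb.1.le, hb.2.le⟩, h⟩, by simp⟩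
  have hne1 : ∀ σ : ℝ, (σ + b * I : ℂ) ≠ 1 := fun σ h => by
    have := congrArg im h
    simp at this
    exact hb.1.ne' this
  have hU : IsOpen ({1}ᶜ : Set ℂ) := isOpen_compl_singleton
  have hζ : DifferentiableOn ℂ riemannZeta {1}ᶜ := fun z hz =>
    (differentiableAt_riemannZeta hz).differentiableWithinAt
  have hc1 : ContinuousOn (fun σ : ℝ => (riemannZeta (σ + b * I))⁻¹)
      (Icc (-(1 / 2) : ℝ) (3 / 2)) :=
    (hζ.continuousOn.comp (continuous_horizontal b).continuousOn fun σ _ => hne1 σ).inv₀ hne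
  have hc2 : ContinuousOn (fun σ : ℝ => deriv riemannZeta (σ + b * I))
      (Icc (-(1 / 2) : ℝ) (3 / 2)) :=
    (hζ.deriv hU).continuousOn.comp (continuous_horizontal b).continuousOn fun σ _ => hne1 σ
  obtain ⟨B₁, hB₁⟩ := isCompact_Icc.exists_bound_of_continuousOn hc1
  obtain ⟨B₂, hB₂⟩ := isCompact_Icc.exists_bound_of_continuousOn hc2
  refine ⟨b, hb, max 0 (max B₁ B₂), le_max_left _ _, fun σ hσ => ⟨hne σ hσ, ?_, ?_⟩⟩
  · exact (hB₁ σ hσ).trans ((le_max_left _ _).trans (le_max_right _ _))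
  · exact (hB₂ σ hσ).trans ((le_max_right _ _).trans (le_max_right _ _))

theorem re_eq_half_of_riemannZeta_eq_zero (hRH : RiemannHypothesis) {s : ℂ} (hs : 0 < s.im)
    (h : riemannZeta s = 0) : s.re = 1 / 2 := by
  refine hRH s h ?_ (by simpa using ne_of_im_pos hs 1)
  rintro ⟨n, hn⟩
  have := ne_of_im_pos hs (-2 * (n + 1))
  push_cast at this
  exact this hn

/-- The zeros in the critical strip with `b < Im ρ ≤ τ`. -/
noncomputable def zetaZerosBetween (b τ : ℝ) : Finset ℂ :=
  (zetaZerosUpTo_finite τ).toFinset.filter fun ρ => b < ρ.im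

section

variable {b τ B B' : ℝ}

theorem zetaZerosBetween_spec (hRH : RiemannHypothesis) (hτ : HeightBound B τ)
    {ρ : ℂ} (hρ : ρ ∈ zetaZerosBetween b τ) :
    riemannZeta ρ = 0 ∧ ρ.re = 1 / 2 ∧ b < ρ.im ∧ ρ.im < τ := by
  simp only [zetaZerosBetween, Finset.mem_filter, Finite.mem_toFinset] at hρ
  obtain ⟨⟨h1, _, _, h4, h5⟩, h6⟩ := hρ
  have hre := re_eq_half_of_riemannZeta_eq_zero hRH h4 h1
  refine ⟨h1, hre, h6, lt_of_le_of_ne h5 fun h => ?_⟩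
  refine (hτ (1 / 2) ⟨by norm_num, by norm_num⟩).1 ?_
  rw [show (((1 / 2 : ℝ) : ℂ) + τ * I) = ρ from Complex.ext (by simp [hre]) (by simp [h])]
  exact h1

theorem mem_zetaZerosBetween (hRH : RiemannHypothesis) (hb : 0 < b) (hbB : HeightBound B b)
    {z : ℂ} (hz : z ∈ Icc (-(1 / 2) : ℝ) (3 / 2) ×ℂ Icc b τ) (h : riemannZeta z = 0) :
    z ∈ zetaZerosBetween b τ := by
  have hpos : 0 < z.im := hb.trans_le hz.2.1
  have hre := re_eq_half_of_riemannZeta_eq_zero hRH hpos h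
  simp only [zetaZerosBetween, Finset.mem_filter, Finite.mem_toFinset]
  refine ⟨⟨h, by rw [hre]; norm_num, by rw [hre]; norm_num, hpos, hz.2.2⟩,
    lt_of_le_of_ne hz.2.1 fun h' => ?_⟩
  refine (hbB (1 / 2) ⟨by norm_num, by norm_num⟩).1 ?_
  rw [show (((1 / 2 : ℝ) : ℂ) + b * I) = z from Complex.ext (by simp [hre]) (by simp [h'])]
  exact h

/-- Summing the residues of `f = g φ`, where `g` has a simple pole with residue `r ρ` at each zero
`ρ` of the zeta function and is holomorphic elsewhere. -/
theorem rectIntegral_zetaZeros (hRH : RiemannHypothesis) (hb : 0 < b) (hbτ : b ≤ τ)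
    (hbB : HeightBound B b) (hτB : HeightBound B' τ) {g φ : ℂ → ℂ} {r : ℂ → ℂ}
    (hφ : Differentiable ℂ φ)
    (hg : ∀ z : ℂ, 0 < z.im → riemannZeta z ≠ 0 → DifferentiableAt ℂ g z)
    (hr : ∀ ρ : ℂ, 0 < ρ.im → riemannZeta ρ = 0 →
      Tendsto (fun z => (z - ρ) * g z) (𝓝[≠] ρ) (𝓝 (r ρ))) :
    rectIntegral (fun s => g s * φ s) (-(1 / 2)) (3 / 2) b τ =
      2 * Real.pi * I * ∑ ρ ∈ zetaZerosBetween b τ, r ρ * φ ρ := by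
  refine rectIntegral_eq_sum_residues (by norm_num) hbτ (zetaZerosBetween b τ)
    (fun ρ => r ρ * φ ρ) (fun ρ hρ => ?_) (fun z hz hzS => ?_) (fun ρ hρ => ?_)
  · obtain ⟨_, h2, h3, h4⟩ := zetaZerosBetween_spec hRH hτB hρ
    refine ⟨?_, ⟨h3, h4⟩⟩
    simp only [mem_preimage, h2]
    norm_num
  · refine (hg z (hb.trans_le hz.2.1) fun h => hzS ?_).mul (hφ z)
    exact mem_zetaZerosBetween hRH hb hbB hz h
  · obtain ⟨h1, _, h3, _⟩ := zetaZerosBetween_spec hRH hτB hρ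
    have h := (hr ρ (hb.trans h3) h1).mul
      ((hφ ρ).continuousAt.tendsto.mono_left nhdsWithin_le_nhds)
    exact h.congr fun z => by ring

end

theorem tendsto_sub_mul_inv {f : ℂ → ℂ} {ρ : ℂ} (hf : DifferentiableAt ℂ f ρ) (h0 : f ρ = 0)
    (h1 : deriv f ρ ≠ 0) : Tendsto (fun z => (z - ρ) * (f z)⁻¹) (𝓝[≠] ρ) (𝓝 (deriv f ρ)⁻¹) := by
  have h := (hasDerivAt_iff_tendsto_slope.mp hf.hasDerivAt).inv₀ h1
  refine h.congr fun z => ?_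
  rw [slope_def_field, h0, sub_zero, inv_div, div_eq_mul_inv]

theorem norm_horizontal_integral_le {f : ℂ → ℂ} {e M : ℝ}
    (hf : ∀ σ ∈ Icc (-(1 / 2) : ℝ) (3 / 2), ‖f (σ + e * I)‖ ≤ M) :
    ‖∫ x : ℝ in (-(1 / 2))..(3 / 2), f (x + e * I)‖ ≤ 2 * M := by
  have := intervalIntegral.norm_integral_le_of_norm_le_const (a := -(1 / 2 : ℝ)) (b := 3 / 2)
    (f := fun x : ℝ => f (x + e * I)) (C := M) fun x hx => by
      rw [uIoc_of_le (by norm_num)] at hx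
      exact hf x ⟨hx.1.le, hx.2⟩
  refine this.trans (le_of_eq ?_)
  norm_num
  ring

/-- The first mollified moment `∑ W(ρ) M(1 - ρ) / ζ'(ρ)`. -/
theorem exists_norm_firstMoment_sub_le (hRH : RiemannHypothesis)
    (hsimple : ∀ s : ℂ, riemannZeta s = 0 → deriv riemannZeta s ≠ 0) {P : Polynomial ℝ} {K C : ℕ}
    (h0 : Polynomial.X ^ K ∣ P) (h1 : (Polynomial.X - 1) ^ K ∣ P) (hK : C + 2 ≤ K) {b B : ℝ}
    (hb : b ∈ Ioo (0 : ℝ) 1) (hB : 0 ≤ B) (hbB : HeightBound B b) :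
    ∃ A : ℝ, 0 ≤ A ∧ ∀ (τ : ℝ) (N : ℕ), 1 ≤ τ → HeightBound (τ ^ C) τ → 1 ≤ N → 2 * N ≤ τ →
      (N : ℝ) ^ 3 * (2 * N / τ) ^ K ≤ 1 →
      ‖(∑ ρ ∈ zetaZerosBetween b τ,
          (deriv riemannZeta ρ)⁻¹ * (mollifier N (1 - ρ) * weight P τ ρ)) -
        τ / (2 * Real.pi) * ((∫ x in (0 : ℝ)..1, P.eval x) * squarefreeSum N : ℝ)‖ ≤ A * τ := by
  obtain ⟨D, hD0, hD⟩ := exists_norm_weight_le h0 h1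
  obtain ⟨Z, hZ0, hZ⟩ := exists_norm_mollifier_three_half_le
  obtain ⟨E, hE0, hE⟩ := exists_norm_inv_riemannZeta_neg_half_le
  obtain ⟨F, hF0, hF⟩ := exists_norm_integral_LSeries_mul_mollifier_sub_le h0 h1
  set Y : ℝ :=
    ∑' m, ‖LSeries.term (fun n => (ArithmeticFunction.moebius n : ℂ)) (1 / 2 + (1 : ℝ)) m‖
  have hY0 : 0 ≤ Y := tsum_nonneg fun m => norm_nonneg _
  refine ⟨2 * (B * D) + 2 * D + E * Z * D + (2 * F + 2 * F * Y), by positivity,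
    fun τ N hτ hτB hN hNτ hNK => ?_⟩
  have hτ0 : 0 < τ := by linarith
  have hτc : (τ : ℂ) ≠ 0 := by exact_mod_cast hτ0.ne'
  have hbτ : b ≤ τ := hb.2.le.trans hτ
  have hN1 : (1 : ℝ) ≤ N := by exact_mod_cast hN
  have hNτ' : (N : ℝ) ≤ τ := by linarith
  set φ : ℂ → ℂ := fun s => mollifier N (1 - s) * weight P τ s with hφ
  have hφd : Differentiable ℂ φ :=
    ((differentiable_mollifier N).comp (differentiable_const _ |>.sub differentiable_id)).mul
      (differentiable_weight P τ)
  have hres := rectIntegral_zetaZeros hRH hb.1 hbτ hbB hτB (g := fun s => (riemannZeta s)⁻¹)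
    (φ := φ) (r := fun ρ => (deriv riemannZeta ρ)⁻¹) hφd
    (fun z hz hz0 => (differentiableAt_riemannZeta (by simpa using ne_of_im_pos hz 1)).inv hz0)
    (fun ρ hρ h => tendsto_sub_mul_inv
      (differentiableAt_riemannZeta (by simpa using ne_of_im_pos hρ 1)) h (hsimple ρ h))
  rw [rectIntegral] at hres
  set f : ℂ → ℂ := fun s => (riemannZeta s)⁻¹ * φ s with hf
  set Hb := ∫ x : ℝ in (-(1 / 2))..(3 / 2), f (x + b * I) with hHb
  set Hτ := ∫ x : ℝ in (-(1 / 2))..(3 / 2), f (x + τ * I) with hHτ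
  set R := ∫ y : ℝ in b..τ, f ((3 / 2 : ℝ) + y * I) with hR
  set Lf := ∫ y : ℝ in b..τ, f ((-(1 / 2) : ℝ) + y * I) with hLf
  set S₀ := ∑ ρ ∈ zetaZerosBetween b τ, (deriv riemannZeta ρ)⁻¹ * φ ρ with hS₀
  -- On the horizontal edges 1/ζ costs τ^C and the mollifier N² ≤ τ²; vanishing of order K ≥ C + 2
  -- pays for both.
  have hK2 : (N : ℝ) ^ 2 * τ ^ C / τ ^ K ≤ 1 := by
    rw [div_le_one (by positivity)]
    calc (N : ℝ) ^ 2 * τ ^ C ≤ τ ^ 2 * τ ^ C := by gcongr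
      _ = τ ^ (C + 2) := by ring
      _ ≤ τ ^ K := pow_le_pow_right₀ hτ hK
  have hmoll : ∀ (σ e : ℝ), σ ∈ Icc (-(1 / 2) : ℝ) (3 / 2) →
      ‖mollifier N (1 - (σ + e * I))‖ ≤ (N : ℝ) ^ 2 := fun σ e hσ =>
    norm_mollifier_le N (by simp; linarith [hσ.2])
  have hHτ' : ‖Hτ‖ ≤ 2 * D := by
    refine norm_horizontal_integral_le fun σ hσ => ?_
    simp only [hf, hφ]
    rw [norm_mul, norm_mul]
    calc _ ≤ τ ^ C * ((N : ℝ) ^ 2 * (D / τ ^ K)) := by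
          gcongr
          · exact (hτB σ hσ).2.1
          · exact hmoll σ τ hσ
          · exact (hD τ σ hτ hσ).1
      _ = D * ((N : ℝ) ^ 2 * τ ^ C / τ ^ K) := by ring
      _ ≤ D := mul_le_of_le_one_right hD0 hK2
  have hHb' : ‖Hb‖ ≤ 2 * (B * D) := by
    refine norm_horizontal_integral_le fun σ hσ => ?_
    simp only [hf, hφ]
    rw [norm_mul, norm_mul]
    calc _ ≤ B * ((N : ℝ) ^ 2 * (D / τ ^ K)) := by
          gcongr
          · exact (hbB σ hσ).2.1
          · exact hmoll σ b hσ
          · exact (hD τ σ hτ hσ).2.1 b ⟨hb.1.le, hb.2.le⟩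
      _ ≤ B * ((N : ℝ) ^ 2 * τ ^ C * (D / τ ^ K)) := by
          gcongr
          exact le_mul_of_one_le_right (by positivity) (one_le_pow₀ hτ)
      _ = B * D * ((N : ℝ) ^ 2 * τ ^ C / τ ^ K) := by ring
      _ ≤ B * D := mul_le_of_le_one_right (by positivity) hK2
  -- For Re s = -1/2 the point 1 - s has real part 3/2, so the mollifier is bounded uniformly in N
  -- and the left edge is only O(τ).
  have hLf' : ‖Lf‖ ≤ E * Z * D * τ := by
    refine (intervalIntegral.norm_integral_le_of_norm_le_const (C := E * (Z * D)) fun y hy => ?_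
      ).trans ?_
    · rw [uIoc_of_le hbτ] at hy
      simp only [hf, hφ]
      rw [norm_mul, norm_mul]
      gcongr
      · have := hE y
        push_cast
        exact this
      · exact (hZ N).2 _ (by simp; norm_num)
      · exact (hD τ (-(1 / 2)) hτ ⟨le_rfl, by norm_num⟩).2.2 y ⟨hb.1.le.trans hy.1.le, hy.2⟩
    · rw [abs_of_nonneg (sub_nonneg.mpr hbτ), ← mul_assoc]
      gcongr
      linarith [hb.1]
  -- The right edge is the mean value estimate with δ = 1, that is Re s = 3/2.
  have hR' : ‖R - squarefreeSum N * (τ * (∫ x in (0 : ℝ)..1, P.eval x : ℝ))‖ ≤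
      (2 * F + 2 * F * Y) * τ := by
    have h2 := hF τ b 1 N (fun n => (ArithmeticFunction.moebius n : ℂ)) hτ ⟨hb.1.le, hb.2.le⟩
      ⟨zero_le_one, le_rfl⟩ hN hNτ
      (ArithmeticFunction.LSeriesSummable_moebius_iff.mpr (by norm_num))
    have e1 : (∫ t in b..τ, LSeries (fun n => (ArithmeticFunction.moebius n : ℂ))
        (1 / 2 + (1 : ℝ) + t * I) * mollifier N (1 - (1 / 2 + (1 : ℝ) + t * I)) *
        weight P τ (1 / 2 + (1 : ℝ) + t * I)) = R := by
      refine intervalIntegral.integral_congr fun t _ => ?_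
      have e : (1 / 2 + (1 : ℝ) + t * I : ℂ) = (3 / 2 : ℝ) + t * I := by push_cast; ring
      simp only [hf, hφ]
      rw [e, inv_riemannZeta_eq_LSeries (by simp; norm_num), mul_assoc]
    have e2 : (∑ n ∈ Finset.Icc 1 N, (ArithmeticFunction.moebius n : ℂ) *
        ArithmeticFunction.moebius n / n) = (squarefreeSum N : ℂ) := by
      rw [squarefreeSum]
      push_cast
      exact Finset.sum_congr rfl fun n _ => by ring
    rw [e1, e2] at h2
    refine h2.trans ?_
    have h3 : ∑ n ∈ Finset.Icc 1 N, ‖(ArithmeticFunction.moebius n : ℂ)‖ / n ≤ 2 * τ := by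
      calc ∑ n ∈ Finset.Icc 1 N, ‖(ArithmeticFunction.moebius n : ℂ)‖ / n
          ≤ ∑ n ∈ Finset.Icc 1 N, (1 : ℝ) := by
            refine Finset.sum_le_sum fun n hn => ?_
            rw [Finset.mem_Icc] at hn
            have hn1 : (1 : ℝ) ≤ n := by exact_mod_cast hn.1
            exact (div_le_one (by linarith)).mpr ((norm_moebius_le_one n).trans hn1)
        _ = N := by simp
        _ ≤ 2 * τ := by linarith
    have h4 : (N : ℝ) ^ 2 * (2 * N * (2 * N / τ) ^ K) ≤ 2 * τ := by
      calc (N : ℝ) ^ 2 * (2 * N * (2 * N / τ) ^ K) = 2 * ((N : ℝ) ^ 3 * (2 * N / τ) ^ K) := by ring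
        _ ≤ 2 * τ := by linarith
    calc F * ∑ n ∈ Finset.Icc 1 N, ‖(ArithmeticFunction.moebius n : ℂ)‖ / n +
          F * Y * ((N : ℝ) ^ 2 * (2 * N * (2 * N / τ) ^ K)) ≤ F * (2 * τ) + F * Y * (2 * τ) := by
          gcongr
      _ = _ := by ring
  have hpi : (2 * Real.pi : ℂ) ≠ 0 := by simp [Real.pi_ne_zero]
  have hmain : S₀ - τ / (2 * Real.pi) * ((∫ x in (0 : ℝ)..1, P.eval x) * squarefreeSum N : ℝ) =
      (2 * Real.pi * I)⁻¹ * (Hb - Hτ + I * (R - squarefreeSum N *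
        (τ * (∫ x in (0 : ℝ)..1, P.eval x : ℝ))) - I * Lf) := by
    rw [eq_inv_mul_iff_mul_eq₀ (mul_ne_zero hpi I_ne_zero), mul_sub, ← hres]
    push_cast
    field_simp
    ring
  rw [hmain, norm_mul]
  have hinv : ‖(2 * Real.pi * I : ℂ)⁻¹‖ ≤ 1 := by
    rw [norm_inv, norm_mul, norm_I, mul_one, norm_mul, norm_ofNat, norm_real,
      Real.norm_of_nonneg Real.pi_pos.le]
    exact inv_le_one_of_one_le₀ (by linarith [Real.pi_gt_three])
  refine (mul_le_of_le_one_left (norm_nonneg _) hinv).trans ?_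
  have hI : ∀ z : ℂ, ‖I * z‖ = ‖z‖ := fun z => by rw [norm_mul, norm_I, one_mul]
  calc _ ≤ ‖Hb‖ + ‖Hτ‖ + ‖R - squarefreeSum N * (τ * (∫ x in (0 : ℝ)..1, P.eval x : ℝ))‖ + ‖Lf‖ := by
        refine (norm_sub_le _ _).trans ?_
        rw [hI]
        gcongr
        refine (norm_add_le _ _).trans ?_
        rw [hI]
        gcongr
        exact norm_sub_le _ _
    _ ≤ 2 * (B * D) + 2 * D + (2 * F + 2 * F * Y) * τ + E * Z * D * τ := by gcongr
    _ ≤ 2 * (B * D) * τ + 2 * D * τ + (2 * F + 2 * F * Y) * τ + E * Z * D * τ := by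
        have e1 : 2 * (B * D) ≤ 2 * (B * D) * τ := le_mul_of_one_le_right (by positivity) hτ
        have e2 : 2 * D ≤ 2 * D * τ := le_mul_of_one_le_right (by positivity) hτ
        linarith
    _ = _ := by ring

/-! ### The second moment -/

section Arithmetic

open ArithmeticFunction

/-- The identity `∑_{de = n} Λ(d) μ(e) = -μ(n) log n`. -/
theorem sum_vonMangoldt_mul_moebius (n : ℕ) :
    ∑ p ∈ n.divisorsAntidiagonal, vonMangoldt p.1 * (moebius p.2 : ℝ) =
      -(moebius n * Real.log n) := by
  have h : pmul (moebius : ArithmeticFunction ℝ) log * (zeta : ArithmeticFunction ℝ) +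
      vonMangoldt = 0 := by
    ext m
    rw [mul_comm, ArithmeticFunction.add_apply, coe_zeta_mul_apply]
    simp only [pmul_apply, intCoe_apply]
    rw [sum_moebius_mul_log_eq, neg_add_cancel, ArithmeticFunction.zero_apply]
  have h2 : pmul (moebius : ArithmeticFunction ℝ) log +
      vonMangoldt * (moebius : ArithmeticFunction ℝ) = 0 := by
    have h3 := congrArg (fun f => f * (moebius : ArithmeticFunction ℝ)) h
    simpa only [add_mul, mul_assoc, coe_zeta_mul_coe_moebius, mul_one, zero_mul] using h3
  have h3 := congrArg (fun f : ArithmeticFunction ℝ => f n) h2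
  simp only [ArithmeticFunction.add_apply, pmul_apply, intCoe_apply, log_apply, mul_apply,
    ArithmeticFunction.zero_apply] at h3
  linarith

/-- The Dirichlet coefficients of `-ζ'/ζ` times the mollifier. -/
noncomputable def logDerivMollifierCoeff (N : ℕ) : ℕ → ℂ :=
  LSeries.convolution (fun n => (vonMangoldt n : ℂ)) (mollifierCoeff N)

/-- Divisors of n ≤ N are themselves at most N, so the truncation is invisible and the convolution
is the full Λ * μ. -/
theorem logDerivMollifierCoeff_apply {N n : ℕ} (hn : n ∈ Finset.Icc 1 N) :
    logDerivMollifierCoeff N n = -(moebius n * Real.log n : ℝ) := by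
  rw [Finset.mem_Icc] at hn
  rw [← ofReal_neg, ← sum_vonMangoldt_mul_moebius, logDerivMollifierCoeff, LSeries.convolution_def,
    ofReal_sum]
  refine Finset.sum_congr rfl fun p hp => ?_
  have h2 := (Nat.ne_zero_of_mem_divisorsAntidiagonal hp).2
  have h3 : p.2 ≤ n := Nat.divisor_le (Nat.snd_mem_divisors_of_mem_antidiagonal hp)
  rw [mollifierCoeff, if_pos (Finset.mem_Icc.mpr ⟨by omega, by omega⟩)]
  push_cast
  rfl

theorem norm_mollifierCoeff_le (N n : ℕ) : ‖mollifierCoeff N n‖ ≤ 1 := by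
  rw [mollifierCoeff]
  split_ifs
  · exact norm_moebius_le_one n
  · simp

/-- Because ∑_{d | n} Λ(d) = log n. This majorant does not depend on N. -/
theorem norm_logDerivMollifierCoeff_le (N n : ℕ) :
    ‖logDerivMollifierCoeff N n‖ ≤ ‖LSeries.logMul 1 n‖ := by
  have h : ‖LSeries.logMul 1 n‖ = Real.log n := by
    rw [LSeries.logMul, Pi.one_apply, mul_one, natCast_log.symm, norm_real,
      Real.norm_of_nonneg (Real.log_natCast_nonneg n)]
  rw [h, logDerivMollifierCoeff, LSeries.convolution_def, ← vonMangoldt_sum,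
    ← Nat.sum_divisorsAntidiagonal fun d _ => vonMangoldt d]
  refine norm_sum_le_of_le _ fun p _ => ?_
  rw [norm_mul, norm_real, Real.norm_of_nonneg vonMangoldt_nonneg]
  exact mul_le_of_le_one_right vonMangoldt_nonneg (norm_mollifierCoeff_le N _)

theorem LSeries_logDerivMollifierCoeff (N : ℕ) {s : ℂ} (hs : 1 < s.re) :
    LSeries (logDerivMollifierCoeff N) s = -logDeriv riemannZeta s * mollifier N s := by
  rw [logDerivMollifierCoeff, LSeries_convolution' (LSeriesSummable_vonMangoldt hs)
    (hasSum_mollifierCoeff N s).LSeriesSummable, LSeries_vonMangoldt_eq_deriv_riemannZeta_div hs,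
    (hasSum_mollifierCoeff N s).LSeries_eq, logDeriv_apply, neg_div]

theorem LSeriesSummable_logDerivMollifierCoeff (N : ℕ) {s : ℂ} (hs : 1 < s.re) :
    LSeriesSummable (logDerivMollifierCoeff N) s :=
  (LSeriesSummable_vonMangoldt hs).convolution (hasSum_mollifierCoeff N s).LSeriesSummable

theorem exists_tsum_logDerivMollifierCoeff_le {s : ℂ} (hs : 1 < s.re) :
    ∃ Y : ℝ, 0 ≤ Y ∧ ∀ N, ∑' n, ‖LSeries.term (logDerivMollifierCoeff N) s n‖ ≤ Y := by
  have hsum : LSeriesSummable (LSeries.logMul 1) s :=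
    LSeriesSummable_logMul_of_lt_re (by rw [LSeries.abscissaOfAbsConv_one]; exact_mod_cast hs)
  exact ⟨∑' n, ‖LSeries.term (LSeries.logMul 1) s n‖, tsum_nonneg fun n => norm_nonneg _, fun N =>
    Summable.tsum_le_tsum (fun n => LSeries.norm_term_le _ (norm_logDerivMollifierCoeff_le N n))
      (LSeriesSummable_logDerivMollifierCoeff N hs).norm hsum.norm⟩

/-- Crude but enough: on the critical line the extra factor N is paid for by the condition N⁴
(2N/τ)^K ≤ 1. -/
theorem tsum_norm_mollifierCoeff_half_le (N : ℕ) :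
    ∑' n, ‖LSeries.term (mollifierCoeff N) (1 / 2) n‖ ≤ N := by
  rw [tsum_eq_sum (s := Finset.Icc 1 N) fun n hn => by
    rw [LSeries.term_def, mollifierCoeff, if_neg hn]; simp]
  calc _ ≤ ∑ n ∈ Finset.Icc 1 N, (1 : ℝ) := by
        refine Finset.sum_le_sum fun n hn => ?_
        rw [Finset.mem_Icc] at hn
        have hn1 : (1 : ℝ) ≤ n := by exact_mod_cast hn.1
        rw [LSeries.term_of_ne_zero (by omega), norm_div, norm_natCast_cpow_of_pos hn.1]
        refine div_le_one_of_le₀ ((norm_mollifierCoeff_le N n).trans ?_) (by positivity)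
        exact Real.one_le_rpow hn1 (by norm_num)
    _ = N := by simp

theorem sum_div_le_card {a : ℕ → ℝ} {N : ℕ} (h : ∀ n ∈ Finset.Icc 1 N, a n ≤ n) :
    ∑ n ∈ Finset.Icc 1 N, a n / n ≤ N := by
  calc ∑ n ∈ Finset.Icc 1 N, a n / n ≤ ∑ n ∈ Finset.Icc 1 N, (1 : ℝ) :=
        Finset.sum_le_sum fun n hn => div_le_one_of_le₀ (h n hn) (by positivity)
    _ = N := by simp

end Arithmetic

theorem logDeriv_riemannZeta_conj (s : ℂ) :
    logDeriv riemannZeta ((starRingEnd ℂ) s) = (starRingEnd ℂ) (logDeriv riemannZeta s) := by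
  have h : (starRingEnd ℂ ∘ riemannZeta ∘ starRingEnd ℂ) = riemannZeta := by
    ext z
    simp [riemannZeta_conj]
  have h2 := deriv_conj_conj (𝕜 := ℂ) (f := riemannZeta)
  have h3 := congrFun h2 ((starRingEnd ℂ) s)
  rw [h] at h3
  rw [logDeriv_apply, logDeriv_apply, h3, riemannZeta_conj, map_div₀]
  simp

theorem HeightBound.norm_logDeriv_le {B τ σ : ℝ} (h : HeightBound B τ) (hB : 0 ≤ B)
    (hσ : σ ∈ Icc (-(1 / 2) : ℝ) (3 / 2)) : ‖logDeriv riemannZeta (σ + τ * I)‖ ≤ B ^ 2 := by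
  obtain ⟨_, h2, h3⟩ := h σ hσ
  rw [logDeriv_apply, div_eq_mul_inv, norm_mul, sq]
  gcongr

/-- The factor is a sum of values of ζ'/ζ at s and 1 - s. The latter is conjugate to a point at the
same height τ, so one height bound controls both. -/
theorem HeightBound.norm_logDerivFunctionalFactor_le {B τ σ : ℝ} (h : HeightBound B τ)
    (hB : 0 ≤ B) (hτ : 0 < τ) (hσ : σ ∈ Icc (-(1 / 2) : ℝ) (3 / 2)) :
    ‖logDerivFunctionalFactor (σ + τ * I)‖ ≤ 2 * B ^ 2 := by
  have h1 := logDeriv_riemannZeta_one_sub (s := σ + τ * I) (by simpa using hτ) (h σ hσ).1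
  have e : (1 - (σ + τ * I) : ℂ) = (starRingEnd ℂ) ((1 - σ : ℝ) + τ * I) := by
    simp; ring
  rw [e, logDeriv_riemannZeta_conj] at h1
  rw [← sub_eq_iff_eq_add.mpr h1]
  refine (norm_sub_le _ _).trans ?_
  rw [norm_neg, RCLike.norm_conj]
  have h2 := h.norm_logDeriv_le hB hσ
  have h3 := h.norm_logDeriv_le hB (σ := 1 - σ) ⟨by linarith [hσ.2], by linarith [hσ.1]⟩
  linarith

theorem tendsto_sub_mul_logDeriv {f : ℂ → ℂ} {ρ : ℂ} (hf : AnalyticAt ℂ f ρ) (h0 : f ρ = 0)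
    (h1 : deriv f ρ ≠ 0) : Tendsto (fun z => (z - ρ) * logDeriv f z) (𝓝[≠] ρ) (𝓝 1) := by
  have h := (tendsto_sub_mul_inv hf.differentiableAt h0 h1).mul
    (hf.deriv.continuousAt.tendsto.mono_left nhdsWithin_le_nhds)
  rw [inv_mul_cancel₀ h1] at h
  refine h.congr fun z => ?_
  rw [logDeriv_apply]
  ring

/-- The weighted product `D(s) D(1 - s) W(s)`, equal to `W |D|²` on the critical line. -/
noncomputable def mollifierSqWeight (P : Polynomial ℝ) (τ : ℝ) (N : ℕ) (s : ℂ) : ℂ :=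
  mollifier N s * mollifier N (1 - s) * weight P τ s

theorem differentiable_mollifierSqWeight (P : Polynomial ℝ) (τ : ℝ) (N : ℕ) :
    Differentiable ℂ (mollifierSqWeight P τ N) :=
  ((differentiable_mollifier N).mul ((differentiable_mollifier N).comp
    (differentiable_const _ |>.sub differentiable_id))).mul (differentiable_weight P τ)

/-- This reflection across the critical line identifies the left edge with the conjugate of the
right edge. -/
theorem mollifierSqWeight_conj (P : Polynomial ℝ) (τ : ℝ) (N : ℕ) (s : ℂ) :
    (starRingEnd ℂ) (mollifierSqWeight P τ N s) =
      mollifierSqWeight P τ N (1 - (starRingEnd ℂ) s) := by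
  rw [mollifierSqWeight, mollifierSqWeight, map_mul, map_mul, mollifier_conj, mollifier_conj,
    weight_conj, map_sub, map_one, sub_sub_cancel]
  ring

theorem mollifier_one_sub_half (N : ℕ) (t : ℝ) :
    mollifier N (1 - (1 / 2 + t * I)) = (starRingEnd ℂ) (mollifier N (1 / 2 + t * I)) := by
  rw [mollifier_conj]
  congr 1
  simp only [map_add, map_mul, map_div₀, map_one, conj_ofNat, conj_ofReal, conj_I]
  ring

theorem mollifierSqWeight_half (P : Polynomial ℝ) (τ : ℝ) (N : ℕ) (t : ℝ) :
    mollifierSqWeight P τ N (1 / 2 + t * I) =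
      (P.eval (t / τ) * ‖mollifier N (1 / 2 + t * I)‖ ^ 2 : ℝ) := by
  rw [mollifierSqWeight, mollifier_one_sub_half, weight_half, mul_conj, normSq_eq_norm_sq]
  push_cast
  ring

theorem norm_mollifierSqWeight_le {P : Polynomial ℝ} {τ E σ e : ℝ} (N : ℕ)
    (hσ : σ ∈ Icc (-(1 / 2) : ℝ) (3 / 2)) (h : ‖weight P τ (σ + e * I)‖ ≤ E) :
    ‖mollifierSqWeight P τ N (σ + e * I)‖ ≤ (N : ℝ) ^ 4 * E := by
  have h1 : ‖mollifier N (σ + e * I)‖ ≤ (N : ℝ) ^ 2 :=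
    norm_mollifier_le N (by simp; linarith [hσ.1])
  have h2 : ‖mollifier N (1 - (σ + e * I))‖ ≤ (N : ℝ) ^ 2 :=
    norm_mollifier_le N (by simp; linarith [hσ.2])
  rw [mollifierSqWeight, norm_mul, norm_mul]
  calc _ ≤ (N : ℝ) ^ 2 * (N : ℝ) ^ 2 * E := by gcongr
    _ = _ := by ring

section

variable {P : Polynomial ℝ} {K : ℕ} {b : ℝ}

theorem exists_norm_rightEdge_sub_le (h0 : Polynomial.X ^ K ∣ P)
    (h1 : (Polynomial.X - 1) ^ K ∣ P) (hb : b ∈ Ioo (0 : ℝ) 1) :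
    ∃ A : ℝ, 0 ≤ A ∧ ∀ (τ : ℝ) (N : ℕ), 1 ≤ τ → 1 ≤ N → 2 * N ≤ τ →
      (N : ℝ) ^ 4 * (2 * N / τ) ^ K ≤ 1 →
      ‖(∫ y in b..τ, logDeriv riemannZeta ((3 / 2 : ℝ) + y * I) *
          mollifierSqWeight P τ N ((3 / 2 : ℝ) + y * I)) -
        squarefreeLogSum N * (τ * (∫ x in (0 : ℝ)..1, P.eval x : ℝ))‖ ≤ A * τ := by
  obtain ⟨F, hF0, hF⟩ := exists_norm_integral_LSeries_mul_mollifier_sub_le h0 h1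
  obtain ⟨Y, hY0, hY⟩ := exists_tsum_logDerivMollifierCoeff_le (s := 1 / 2 + (1 : ℝ)) (by norm_num)
  refine ⟨F + 2 * F * Y, by positivity, fun τ N hτ hN hNτ hNK => ?_⟩
  have hN1 : (1 : ℝ) ≤ N := by exact_mod_cast hN
  have h := hF τ b 1 N (logDerivMollifierCoeff N) hτ ⟨hb.1.le, hb.2.le⟩ ⟨zero_le_one, le_rfl⟩ hN
    hNτ (LSeriesSummable_logDerivMollifierCoeff N (by norm_num))
  have e1 : (∫ t in b..τ, LSeries (logDerivMollifierCoeff N)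
      (1 / 2 + (1 : ℝ) + t * I) * mollifier N (1 - (1 / 2 + (1 : ℝ) + t * I)) *
      weight P τ (1 / 2 + (1 : ℝ) + t * I)) = -∫ y in b..τ,
        logDeriv riemannZeta ((3 / 2 : ℝ) + y * I) *
          mollifierSqWeight P τ N ((3 / 2 : ℝ) + y * I) := by
    rw [← intervalIntegral.integral_neg]
    refine intervalIntegral.integral_congr fun t _ => ?_
    have e : (1 / 2 + (1 : ℝ) + t * I : ℂ) = (3 / 2 : ℝ) + t * I := by push_cast; ring
    simp only [mollifierSqWeight]
    rw [e, LSeries_logDerivMollifierCoeff N (by simp; norm_num)]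
    ring
  have e2 : (∑ n ∈ Finset.Icc 1 N, logDerivMollifierCoeff N n *
      ArithmeticFunction.moebius n / n) = -(squarefreeLogSum N : ℂ) := by
    rw [squarefreeLogSum, ofReal_sum, ← Finset.sum_neg_distrib]
    refine Finset.sum_congr rfl fun n hn => ?_
    rw [logDerivMollifierCoeff_apply hn]
    push_cast
    ring
  rw [e1, e2, ← norm_neg] at h
  have h3 : ∑ n ∈ Finset.Icc 1 N, ‖logDerivMollifierCoeff N n‖ / n ≤ N := by
    refine sum_div_le_card fun n hn => ?_
    rw [logDerivMollifierCoeff_apply hn, norm_neg, norm_real, norm_mul,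
      Real.norm_of_nonneg (Real.log_natCast_nonneg n)]
    have hμ := norm_moebius_le_one n
    rw [norm_intCast] at hμ
    calc ‖(ArithmeticFunction.moebius n : ℝ)‖ * Real.log n ≤ 1 * n := by
          gcongr
          · exact hμ
          · exact Real.log_le_self (by positivity)
      _ = n := one_mul _
  have h4 : (N : ℝ) ^ 2 * (2 * N * (2 * N / τ) ^ K) ≤ 2 * τ := by
    have h5 : (N : ℝ) ^ 3 * (2 * N / τ) ^ K ≤ (N : ℝ) ^ 4 * (2 * N / τ) ^ K := by
      gcongr
      norm_num
    calc (N : ℝ) ^ 2 * (2 * N * (2 * N / τ) ^ K) = 2 * ((N : ℝ) ^ 3 * (2 * N / τ) ^ K) := by ring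
      _ ≤ 2 * τ := by linarith
  calc _ = _ := by congr 1; ring
    _ ≤ _ := h
    _ ≤ F * τ + F * Y * (2 * τ) := by
        gcongr
        · linarith
        · exact hY N
    _ = _ := by ring

/-- The mean value estimate with δ = 0, where the Dirichlet series is the mollifier itself and
M(1-s) is the conjugate of M(s). -/
theorem exists_integral_half_le (h0 : Polynomial.X ^ K ∣ P)
    (h1 : (Polynomial.X - 1) ^ K ∣ P) (hb : b ∈ Ioo (0 : ℝ) 1) :
    ∃ A : ℝ, 0 ≤ A ∧ ∀ (τ : ℝ) (N : ℕ), 1 ≤ τ → 1 ≤ N → 2 * N ≤ τ →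
      (N : ℝ) ^ 4 * (2 * N / τ) ^ K ≤ 1 →
      ∫ t in b..τ, P.eval (t / τ) * ‖mollifier N (1 / 2 + t * I)‖ ^ 2 ≤
        squarefreeSum N * (τ * ∫ x in (0 : ℝ)..1, P.eval x) + A * τ := by
  obtain ⟨F, hF0, hF⟩ := exists_norm_integral_LSeries_mul_mollifier_sub_le h0 h1
  refine ⟨F + 2 * F, by positivity, fun τ N hτ hN hNτ hNK => ?_⟩
  have h := hF τ b 0 N (mollifierCoeff N) hτ ⟨hb.1.le, hb.2.le⟩ ⟨le_rfl, zero_le_one⟩ hN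
    hNτ (hasSum_mollifierCoeff N _).LSeriesSummable
  simp only [ofReal_zero, add_zero] at h
  have e1 : (∫ t in b..τ, LSeries (mollifierCoeff N)
      (1 / 2 + t * I) * mollifier N (1 - (1 / 2 + t * I)) * weight P τ (1 / 2 + t * I)) =
      ((∫ t in b..τ, P.eval (t / τ) * ‖mollifier N (1 / 2 + t * I)‖ ^ 2 : ℝ) : ℂ) := by
    rw [← intervalIntegral.integral_ofReal]
    refine intervalIntegral.integral_congr fun t _ => ?_
    rw [← mollifierSqWeight_half, mollifierSqWeight, (hasSum_mollifierCoeff N _).LSeries_eq]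
  have e2 : (∑ n ∈ Finset.Icc 1 N, mollifierCoeff N n *
      ArithmeticFunction.moebius n / n) = (squarefreeSum N : ℂ) := by
    rw [squarefreeSum, ofReal_sum]
    refine Finset.sum_congr rfl fun n hn => ?_
    rw [mollifierCoeff, if_pos hn]
    push_cast
    ring
  rw [e1, e2] at h
  have h3 : ∑ n ∈ Finset.Icc 1 N, ‖mollifierCoeff N n‖ / n ≤ N := by
    refine sum_div_le_card fun n hn => (norm_mollifierCoeff_le N n).trans ?_
    exact_mod_cast (Finset.mem_Icc.mp hn).1
  have h4 : (∑' m, ‖LSeries.term (mollifierCoeff N) (1 / 2) m‖) *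
      ((N : ℝ) ^ 2 * (2 * N * (2 * N / τ) ^ K)) ≤ 2 * τ := by
    calc _ ≤ (N : ℝ) * ((N : ℝ) ^ 2 * (2 * N * (2 * N / τ) ^ K)) := by
          gcongr
          exact tsum_norm_mollifierCoeff_half_le N
      _ = 2 * ((N : ℝ) ^ 4 * (2 * N / τ) ^ K) := by ring
      _ ≤ 2 * τ := by linarith
  have h6 : F * ∑ n ∈ Finset.Icc 1 N, ‖mollifierCoeff N n‖ / n ≤ F * τ := by
    gcongr
    linarith
  have h5 := h.trans (add_le_add h6 ((mul_assoc F _ _).trans_le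
    (mul_le_mul_of_nonneg_left h4 hF0)))
  rw [← ofReal_mul, ← ofReal_mul, ← ofReal_sub, norm_real] at h5
  linarith [(le_abs_self _).trans h5]

/-- The second mollified moment `∑ W(ρ) |M(ρ)|²`. -/
theorem exists_secondMoment_le (hRH : RiemannHypothesis)
    (hsimple : ∀ s : ℂ, riemannZeta s = 0 → deriv riemannZeta s ≠ 0) {C : ℕ} {B : ℝ}
    (h0 : Polynomial.X ^ K ∣ P) (h1 : (Polynomial.X - 1) ^ K ∣ P)
    (hP : ∀ x ∈ Icc (0 : ℝ) 1, 0 ≤ P.eval x) (hK : 2 * C + 4 ≤ K)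
    (hb : b ∈ Ioo (0 : ℝ) 1) (hB : 0 ≤ B) (hbB : HeightBound B b) :
    ∃ A : ℝ, 0 ≤ A ∧ ∀ (τ : ℝ) (N : ℕ), 1 ≤ τ → HeightBound (τ ^ C) τ → 1 ≤ N → 2 * N ≤ τ →
      (N : ℝ) ^ 4 * (2 * N / τ) ^ K ≤ 1 →
      ∑ ρ ∈ zetaZerosBetween b τ, P.eval (ρ.im / τ) * ‖mollifier N ρ‖ ^ 2 ≤
        τ / (2 * Real.pi) * ((∫ x in (0 : ℝ)..1, P.eval x) *
          (squarefreeSum N * (Real.log (τ + 1) + 4) + 2 * squarefreeLogSum N)) +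
        A * (τ * (Real.log (τ + 1) + 4)) := by
  obtain ⟨D, hD0, hD⟩ := exists_norm_weight_le h0 h1
  obtain ⟨A₁, hA₁0, hA₁⟩ := exists_norm_rightEdge_sub_le h0 h1 hb
  obtain ⟨A₂, hA₂0, hA₂⟩ := exists_integral_half_le h0 h1 hb
  refine ⟨2 * A₁ + A₂ + (4 * D + 6 * (B ^ 2 * D)), by positivity,
    fun τ N hτ hτB hN hNτ hNK => ?_⟩
  have hτ0 : 0 < τ := by linarith
  have hbτ : b ≤ τ := hb.2.le.trans hτ
  have hN1 : (1 : ℝ) ≤ N := by exact_mod_cast hN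
  have hNτ' : (N : ℝ) ≤ τ := by linarith
  have hlog : 0 ≤ Real.log (τ + 1) := Real.log_nonneg (by linarith)
  set φ : ℂ → ℂ := mollifierSqWeight P τ N with hφ
  have hφd : Differentiable ℂ φ := differentiable_mollifierSqWeight P τ N
  have han : ∀ z : ℂ, z ≠ 1 → AnalyticAt ℂ riemannZeta z := fun z hz =>
    DifferentiableOn.analyticAt (s := {1}ᶜ)
      (fun s hs => (differentiableAt_riemannZeta hs).differentiableWithinAt)
      (isOpen_compl_singleton.mem_nhds hz)
  have hlogd : ∀ z : ℂ, 0 < z.im → riemannZeta z ≠ 0 →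
      DifferentiableAt ℂ (logDeriv riemannZeta) z := fun z hz hz0 => by
    have h := han z (by simpa using ne_of_im_pos hz 1)
    exact h.deriv.differentiableAt.div h.differentiableAt hz0
  have hres := rectIntegral_zetaZeros hRH hb.1 hbτ hbB hτB (g := logDeriv riemannZeta)
    (φ := φ) (r := fun _ => 1) hφd hlogd
    (fun ρ hρ h => tendsto_sub_mul_logDeriv (han ρ (by simpa using ne_of_im_pos hρ 1)) h
      (hsimple ρ h))
  -- The logarithmic derivative of the functional factor is holomorphic in the upper half-plane, so
  -- its integral can be moved from Re s = -1/2 to the critical line, where the weighted square is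
  -- real and nonnegative.
  have hGd : ∀ z ∈ Icc (-(1 / 2) : ℝ) (1 / 2) ×ℂ Icc b τ,
      DifferentiableAt ℂ (fun s => logDerivFunctionalFactor s * φ s) z := fun z hz =>
    (differentiableAt_logDerivFunctionalFactor (hb.1.trans_le hz.2.1)).mul (hφd z)
  have hrect := rectIntegral_eq_zero (by norm_num) hbτ hGd
  rw [rectIntegral] at hres hrect
  set f : ℂ → ℂ := fun s => logDeriv riemannZeta s * φ s with hf
  set g : ℂ → ℂ := fun s => logDerivFunctionalFactor s * φ s with hg
  set Hb := ∫ x : ℝ in (-(1 / 2))..(3 / 2), f (x + b * I) with hHb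
  set Hτ := ∫ x : ℝ in (-(1 / 2))..(3 / 2), f (x + τ * I) with hHτ
  set R := ∫ y : ℝ in b..τ, f ((3 / 2 : ℝ) + y * I) with hR
  set Lf := ∫ y : ℝ in b..τ, f ((-(1 / 2) : ℝ) + y * I) with hLf
  set Gb := ∫ x : ℝ in (-(1 / 2))..(1 / 2), g (x + b * I) with hGb
  set Gτ := ∫ x : ℝ in (-(1 / 2))..(1 / 2), g (x + τ * I) with hGτ
  set Gh := ∫ y : ℝ in b..τ, g ((1 / 2 : ℝ) + y * I) with hGh
  set Gl := ∫ y : ℝ in b..τ, g ((-(1 / 2) : ℝ) + y * I) with hGl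
  have hline : ∀ σ : ℝ, σ ∈ Icc (-(1 / 2) : ℝ) (1 / 2) →
      ContinuousOn (fun y : ℝ => g (σ + y * I)) (uIcc b τ) := fun σ hσ y hy => by
    rw [uIcc_of_le hbτ] at hy
    exact ((hGd (σ + y * I) (horizontal_mem hσ hy)).continuousAt.comp
      (f := fun y : ℝ => (σ + y * I : ℂ)) (by fun_prop)).continuousWithinAt
  -- With s = 1 - w̄ and Re w = 3/2, the functional equation writes ζ'/ζ at s as minus the conjugate
  -- of its value at w, minus the factor's logarithmic derivative.
  have hleft : Lf = -(starRingEnd ℂ) R - Gl := by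
    have hcont : ContinuousOn (fun y : ℝ => (starRingEnd ℂ) (f ((3 / 2 : ℝ) + y * I)))
        (uIcc b τ) := fun y hy => by
      rw [uIcc_of_le hbτ] at hy
      have hne : riemannZeta ((3 / 2 : ℝ) + y * I) ≠ 0 :=
        riemannZeta_ne_zero_of_one_lt_re (by simp; norm_num)
      have hd : DifferentiableAt ℂ f ((3 / 2 : ℝ) + y * I) :=
        (hlogd _ (by simpa using hb.1.trans_le hy.1) hne).mul (hφd _)
      exact (continuous_conj.continuousAt.comp (hd.continuousAt.comp
        (f := fun y : ℝ => (((3 / 2 : ℝ) : ℂ) + y * I)) (by fun_prop))).continuousWithinAt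
    rw [hR, ← intervalIntegral.intervalIntegral_conj, hGl, ← intervalIntegral.integral_neg,
      ← intervalIntegral.integral_sub hcont.fun_neg.intervalIntegrable
        (hline (-(1 / 2)) ⟨le_rfl, by norm_num⟩).intervalIntegrable]
    refine intervalIntegral.integral_congr fun y hy => ?_
    rw [uIcc_of_le hbτ] at hy
    have hy0 : 0 < y := hb.1.trans_le hy.1
    set s : ℂ := (-(1 / 2) : ℝ) + y * I with hs
    set w : ℂ := (3 / 2 : ℝ) + y * I with hw
    have e1 : s = 1 - (starRingEnd ℂ) w := by
      rw [hs, hw]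
      simp only [map_add, map_mul, conj_ofReal, conj_I]
      push_cast
      ring
    have hs0 : riemannZeta s ≠ 0 := fun h => by
      have := re_eq_half_of_riemannZeta_eq_zero hRH (by simpa [hs] using hy0) h
      simp [hs] at this
      norm_num at this
    have h2 := logDeriv_riemannZeta_one_sub (s := s) (by simpa [hs] using hy0) hs0
    have e2 : 1 - s = (starRingEnd ℂ) w := by rw [e1, sub_sub_cancel]
    rw [e2, logDeriv_riemannZeta_conj] at h2
    have e3 : φ s = (starRingEnd ℂ) (φ w) := by rw [e1, hφ, mollifierSqWeight_conj]
    simp only [hf, hg, map_mul]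
    rw [← e3, ← sub_eq_iff_eq_add'.mpr h2]
    ring
  have hK2 : (N : ℝ) ^ 4 * (τ ^ C) ^ 2 / τ ^ K ≤ 1 := by
    rw [div_le_one (by positivity)]
    calc (N : ℝ) ^ 4 * (τ ^ C) ^ 2 ≤ τ ^ 4 * (τ ^ C) ^ 2 := by gcongr
      _ = τ ^ (2 * C + 4) := by ring
      _ ≤ τ ^ K := pow_le_pow_right₀ hτ hK
  have hedge : ∀ {h : ℂ → ℂ} {σ e E : ℝ}, σ ∈ Icc (-(1 / 2) : ℝ) (3 / 2) → 0 ≤ E →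
      ‖weight P τ (σ + e * I)‖ ≤ D / τ ^ K → ‖h (σ + e * I)‖ ≤ E * (τ ^ C) ^ 2 →
      ‖h (σ + e * I) * φ (σ + e * I)‖ ≤ E * D := by
    intro h σ e E hσ hE hW hh
    rw [norm_mul]
    calc _ ≤ E * (τ ^ C) ^ 2 * ((N : ℝ) ^ 4 * (D / τ ^ K)) := by
          gcongr
          exact norm_mollifierSqWeight_le N hσ hW
      _ = E * D * ((N : ℝ) ^ 4 * (τ ^ C) ^ 2 / τ ^ K) := by ring
      _ ≤ E * D := mul_le_of_le_one_right (by positivity) hK2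
  have hτC : 0 ≤ τ ^ C := by positivity
  have hle : ∀ E : ℝ, 0 ≤ E → E ≤ E * (τ ^ C) ^ 2 := fun E hE =>
    le_mul_of_one_le_right hE (one_le_pow₀ (one_le_pow₀ hτ))
  have hHτ' : ‖Hτ‖ ≤ 2 * (1 * D) := norm_horizontal_integral_le fun σ hσ =>
    hedge hσ zero_le_one (hD τ σ hτ hσ).1 (by
      rw [one_mul]; exact hτB.norm_logDeriv_le hτC hσ)
  have hHb' : ‖Hb‖ ≤ 2 * (B ^ 2 * D) := norm_horizontal_integral_le fun σ hσ =>
    hedge hσ (by positivity) ((hD τ σ hτ hσ).2.1 b ⟨hb.1.le, hb.2.le⟩)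
      ((hbB.norm_logDeriv_le hB hσ).trans (hle _ (by positivity)))
  have hhalf : ∀ {e M : ℝ}, (∀ σ ∈ Icc (-(1 / 2) : ℝ) (3 / 2), ‖g (σ + e * I)‖ ≤ M) →
      ‖∫ x : ℝ in (-(1 / 2))..(1 / 2), g (x + e * I)‖ ≤ M := fun {e M} h => by
    have := intervalIntegral.norm_integral_le_of_norm_le_const (a := -(1 / 2 : ℝ)) (b := 1 / 2)
      (f := fun x : ℝ => g (x + e * I)) (C := M) fun x hx => by
        rw [uIoc_of_le (by norm_num)] at hx
        exact h x ⟨hx.1.le, hx.2.trans (by norm_num)⟩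
    refine this.trans (le_of_eq ?_)
    norm_num
  have hGτ' : ‖Gτ‖ ≤ 2 * D := hhalf fun σ hσ =>
    hedge hσ zero_le_two (hD τ σ hτ hσ).1 (hτB.norm_logDerivFunctionalFactor_le hτC hτ0 hσ)
  have hGb' : ‖Gb‖ ≤ 2 * B ^ 2 * D := hhalf fun σ hσ =>
    hedge hσ (by positivity) ((hD τ σ hτ hσ).2.1 b ⟨hb.1.le, hb.2.le⟩)
      ((hbB.norm_logDerivFunctionalFactor_le hB hb.1 hσ).trans (hle _ (by positivity)))
  have hGh' : Gh.re ≤ (Real.log (τ + 1) + 4) *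
      (squarefreeSum N * (τ * ∫ x in (0 : ℝ)..1, P.eval x) + A₂ * τ) := by
    refine le_trans ?_ (mul_le_mul_of_nonneg_left (hA₂ τ N hτ hN hNτ hNK) (by linarith))
    have hc := hline (1 / 2) ⟨by norm_num, le_rfl⟩
    have e := reCLM.intervalIntegral_comp_comm (hc.intervalIntegrable (μ := volume))
    rw [reCLM_apply] at e
    rw [hGh, ← e, ← intervalIntegral.integral_const_mul]
    have hmc : Continuous fun t : ℝ => mollifier N (1 / 2 + t * I) :=
      (differentiable_mollifier N).continuous.comp (by fun_prop)
    have hpc : Continuous fun t : ℝ => P.eval (t / τ) := P.continuous.comp (by fun_prop)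
    refine intervalIntegral.integral_mono_on hbτ
      (reCLM.continuous.comp_continuousOn hc).intervalIntegrable
      ((continuous_const.mul (hpc.mul (hmc.norm.pow 2))).intervalIntegrable _ _) fun t ht => ?_
    have ht0 : 0 < t := hb.1.trans_le ht.1
    have e2 : (((1 / 2 : ℝ) : ℂ) + t * I) = 1 / 2 + t * I := by push_cast; ring
    simp only [reCLM_apply, hg]
    rw [e2, hφ, mollifierSqWeight_half, re_mul_ofReal]
    have hnn : 0 ≤ P.eval (t / τ) * ‖mollifier N (1 / 2 + t * I)‖ ^ 2 :=
      mul_nonneg (hP _ ⟨by positivity, (div_le_one hτ0).mpr ht.2⟩) (by positivity)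
    refine mul_le_mul_of_nonneg_right ?_ hnn
    refine (re_logDerivFunctionalFactor_le ht0).trans ?_
    gcongr
    exact ht.2
  have hR' := hA₁ τ N hτ hN hNτ hNK
  rw [← ofReal_mul, ← ofReal_mul] at hR'
  have hRre : R.re ≤ squarefreeLogSum N * (τ * ∫ x in (0 : ℝ)..1, P.eval x) + A₁ * τ := by
    have h2 := (le_abs_self _).trans ((abs_re_le_norm _).trans hR')
    rw [sub_re, ofReal_re] at h2
    linarith
  have hsum : ∑ ρ ∈ zetaZerosBetween b τ, (1 : ℂ) * φ ρ =
      ((∑ ρ ∈ zetaZerosBetween b τ, P.eval (ρ.im / τ) * ‖mollifier N ρ‖ ^ 2 : ℝ) : ℂ) := by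
    rw [ofReal_sum]
    refine Finset.sum_congr rfl fun ρ hρ => ?_
    have hre := (zetaZerosBetween_spec hRH hτB hρ).2.1
    have e : ρ = 1 / 2 + ρ.im * I := Complex.ext (by simp [hre]) (by simp)
    rw [one_mul, hφ]
    conv_lhs => rw [e, mollifierSqWeight_half, ← e]
  rw [hsum, hleft] at hres
  set S₀ := ∑ ρ ∈ zetaZerosBetween b τ, P.eval (ρ.im / τ) * ‖mollifier N ρ‖ ^ 2
  -- The two vertical edges give 2 Re R, which produces 2L; the integral on the critical line
  -- produces S · log τ; horizontal pieces remain as the error.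
  have hmain : (2 * Real.pi * S₀ : ℂ) =
      R + (starRingEnd ℂ) R + Gh + -I * (Hb - Hτ + Gb - Gτ) := by
    have e : I * (2 * Real.pi * S₀ : ℂ) = I *
        (R + (starRingEnd ℂ) R + Gh + -I * (Hb - Hτ + Gb - Gτ)) := by
      linear_combination -hres - hrect + (Hb - Hτ + Gb - Gτ) * I_mul_I
    exact mul_left_cancel₀ I_ne_zero e
  have hnorm : (-I * (Hb - Hτ + Gb - Gτ)).re ≤ 4 * D + 4 * (B ^ 2 * D) := by
    refine (re_le_norm _).trans ?_
    rw [norm_mul, norm_neg, norm_I, one_mul]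
    have n1 := norm_sub_le (Hb - Hτ + Gb) Gτ
    have n2 := norm_add_le (Hb - Hτ) Gb
    have n3 := norm_sub_le Hb Hτ
    linarith
  have hfin : 2 * Real.pi * S₀ = 2 * R.re + Gh.re + (-I * (Hb - Hτ + Gb - Gτ)).re := by
    have := congrArg re hmain
    rw [add_re, add_re, add_re, conj_re] at this
    rw [two_mul R.re, ← this]
    norm_cast
  have hpi : 0 < 2 * Real.pi := by positivity
  have hpi1 : 1 ≤ 2 * Real.pi := by linarith [Real.pi_gt_three]
  set J := ∫ x in (0 : ℝ)..1, P.eval x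
  set l := Real.log (τ + 1) + 4
  have hl1 : 1 ≤ l := by linarith
  have hτl : τ ≤ τ * l := le_mul_of_one_le_right hτ0.le hl1
  have hτl1 : 1 ≤ τ * l := hτ.trans hτl
  have hup : 2 * Real.pi * S₀ ≤ τ * (J * (squarefreeSum N * l + 2 * squarefreeLogSum N)) +
      (2 * A₁ + A₂ + (4 * D + 6 * (B ^ 2 * D))) * (τ * l) := by
    have m1 : 2 * A₁ * τ ≤ 2 * A₁ * (τ * l) := by gcongr
    have m2 : 4 * D + 6 * (B ^ 2 * D) ≤ (4 * D + 6 * (B ^ 2 * D)) * (τ * l) :=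
      le_mul_of_one_le_right (by positivity) hτl1
    have m3 : 0 ≤ B ^ 2 * D := by positivity
    nlinarith [hfin, hRre, hGh', hnorm]
  have hA0 : 0 ≤ (2 * A₁ + A₂ + (4 * D + 6 * (B ^ 2 * D))) * (τ * l) := by positivity
  calc S₀ = 2 * Real.pi * S₀ / (2 * Real.pi) := by field_simp
    _ ≤ (τ * (J * (squarefreeSum N * l + 2 * squarefreeLogSum N)) +
      (2 * A₁ + A₂ + (4 * D + 6 * (B ^ 2 * D))) * (τ * l)) / (2 * Real.pi) := by gcongr
    _ = τ / (2 * Real.pi) * (J * (squarefreeSum N * l + 2 * squarefreeLogSum N)) +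
      (2 * A₁ + A₂ + (4 * D + 6 * (B ^ 2 * D))) * (τ * l) / (2 * Real.pi) := by ring
    _ ≤ _ := by
      gcongr
      exact div_le_self hA0 hpi1

end

/-! ### Cauchy–Schwarz, choice of parameters and conclusion -/

theorem reciprocalZetaDerivMoment_nonneg (T : ℝ) : 0 ≤ reciprocalZetaDerivMoment T :=
  Finset.sum_nonneg fun _ _ => by positivity

theorem reciprocalZetaDerivMoment_mono : Monotone reciprocalZetaDerivMoment := fun S T hST => by
  refine Finset.sum_le_sum_of_subset_of_nonneg (fun ρ hρ => ?_) fun _ _ _ => by positivity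
  rw [Finite.mem_toFinset] at hρ ⊢
  exact ⟨hρ.1, hρ.2.1, hρ.2.2.1, hρ.2.2.2.1, hρ.2.2.2.2.trans hST⟩

/-- The Cauchy–Schwarz inequality between the two mollified moments. -/
theorem norm_firstMoment_sq_le (hRH : RiemannHypothesis) {b τ B : ℝ} (hτB : HeightBound B τ)
    (P : Polynomial ℝ) (N : ℕ) :
    ‖∑ ρ ∈ zetaZerosBetween b τ,
        (deriv riemannZeta ρ)⁻¹ * (mollifier N (1 - ρ) * weight P τ ρ)‖ ^ 2 ≤
      reciprocalZetaDerivMoment τ *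
        ∑ ρ ∈ zetaZerosBetween b τ, (P ^ 2).eval (ρ.im / τ) * ‖mollifier N ρ‖ ^ 2 := by
  have h1 : ‖∑ ρ ∈ zetaZerosBetween b τ,
      (deriv riemannZeta ρ)⁻¹ * (mollifier N (1 - ρ) * weight P τ ρ)‖ ≤
      ∑ ρ ∈ zetaZerosBetween b τ, ‖(deriv riemannZeta ρ)⁻¹‖ *
        ‖mollifier N (1 - ρ) * weight P τ ρ‖ := by
    refine (norm_sum_le _ _).trans (le_of_eq ?_)
    exact Finset.sum_congr rfl fun ρ _ => norm_mul _ _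
  have h2 := Finset.sum_mul_sq_le_sq_mul_sq (zetaZerosBetween b τ)
    (fun ρ => ‖(deriv riemannZeta ρ)⁻¹‖) (fun ρ => ‖mollifier N (1 - ρ) * weight P τ ρ‖)
  refine (pow_le_pow_left₀ (norm_nonneg _) h1 2).trans (h2.trans ?_)
  have h3 : ∑ ρ ∈ zetaZerosBetween b τ, ‖(deriv riemannZeta ρ)⁻¹‖ ^ 2 ≤
      reciprocalZetaDerivMoment τ := by
    rw [reciprocalZetaDerivMoment]
    simp only [norm_inv, inv_pow, one_div]
    exact Finset.sum_le_sum_of_subset_of_nonneg (Finset.filter_subset _ _)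
      fun _ _ _ => by positivity
  have h4 : ∑ ρ ∈ zetaZerosBetween b τ, ‖mollifier N (1 - ρ) * weight P τ ρ‖ ^ 2 =
      ∑ ρ ∈ zetaZerosBetween b τ, (P ^ 2).eval (ρ.im / τ) * ‖mollifier N ρ‖ ^ 2 := by
    refine Finset.sum_congr rfl fun ρ hρ => ?_
    have hre := (zetaZerosBetween_spec hRH hτB hρ).2.1
    have e : ρ = 1 / 2 + ρ.im * I := Complex.ext (by simp [hre]) (by simp)
    conv_lhs => rw [e, mollifier_one_sub_half, weight_half, ← e]
    rw [norm_mul, RCLike.norm_conj, norm_real, mul_pow, Real.norm_eq_abs, sq_abs,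
      Polynomial.eval_pow]
    ring
  rw [h4]
  gcongr
  rw [← h4]
  exact Finset.sum_nonneg fun _ _ => by positivity

theorem half_le_natFloor {x : ℝ} (hx : 1 ≤ x) : x / 2 ≤ ⌊x⌋₊ := by
  have h1 := Nat.lt_floor_add_one x
  have h2 : (1 : ℝ) ≤ ⌊x⌋₊ := by exact_mod_cast (Nat.one_le_floor_iff x).mpr hx
  linarith

/-- The length of the mollifier can be a power of `τ` with exponent as close to `1` as desired. -/
theorem exists_mollifier_length {θ : ℝ} (hθ : 0 < θ) :
    ∃ K₀ : ℕ, ∀ K ≥ K₀, ∀ X₀ : ℝ, ∀ᶠ τ : ℝ in atTop, ∃ N : ℕ, 1 ≤ N ∧ 2 * N ≤ τ ∧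
      (N : ℝ) ^ 4 * (2 * N / τ) ^ K ≤ 1 ∧ X₀ ≤ Real.log N ∧
      Real.log (τ + 1) + 4 ≤ (1 + θ) * Real.log N := by
  -- Any ϑ < 1 with (1 + θ)ϑ > 1 works: then (1 + θ) log N exceeds log τ by a growing margin that
  -- covers the constants.
  set ϑ : ℝ := 1 / (1 + θ / 2) with hϑ
  have hϑ0 : 0 < ϑ := by positivity
  have hϑ1 : ϑ < 1 := by rw [hϑ, div_lt_one (by positivity)]; linarith
  have hgap : 0 < (1 + θ) * ϑ - 1 := by
    rw [hϑ, mul_one_div, sub_pos, lt_div_iff₀ (by positivity)]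
    linarith
  -- N⁴ costs less than τ⁴ and (2N/τ)^K is at most 2^K τ^{-(1-ϑ)K}. Five powers leave τ^{-1}, which
  -- absorbs 2^K.
  refine ⟨⌈5 / (1 - ϑ)⌉₊, fun K hK X₀ => ?_⟩
  have hK' : 5 ≤ (1 - ϑ) * K := by
    have h := (Nat.le_ceil (5 / (1 - ϑ))).trans (Nat.cast_le.mpr hK)
    rw [div_le_iff₀ (by linarith)] at h
    linarith
  have hlog := Real.tendsto_log_atTop
  have hpow := tendsto_rpow_atTop (y := 1 - ϑ) (by linarith)
  filter_upwards [hlog.eventually_ge_atTop ((X₀ + 1) / ϑ),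
    hlog.eventually_ge_atTop ((6 + θ) / ((1 + θ) * ϑ - 1)),
    hpow.eventually_ge_atTop 2, eventually_ge_atTop (2 ^ K : ℝ), eventually_ge_atTop 1]
    with τ h1 h2 h3 h4 h5
  have hτ0 : 0 < τ := by linarith
  have hx1 : 1 ≤ τ ^ ϑ := Real.one_le_rpow h5 hϑ0.le
  have hx0 : 0 < τ ^ ϑ := by linarith
  have hN := half_le_natFloor hx1
  have hN2 : (⌊τ ^ ϑ⌋₊ : ℝ) ≤ τ ^ ϑ := Nat.floor_le hx0.le
  have hlogN : ϑ * Real.log τ - 1 ≤ Real.log ⌊τ ^ ϑ⌋₊ := by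
    refine le_trans ?_ (Real.log_le_log (by positivity) hN)
    rw [Real.log_div hx0.ne' two_ne_zero, Real.log_rpow hτ0]
    linarith [Real.log_two_lt_d9]
  have hsplit : τ ^ ϑ * τ ^ (1 - ϑ) = τ := by
    rw [← Real.rpow_add hτ0, add_sub_cancel, Real.rpow_one]
  refine ⟨⌊τ ^ ϑ⌋₊, (Nat.one_le_floor_iff _).mpr hx1, ?_, ?_, ?_, ?_⟩
  · calc 2 * (⌊τ ^ ϑ⌋₊ : ℝ) ≤ τ ^ (1 - ϑ) * τ ^ ϑ := by gcongr
      _ = τ := by rw [mul_comm, hsplit]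
  · calc (⌊τ ^ ϑ⌋₊ : ℝ) ^ 4 * (2 * ⌊τ ^ ϑ⌋₊ / τ) ^ K
        ≤ (τ ^ ϑ) ^ 4 * (2 * τ ^ ϑ / τ) ^ K := by gcongr
      _ = 2 ^ K * τ ^ (ϑ * 4 - (1 - ϑ) * K) := by
          rw [Real.rpow_sub hτ0, Real.rpow_mul hτ0.le, Real.rpow_mul hτ0.le, Real.rpow_natCast,
            div_pow, mul_pow, ← Real.rpow_natCast (τ ^ ϑ) 4]
          nth_rewrite 3 [← hsplit]
          rw [mul_pow]
          push_cast
          field_simp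
      _ ≤ τ * τ ^ (-1 : ℝ) := by
          gcongr
          linarith
      _ = 1 := by rw [Real.rpow_neg_one, mul_inv_cancel₀ hτ0.ne']
  · rw [div_le_iff₀ hϑ0] at h1
    linarith
  · rw [div_le_iff₀ hgap] at h2
    have h6 : Real.log (τ + 1) ≤ Real.log τ + 1 := by
      calc Real.log (τ + 1) ≤ Real.log (2 * τ) := Real.log_le_log (by linarith) (by linarith)
        _ = Real.log 2 + Real.log τ := Real.log_mul two_ne_zero hτ0.ne'
        _ ≤ _ := by linarith [Real.log_two_lt_d9]
    have h7 := mul_le_mul_of_nonneg_left hlogN (show 0 ≤ 1 + θ by linarith)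
    linarith

/-- The optimisation behind the choice of the squarefree sum: among `S ≥ c X`, the quotient
`S² / (S (l + 2 X) - c X²)` is smallest at `S = c X`. -/
theorem mul_quadratic_le {c S X l : ℝ} (hX : 0 ≤ X) (hl : 0 ≤ l) (hc : 0 ≤ c) (hS : c * X ≤ S) :
    c * X * (S * (l + 2 * X) - c * X ^ 2) ≤ S ^ 2 * (l + X) := by
  have h1 : 0 ≤ S := le_trans (by positivity) hS
  have h2 : 0 ≤ S * (l + X) - c * X ^ 2 := by nlinarith [mul_nonneg h1 hl]
  -- The difference of the two sides is exactly (S - cX)(S(l + X) - cX²).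
  nlinarith [mul_nonneg (sub_nonneg.mpr hS) h2]

/-- The final comparison with τ/(2π) scaled out: k = 2πκ for the target constant κ, and a₁, a₂X are
the errors of the two moments. The optimisation gives cΦ ≤ (2 + θ)S²; the slack δ leaves a surplus
of order X², which beats errors linear in X. -/
theorem moment_inequality {c k S X l J θ δ a₁ a₂ : ℝ} (hc : 0 < c) (hk : 0 ≤ k) (hX : 0 < X)
    (hl : 0 ≤ l) (hlX : l ≤ (1 + θ) * X) (hS : c * X ≤ S) (hS2 : S ≤ 2 * X)
    (hJ : J ∈ Icc (1 / 2 : ℝ) 1) (hδ : 0 < δ) (hkJ : k * (2 + θ) + δ * c ≤ c * J) (ha₁ : 0 ≤ a₁)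
    (hX₀ : 4 * a₁ + k * a₂ < δ * c ^ 2 / 2 * X) :
    k * (J * (S * (l + 2 * X) - c * X ^ 2) + a₂ * X) < (J * S - a₁) ^ 2 := by
  have hJ0 : 0 ≤ J := by linarith [hJ.1]
  have hS0 : 0 ≤ S := le_trans (by positivity) hS
  set Φ := S * (l + 2 * X) - c * X ^ 2 with hΦ
  have h1 : c * X * Φ ≤ S ^ 2 * (l + X) := mul_quadratic_le hX.le hl hc.le hS
  have h2 : c * X * Φ ≤ S ^ 2 * ((2 + θ) * X) := h1.trans (by gcongr; linarith)
  have h3 : c * Φ ≤ S ^ 2 * (2 + θ) := by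
    refine le_of_mul_le_mul_right ?_ hX
    linarith
  have h4 : k * Φ ≤ S ^ 2 * (J - δ) := by
    refine le_of_mul_le_mul_left ?_ hc
    calc c * (k * Φ) = k * (c * Φ) := by ring
      _ ≤ k * (S ^ 2 * (2 + θ)) := by gcongr
      _ = S ^ 2 * (k * (2 + θ)) := by ring
      _ ≤ S ^ 2 * (c * J - δ * c) := by gcongr; linarith
      _ = c * (S ^ 2 * (J - δ)) := by ring
  have h5 : k * (J * Φ) ≤ J ^ 2 * S ^ 2 - J * (δ * S ^ 2) := by
    calc k * (J * Φ) = J * (k * Φ) := by ring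
      _ ≤ J * (S ^ 2 * (J - δ)) := by gcongr
      _ = _ := by ring
  have h6 : δ * c ^ 2 / 2 * X * X ≤ J * (δ * S ^ 2) := by
    calc δ * c ^ 2 / 2 * X * X = 1 / 2 * (δ * (c * X) ^ 2) := by ring
      _ ≤ J * (δ * S ^ 2) := by gcongr; exact hJ.1
  have h7 : 2 * a₁ * (J * S) ≤ 4 * a₁ * X := by
    calc 2 * a₁ * (J * S) ≤ 2 * a₁ * (1 * (2 * X)) := by gcongr; exact hJ.2
      _ = _ := by ring
  have h8 := mul_lt_mul_of_pos_right hX₀ hX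
  nlinarith [sq_nonneg a₁]

set_option maxHeartbeats 400000 in
/-- The lower bound along heights at which the zeta function is not too small. -/
theorem eventually_le_reciprocalZetaDerivMoment (hRH : RiemannHypothesis)
    (hsimple : ∀ s : ℂ, riemannZeta s = 0 → deriv riemannZeta s ≠ 0) (C : ℕ) {ε : ℝ} (hε : 0 < ε)
    (hκ : 0 < 3 / (2 * Real.pi ^ 3) - ε) :
    ∀ᶠ τ : ℝ in atTop, HeightBound (τ ^ C) τ →
      (3 / (2 * Real.pi ^ 3) - ε) * τ ≤ reciprocalZetaDerivMoment τ := by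
  obtain ⟨b, hb, B, hB, hbB⟩ := exists_heightBound_low
  have hπ := Real.pi_gt_three
  set κ := 3 / (2 * Real.pi ^ 3) - ε with hκdef
  set c : ℝ := 6 / Real.pi ^ 2 with hc
  have hc0 : 0 < c := by positivity
  have hc1 : c ≤ 1 := by
    rw [hc, div_le_one (by positivity)]
    nlinarith
  -- One parameter serves as the loss in ∫P, the loss in the mollifier length and the slack δ in
  -- `moment_inequality`.
  set θ : ℝ := min (1 / 2) ε with hθ
  have hθ0 : 0 < θ := lt_min (by norm_num) hε
  have hθ1 : θ ≤ 1 / 2 := min_le_left _ _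
  have hθε : θ ≤ ε := min_le_right _ _
  obtain ⟨K₀, hK₀⟩ := exists_mollifier_length hθ0
  set K := max K₀ (2 * C + 4) with hK
  obtain ⟨P, hP0, hP1, hP01, hPint⟩ := exists_weight_polynomial K hθ0
  have hQ0 : Polynomial.X ^ K ∣ P ^ 2 := hP0.trans (dvd_pow_self P two_ne_zero)
  have hQ1 : (Polynomial.X - 1) ^ K ∣ P ^ 2 := hP1.trans (dvd_pow_self P two_ne_zero)
  obtain ⟨A₁, hA₁0, hA₁⟩ := exists_norm_firstMoment_sub_le hRH hsimple (C := C) hP0 hP1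
    (by have := le_max_right K₀ (2 * C + 4); omega) hb hB hbB
  obtain ⟨A₂, hA₂0, hA₂⟩ := exists_secondMoment_le hRH hsimple (C := C) hQ0 hQ1
    (fun x _ => by rw [Polynomial.eval_pow]; positivity) (le_max_right _ _) hb hB hbB
  set J := ∫ x in (0 : ℝ)..1, P.eval x with hJ
  set J₂ := ∫ x in (0 : ℝ)..1, (P ^ 2).eval x with hJ₂
  have hJ1 : J ≤ 1 := by
    have h := intervalIntegral.integral_mono_on (zero_le_one' ℝ)
      (P.continuous.intervalIntegrable (μ := volume) 0 1)
      (continuous_const.intervalIntegrable (μ := volume) 0 1) fun x hx => (hP01 x hx).2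
    simpa using h
  -- As 0 ≤ P ≤ 1, squaring the weight does not increase its integral, so J may replace J₂ in the
  -- second moment.
  have hJJ : J₂ ≤ J := by
    refine intervalIntegral.integral_mono_on (zero_le_one' ℝ)
      ((P ^ 2).continuous.intervalIntegrable 0 1) (P.continuous.intervalIntegrable 0 1)
      fun x hx => ?_
    rw [Polynomial.eval_pow]
    nlinarith [(hP01 x hx).1, (hP01 x hx).2]
  have hJmem : J ∈ Icc (1 / 2 : ℝ) 1 := ⟨by linarith, hJ1⟩
  set k := 2 * Real.pi * κ with hk
  have hk0 : 0 < k := by positivity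
  have hkc : k = c / 2 - 2 * Real.pi * ε := by
    rw [hk, hκdef, hc]
    field_simp
    ring
  -- The losses total at most 5cθ/2 ≤ 5ε/2, while lowering the constant by ε gains at least 4πε.
  have hkJ : k * (2 + θ) + θ * c ≤ c * J := by
    have h1 : c * (1 - θ) ≤ c * J := by gcongr
    have h2 : 0 ≤ Real.pi * ε * θ := by positivity
    have h3 : c * θ ≤ 1 * ε := by gcongr
    have h4 : 3 * ε ≤ Real.pi * ε := by gcongr
    rw [hkc]
    nlinarith
  set a₁ := 2 * Real.pi * A₁ with ha₁
  set a₂ := 2 * c + 4 * Real.pi * A₂ with ha₂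
  have ha₁0 : 0 ≤ a₁ := by positivity
  have hδc : 0 < θ * c ^ 2 / 2 := by positivity
  filter_upwards [hK₀ K (le_max_left _ _)
    (max 1 (max (2 * a₁ / c) ((4 * a₁ + k * a₂ + 1) / (θ * c ^ 2 / 2)))),
    eventually_ge_atTop 1] with τ hN hτ hτB
  obtain ⟨N, hN1, hNτ, hNK, hX₀, hlX⟩ := hN
  have hN1' : (1 : ℝ) ≤ N := by exact_mod_cast hN1
  have hτ0 : 0 < τ := by linarith
  set X := Real.log N with hX
  set l := Real.log (τ + 1) + 4 with hl
  have hl0 : 0 ≤ l := by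
    have := Real.log_nonneg (show 1 ≤ τ + 1 by linarith)
    linarith
  have hX1 : 1 ≤ X := (le_max_left _ _).trans hX₀
  have hXa : a₁ ≤ c * X / 2 := by
    have h := ((le_max_left _ _).trans (le_max_right _ _)).trans hX₀
    rw [div_le_iff₀ hc0] at h
    linarith
  have hXb : 4 * a₁ + k * a₂ < θ * c ^ 2 / 2 * X := by
    have h := ((le_max_right _ _).trans (le_max_right _ _)).trans hX₀
    rw [div_le_iff₀ hδc] at h
    linarith
  set S := squarefreeSum N with hS
  have hS1 : c * X ≤ S := log_le_squarefreeSum hN1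
  have hS2 : S ≤ 2 * X := (squarefreeSum_le N).trans (by linarith)
  have hS0 : 0 ≤ S := squarefreeSum_nonneg N
  have hSl0 : 0 ≤ squarefreeLogSum N := Finset.sum_nonneg fun n _ => by
    have := Real.log_natCast_nonneg n
    positivity
  have hineq := moment_inequality hc0 hk0.le (by linarith) hl0 hlX hS1 hS2 hJmem hθ0 hkJ ha₁0 hXb
  have hN3 : (N : ℝ) ^ 3 * (2 * N / τ) ^ K ≤ 1 := by
    refine le_trans ?_ hNK
    gcongr
    norm_num
  have hM1 := hA₁ τ N hτ hτB hN1 hNτ hN3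
  have hM2 := hA₂ τ N hτ hτB hN1 hNτ hNK
  have hCS := norm_firstMoment_sq_le (b := b) hRH hτB P N
  set M₁ := ∑ ρ ∈ zetaZerosBetween b τ,
    (deriv riemannZeta ρ)⁻¹ * (mollifier N (1 - ρ) * weight P τ ρ)
  set M₂ := ∑ ρ ∈ zetaZerosBetween b τ, (P ^ 2).eval (ρ.im / τ) * ‖mollifier N ρ‖ ^ 2
  have hM₂0 : 0 ≤ M₂ := Finset.sum_nonneg fun ρ _ => by
    rw [Polynomial.eval_pow]
    positivity
  set q := τ / (2 * Real.pi) with hq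
  have hq0 : 0 < q := by positivity
  have hlow : q * (J * S - a₁) ≤ ‖M₁‖ := by
    have e : ‖((q * (J * S) : ℝ) : ℂ)‖ = q * (J * S) := by
      rw [norm_real, Real.norm_of_nonneg]
      have := hJmem.1
      positivity
    have h := norm_sub_norm_le ((q * (J * S) : ℝ) : ℂ) M₁
    rw [e, norm_sub_rev] at h
    have e2 : ((q * (J * S) : ℝ) : ℂ) = τ / (2 * Real.pi) * (J * S : ℝ) := by
      rw [hq]
      push_cast
      ring
    rw [e2] at h
    have e3 : q * a₁ = A₁ * τ := by
      rw [hq, ha₁]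
      field_simp
    rw [mul_sub, e3]
    linarith
  have hJS : 0 ≤ J * S - a₁ := by
    have h := mul_le_mul_of_nonneg_right hJmem.1 hS0
    linarith
  have hup : M₂ ≤ q * (J * (S * (l + 2 * X) - c * X ^ 2) + a₂ * X) := by
    have hlog := two_mul_squarefreeLogSum_le hN1
    have hlog' : 2 * squarefreeLogSum N ≤ 2 * S * X - c * X ^ 2 + 2 * c := by
      refine hlog.trans ?_
      have : 0 ≤ c * (2 / (N : ℝ)) := by positivity
      rw [← hc, mul_sub c]
      linarith
    have h1 : J₂ * (S * l + 2 * squarefreeLogSum N) ≤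
        J * (S * (l + 2 * X) - c * X ^ 2) + 2 * c * X := by
      calc J₂ * (S * l + 2 * squarefreeLogSum N) ≤ J * (S * l + 2 * squarefreeLogSum N) := by
            gcongr
        _ ≤ J * (S * l + (2 * S * X - c * X ^ 2 + 2 * c)) := by
            have := hJmem.1
            gcongr
        _ = J * (S * (l + 2 * X) - c * X ^ 2) + J * (2 * c) := by ring
        _ ≤ _ := by
            have : J * (2 * c) ≤ X * (2 * c) := by
              gcongr
              exact hJ1.trans hX1
            linarith
    have h2 : A₂ * (τ * l) ≤ q * (4 * Real.pi * A₂ * X) := by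
      have h3 : l ≤ 2 * X := hlX.trans (by gcongr; linarith)
      calc A₂ * (τ * l) ≤ A₂ * (τ * (2 * X)) := by gcongr
        _ = _ := by rw [hq]; field_simp; ring
    calc M₂ ≤ _ := hM2
      _ ≤ q * (J * (S * (l + 2 * X) - c * X ^ 2) + 2 * c * X) + q * (4 * Real.pi * A₂ * X) := by
          gcongr
      _ = _ := by rw [ha₂]; ring
  by_contra! hlt
  have h1 : (q * (J * S - a₁)) ^ 2 ≤ κ * τ * (q * (J * (S * (l + 2 * X) - c * X ^ 2) + a₂ * X)) :=
    calc (q * (J * S - a₁)) ^ 2 ≤ ‖M₁‖ ^ 2 := pow_le_pow_left₀ (by positivity) hlow 2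
      _ ≤ _ := hCS
      _ ≤ κ * τ * M₂ := by gcongr
      _ ≤ _ := by gcongr
  have h2 : κ * τ = q * k := by
    rw [hq, hk]
    field_simp
  rw [h2] at h1
  have h3 : q ^ 2 * (J * S - a₁) ^ 2 ≤
      q ^ 2 * (k * (J * (S * (l + 2 * X) - c * X ^ 2) + a₂ * X)) := by linarith
  exact absurd (le_of_mul_le_mul_left h3 (by positivity)) (not_le.mpr hineq)

theorem mainTheorem1
    (hRH : RiemannHypothesis)
    (hsimple : ∀ s : ℂ, riemannZeta s = 0 → analyticOrderAt riemannZeta s = 1)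
    (ε : ℝ) (hε : 0 < ε) :
    ∃ T₀ : ℝ, ∀ T : ℝ, T₀ ≤ T →
      (3 / (2 * Real.pi ^ 3) - ε) * T ≤ reciprocalZetaDerivMoment T := by
  have hderiv : ∀ s : ℂ, riemannZeta s = 0 → deriv riemannZeta s ≠ 0 := fun s hs => by
    have h1 : s ≠ 1 := fun h => riemannZeta_one_ne_zero (h ▸ hs)
    exact deriv_ne_zero_of_analyticOrderAt_eq_one (DifferentiableOn.analyticAt (s := {1}ᶜ)
      (fun z hz => (differentiableAt_riemannZeta hz).differentiableWithinAt)
      (isOpen_compl_singleton.mem_nhds h1)) (hsimple s hs)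
  -- Half of ε goes to the bound at good heights, half to replacing T by τ ≥ T - 1. If the constant
  -- is not positive, the claim is trivial for T ≥ 0.
  rcases le_or_gt (3 / (2 * Real.pi ^ 3) - ε / 2) 0 with hneg | hpos
  · refine ⟨0, fun T hT => le_trans ?_ (reciprocalZetaDerivMoment_nonneg T)⟩
    exact mul_nonpos_of_nonpos_of_nonneg (by linarith) hT
  obtain ⟨C, T₁, hT₁⟩ := exists_heightBound_pow hderiv
  obtain ⟨T₂, hT₂⟩ := eventually_atTop.mp
    (eventually_le_reciprocalZetaDerivMoment hRH hderiv C (half_pos hε) hpos)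
  set κ := 3 / (2 * Real.pi ^ 3) - ε / 2 with hκ
  -- T₂ + 1 ensures τ ≥ T₂; T ≥ 2κ/ε makes the loss κ from T - 1 at most εT/2.
  refine ⟨max T₁ (max (T₂ + 1) (2 * κ / ε)), fun T hT => ?_⟩
  simp only [max_le_iff] at hT
  obtain ⟨hTa, hTb, hTc⟩ := hT
  obtain ⟨τ, hτ, hτB⟩ := hT₁ T hTa
  have h1 := hT₂ τ (by linarith [hτ.1]) hτB
  have h2 := reciprocalZetaDerivMoment_mono hτ.2
  rw [div_le_iff₀ hε] at hTc
  have h3 : κ * (T - 1) ≤ κ * τ := by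
    gcongr
    exact hτ.1
  have h4 : (3 / (2 * Real.pi ^ 3) - ε) * T = κ * T - T * ε / 2 := by rw [hκ]; ring
  linarith
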